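/- Let $p>3$ be a prime and let $L$ be a $\mathbb{Z}$-lattice on a (positive definite) ternary quadratic space over $\mathbb{Q}$ having, with respect to some $\mathbb{Z}$-basis, the Gram matrix $$\begin{pmatrix} 2&0&-p\\0&2&-p\\-p&-p&7p^2\end{pmatrix}$$ (the bilinear form $B$ and the quadratic form $Q$ being related by $Q(x)=B(x,x)$). Let $h(L)$ be the class number of $L$, that is, the number of isometry classes in the genus of $L$, where the genus of $L$ is the set of all lattices $M$ on the same quadratic space such that $M_q\cong L_q$ over $\mathbb{Z}_q$ for every prime $q$. Then $$h(L)=\begin{cases} \dfrac{p^2+6p+9}{16} & \text{if } p\equiv 1,5,13,17 \pmod{24},\\[2mm] \dfrac{p^2+4p+3}{16} & \text{if } p\equiv 7 \pmod{24},\\[2mm] \dfrac{p^2+4p+11}{16} & \text{if } p\equiv 11,19 \pmod{24},\\[2mm] \dfrac{p^2+4p+19}{16} & \text{if } p\equiv 23 \pmod{24}. \end{cases}$$ -/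

import Mathlib

open scoped TensorProduct

noncomputable section

namespace QuadraticSpace

variable {V : Type*} [AddCommGroup V] [Module ℚ V]

/-- The localization `L_q = ℤ_q L` of a `ℤ`-lattice `L` on a rational vector space `V`, as a
`ℤ_q`-submodule of `V_q = ℚ_q ⊗ V`. -/
def localization (q : ℕ) [Fact q.Prime] (L : Submodule ℤ V) :
    Submodule ℤ_[q] (ℚ_[q] ⊗[ℚ] V) :=
  Submodule.span ℤ_[q] ((fun v : V => (1 : ℚ_[q]) ⊗ₜ[ℚ] v) '' (L : Set V))

/-- `L_q` and `M_q` are isometric: some isometry of the quadratic space `V_q` carries one onto the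
other. -/
def LocallyIsometric (Q : QuadraticForm ℚ V) (q : ℕ) [Fact q.Prime] (L M : Submodule ℤ V) : Prop :=
  ∃ σ : (Q.baseChange ℚ_[q]).IsometryEquiv (Q.baseChange ℚ_[q]),
    σ '' (localization q L : Set (ℚ_[q] ⊗[ℚ] V)) = localization q M

/-- The genus of `L`: all lattices on the quadratic space `(V, Q)` that are isometric to `L`
at every prime. -/
def genus (Q : QuadraticForm ℚ V) (L : Submodule ℤ V) : Set (Submodule ℤ V) :=
  {M | M.IsLattice ℚ ∧ ∀ (q : ℕ) [Fact q.Prime], LocallyIsometric Q q L M}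

/-- Two lattices on `(V, Q)` are isometric (lie in the same class): some isometry of `(V, Q)`
carries one onto the other. -/
def Isometric (Q : QuadraticForm ℚ V) (L M : Submodule ℤ V) : Prop :=
  ∃ σ : Q.IsometryEquiv Q, σ '' (L : Set V) = M

theorem isometric_equivalence (Q : QuadraticForm ℚ V) : Equivalence (Isometric Q) where
  refl L := ⟨QuadraticMap.IsometryEquiv.refl Q, Set.image_id _⟩
  symm := by
    rintro L M ⟨σ, h⟩
    refine ⟨σ.symm, ?_⟩
    rw [← h, Set.image_image]
    simp
  trans := by
    rintro L M N ⟨σ, h⟩ ⟨τ, h'⟩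
    refine ⟨σ.trans τ, ?_⟩
    rw [← h', ← h, Set.image_image]
    rfl

/-- The relation of being isometric, on the genus of `L`. -/
def genusSetoid (Q : QuadraticForm ℚ V) (L : Submodule ℤ V) : Setoid (genus Q L) :=
  Setoid.comap Subtype.val ⟨Isometric Q, isometric_equivalence Q⟩

/-- The class number `h(L)`: the number of isometry classes in the genus of `L`. -/
def classNumber (Q : QuadraticForm ℚ V) (L : Submodule ℤ V) : ℕ :=
  Nat.card (Quotient (genusSetoid Q L))

/-- `L` has Gram matrix `A` with respect to some `ℤ`-basis; the bilinear form `B` of the space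
is normalized by `B(x, x) = Q(x)`. -/
def HasGramMatrix {n : ℕ} (Q : QuadraticForm ℚ V) (L : Submodule ℤ V)
    (A : Matrix (Fin n) (Fin n) ℤ) : Prop :=
  ∃ b : Module.Basis (Fin n) ℤ L,
    ∀ i j, QuadraticMap.associated (R := ℚ) Q (b i : V) (b j : V) = (A i j : ℚ)

end QuadraticSpace

end

/-! ### Localizations and Gram matrices in a genus. -/

namespace QuadraticSpace

variable {V : Type*} [AddCommGroup V] [Module ℚ V]

/-! In suitable rational coordinates the form is 2x² + 2y² + 6z², and L consists of the vectors
(a/2, b/2, k) with a ≡ b ≡ k mod 2 that are orthogonal modulo p to (0, 0, 1). Replacing (0, 0, 1) by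
a point s of the quadric x² + y² + 3z² = 3 over 𝔽_p gives `modelLattice c s`. The classes in the
genus of L correspond to the orbits on this quadric of the group `SignedSwap`, of order 16, of
automorphs of the integral lattice with form 2x² + 2y² + 6z². Burnside's lemma and quadratic
character sums count the orbits, and the counts depend on the residue of p modulo 24.

Every model lattice lies in the genus (`modelLattice_mem_genus`): it agrees with L away from p, and
at p a reflection carries s to ±(0, 0, 1). Conversely, let M be in the genus. Approximating the
local isometries at 2, 3 and p gives vectors of M whose Gram matrix is the given one modulo 96p³,
and from them a vector u. The vectors of M whose product with u is divisible by 12p generate,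
together with u, a lattice of determinant 24 on which the bilinear form is even. Half of that form
has determinant 3, and reduction theory (`exists_orthogonal_of_gramDet_eq_three`) shows that it is
x² + y² + 3z². In the resulting coordinates M is the model lattice of u modulo p
(`exists_eq_modelLattice`).

Finally, the integral lattice can be recovered from any model lattice by means of the form alone
(`mem_standardLattice_iff`). So an isometry between model lattices is a signed permutation of
coordinates, and a model lattice determines s up to sign (`isometric_modelLattice_iff`). -/

theorem isUnit_intCast_padicInt {q : ℕ} [Fact q.Prime] {n : ℤ} (hn : ¬ (q : ℤ) ∣ n) :
    IsUnit (n : ℤ_[q]) := by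
  rw [PadicInt.isUnit_iff]
  by_contra h
  exact hn ((PadicInt.norm_int_lt_one_iff_dvd n).1 (lt_of_le_of_ne (PadicInt.norm_le_one _) h))

/-- An integer prime to q is a unit of ℤ_q, so a rational map that respects the lattices only up to
denominators prime to q respects the localizations exactly. -/
theorem baseChange_mem_localization {q : ℕ} [Fact q.Prime] {L M : Submodule ℤ V}
    (σ : V →ₗ[ℚ] V) (h : ∀ v ∈ L, ∃ n : ℤ, ¬ (q : ℤ) ∣ n ∧ n • σ v ∈ M)
    {x : ℚ_[q] ⊗[ℚ] V} (hx : x ∈ localization q L) :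
    σ.baseChange ℚ_[q] x ∈ localization q M := by
  unfold localization at hx
  induction hx using Submodule.span_induction with
  | mem x hx =>
    obtain ⟨v, hv, rfl⟩ := hx
    obtain ⟨n, hn, hm⟩ := h v hv
    obtain ⟨u, hu⟩ := isUnit_intCast_padicInt hn
    have h1 : (1 : ℚ_[q]) ⊗ₜ[ℚ] (n • σ v) ∈ localization q M :=
      Submodule.subset_span ⟨_, hm, rfl⟩
    have h2 := (localization q M).smul_mem (↑u⁻¹ : ℤ_[q]) h1
    convert! h2 using 1
    have h3 : (1 : ℚ_[q]) ⊗ₜ[ℚ] (n • σ v) = (u : ℤ_[q]) • ((1 : ℚ_[q]) ⊗ₜ[ℚ] σ v) := by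
      rw [hu, ← Int.cast_smul_eq_zsmul ℚ, TensorProduct.tmul_smul, Int.cast_smul_eq_zsmul,
        Int.cast_smul_eq_zsmul]
    rw [h3, smul_smul]
    simp
  | zero => simp
  | add x y _ _ hx hy => rw [map_add]; exact add_mem hx hy
  | smul a x _ hx =>
    have : σ.baseChange ℚ_[q] (a • x) = a • σ.baseChange ℚ_[q] x :=
      LinearMap.map_smul_of_tower (σ.baseChange ℚ_[q]) a x
    rw [this]
    exact Submodule.smul_mem _ _ hx

/-- The base change of an isometry. -/
noncomputable def baseChangeIsometryEquiv {Q : QuadraticForm ℚ V} (q : ℕ) [Fact q.Prime]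
    (σ : Q.IsometryEquiv Q) :
    (Q.baseChange ℚ_[q]).IsometryEquiv (Q.baseChange ℚ_[q]) where
  toLinearEquiv := LinearEquiv.baseChange ℚ ℚ_[q] V V σ.toLinearEquiv
  map_app' := by
    have h : (Q.baseChange ℚ_[q]).comp
        ((LinearEquiv.baseChange ℚ ℚ_[q] V V σ.toLinearEquiv) : _ →ₗ[ℚ_[q]] _) =
        Q.baseChange ℚ_[q] := by
      apply baseChange_ext
      intro m
      simp
    intro x
    exact congrArg (fun Q' : QuadraticForm ℚ_[q] (ℚ_[q] ⊗[ℚ] V) => Q' x) h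

theorem locallyIsometric_of_isometryEquiv {Q : QuadraticForm ℚ V} {q : ℕ} [Fact q.Prime]
    {L M : Submodule ℤ V} (σ : Q.IsometryEquiv Q)
    (h : ∀ v ∈ L, ∃ n : ℤ, ¬ (q : ℤ) ∣ n ∧ n • σ v ∈ M)
    (h' : ∀ v ∈ M, ∃ n : ℤ, ¬ (q : ℤ) ∣ n ∧ n • σ.symm v ∈ L) :
    LocallyIsometric Q q L M := by
  refine ⟨baseChangeIsometryEquiv q σ, Set.Subset.antisymm ?_ ?_⟩
  · rintro _ ⟨x, hx, rfl⟩
    exact baseChange_mem_localization (σ.toLinearEquiv : V →ₗ[ℚ] V) h hx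
  · intro y hy
    refine ⟨_, baseChange_mem_localization (σ.symm.toLinearEquiv : V →ₗ[ℚ] V) h' hy, ?_⟩
    exact (LinearEquiv.baseChange ℚ ℚ_[q] V V σ.toLinearEquiv).apply_symm_apply y

theorem associated_baseChange_one_tmul (Q : QuadraticForm ℚ V) (q : ℕ) [Fact q.Prime] (x y : V) :
    QuadraticMap.associated (R := ℚ_[q]) (Q.baseChange ℚ_[q]) (1 ⊗ₜ x) (1 ⊗ₜ y) =
      ((QuadraticMap.associated (R := ℚ) Q x y : ℚ) : ℚ_[q]) := by
  rw [QuadraticForm.associated_baseChange]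
  simp [LinearMap.BilinForm.baseChange_tmul, Algebra.smul_def]

theorem localization_eq_span_basis {n : ℕ} (q : ℕ) [Fact q.Prime] {L : Submodule ℤ V}
    (b : Module.Basis (Fin n) ℤ L) :
    localization q L =
      Submodule.span ℤ_[q] (Set.range fun i => (1 : ℚ_[q]) ⊗ₜ[ℚ] (b i : V)) := by
  apply le_antisymm
  · refine Submodule.span_le.2 ?_
    rintro _ ⟨v, hv, rfl⟩
    have h := b.sum_repr ⟨v, hv⟩
    have h1 : v = ∑ i, (b.repr ⟨v, hv⟩ i) • (b i : V) := by
      have h2 := congrArg (fun x : L => (x : V)) h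
      simp only [AddSubmonoidClass.coe_finsetSum, SetLike.val_smul] at h2
      exact h2.symm
    simp only [SetLike.mem_coe]
    rw [h1, TensorProduct.tmul_sum]
    refine sum_mem fun i _ => ?_
    have : (1 : ℚ_[q]) ⊗ₜ[ℚ] ((b.repr ⟨v, hv⟩ i) • (b i : V)) =
        ((b.repr ⟨v, hv⟩ i : ℤ) : ℤ_[q]) • (1 : ℚ_[q]) ⊗ₜ[ℚ] (b i : V) := by
      rw [← Int.cast_smul_eq_zsmul ℚ, TensorProduct.tmul_smul, Int.cast_smul_eq_zsmul,
        Int.cast_smul_eq_zsmul]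
    rw [this]
    exact Submodule.smul_mem _ _ (Submodule.subset_span ⟨i, rfl⟩)
  · refine Submodule.span_le.2 ?_
    rintro _ ⟨i, rfl⟩
    exact Submodule.subset_span ⟨_, (b i).2, rfl⟩

/-- The Gram matrix of a family of vectors. -/
noncomputable def gram {n : ℕ} (Q : QuadraticForm ℚ V) (v : Fin n → V) :
    Matrix (Fin n) (Fin n) ℚ :=
  Matrix.of fun i j => QuadraticMap.associated (R := ℚ) Q (v i) (v j)

theorem sum_smul_eq_zero_of_isLattice {n : ℕ} (q : ℕ) [Fact q.Prime] {M : Submodule ℤ V}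
    (hM : M.IsLattice ℚ) (m : Module.Basis (Fin n) ℤ M) {c d : Fin n → ℤ_[q]}
    (h : ∑ i, c i • ((1 : ℚ_[q]) ⊗ₜ[ℚ] (m i : V)) = ∑ i, d i • ((1 : ℚ_[q]) ⊗ₜ[ℚ] (m i : V))) :
    c = d := by
  have hb := ((m.extendOfIsLattice ℚ).baseChange ℚ_[q]).linearIndependent
  rw [Fintype.linearIndependent_iff] at hb
  have h1 := hb (fun i => (c i : ℚ_[q]) - d i) (by
    simp only [Module.Basis.baseChange_apply, Module.Basis.extendOfIsLattice_apply, sub_smul,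
      Finset.sum_sub_distrib]
    rw [sub_eq_zero]
    exact h)
  funext i
  exact Subtype.coe_injective (sub_eq_zero.1 (h1 i))

/-- The rows of `T` are the coordinates of the σ(bᵢ) in the basis m, and those of `S` the
coordinates of the σ⁻¹(mⱼ) in the basis b. -/
theorem exists_matrix_of_locallyIsometric {n : ℕ} {Q : QuadraticForm ℚ V} {q : ℕ} [Fact q.Prime]
    {L M : Submodule ℤ V} (hL : L.IsLattice ℚ)
    (b : Module.Basis (Fin n) ℤ L) (m : Module.Basis (Fin n) ℤ M)
    (h : LocallyIsometric Q q L M) :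
    ∃ T S : Matrix (Fin n) (Fin n) ℤ_[q], T * S = 1 ∧
      (T.map ((↑) : ℤ_[q] → ℚ_[q])) * (gram Q fun i => (m i : V)).map ((↑) : ℚ → ℚ_[q]) *
        (T.map ((↑) : ℤ_[q] → ℚ_[q])).transpose =
      (gram Q fun i => (b i : V)).map ((↑) : ℚ → ℚ_[q]) := by
  obtain ⟨σ, hσ⟩ := h
  have h1 : ∀ i, ∃ t : Fin n → ℤ_[q],
      ∑ j, t j • ((1 : ℚ_[q]) ⊗ₜ[ℚ] (m j : V)) = σ (1 ⊗ₜ (b i : V)) := by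
    intro i
    rw [← Submodule.mem_span_range_iff_exists_fun, ← localization_eq_span_basis,
      ← SetLike.mem_coe, ← hσ]
    exact ⟨_, Submodule.subset_span ⟨_, (b i).2, rfl⟩, rfl⟩
  have h2 : ∀ j, ∃ s : Fin n → ℤ_[q],
      ∑ i, s i • ((1 : ℚ_[q]) ⊗ₜ[ℚ] (b i : V)) = σ.symm (1 ⊗ₜ (m j : V)) := by
    intro j
    rw [← Submodule.mem_span_range_iff_exists_fun, ← localization_eq_span_basis,
      ← SetLike.mem_coe]
    have : (1 : ℚ_[q]) ⊗ₜ[ℚ] (m j : V) ∈ (localization q M : Set (ℚ_[q] ⊗[ℚ] V)) :=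
      Submodule.subset_span ⟨_, (m j).2, rfl⟩
    rw [← hσ] at this
    obtain ⟨x, hx, hx'⟩ := this
    rw [← hx']
    simpa using hx
  choose T hT using h1
  choose S hS using h2
  refine ⟨Matrix.of T, Matrix.of S, ?_, ?_⟩
  · ext i k
    have h3 : ∑ j, T i j • σ.symm (1 ⊗ₜ (m j : V)) = 1 ⊗ₜ (b i : V) := by
      have := congrArg σ.symm (hT i)
      rw [QuadraticMap.IsometryEquiv.symm_apply_apply] at this
      rw [← this]
      have hlin : ∀ x, σ.symm x = σ.symm.toLinearEquiv x := fun _ => rfl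
      simp only [hlin]
      rw [map_sum]
      refine Finset.sum_congr rfl fun j _ => ?_
      exact (LinearMap.map_smul_of_tower σ.symm.toLinearEquiv.toLinearMap (T i j) _).symm
    have h4 : ∑ k, (∑ j, T i j * S j k) • ((1 : ℚ_[q]) ⊗ₜ[ℚ] (b k : V)) =
        ∑ k, ((1 : Matrix (Fin n) (Fin n) ℤ_[q]) i k) • ((1 : ℚ_[q]) ⊗ₜ[ℚ] (b k : V)) := by
      simp only [Finset.sum_smul, mul_smul]
      rw [Finset.sum_comm]
      simp only [← Finset.smul_sum, hS, h3]
      simp [Matrix.one_apply]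
    exact congrFun (sum_smul_eq_zero_of_isLattice q hL b h4) k
  · ext i k
    have h5 : QuadraticMap.associated (R := ℚ_[q]) (Q.baseChange ℚ_[q])
        (σ (1 ⊗ₜ (b i : V))) (σ (1 ⊗ₜ (b k : V))) =
        QuadraticMap.associated (R := ℚ_[q]) (Q.baseChange ℚ_[q]) (1 ⊗ₜ (b i : V)) (1 ⊗ₜ (b k : V)) := by
      simp only [QuadraticMap.associated_apply, ← map_add, QuadraticMap.IsometryEquiv.map_app]
    rw [associated_baseChange_one_tmul, ← hT i, ← hT k] at h5
    have hs : ∀ (a : ℤ_[q]) (x : ℚ_[q] ⊗[ℚ] V), a • x = (a : ℚ_[q]) • x := fun a x => rfl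
    simp only [hs, map_sum, map_smul, LinearMap.sum_apply, LinearMap.smul_apply,
      associated_baseChange_one_tmul, smul_eq_mul] at h5
    simp only [gram, Matrix.mul_apply, Matrix.map_apply, Matrix.of_apply, Matrix.transpose_apply]
    rw [← h5]
    refine Finset.sum_congr rfl fun j _ => ?_
    rw [Finset.sum_mul, Finset.mul_sum]
    refine Finset.sum_congr rfl fun l _ => ?_
    change ((T i l : ℤ_[q]) : ℚ_[q]) * _ * ((T k j : ℤ_[q]) : ℚ_[q]) = _
    ring

theorem Rat.exists_intCast_eq_of_padic_norm_le_one {r : ℚ}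
    (h : ∀ (q : ℕ) [Fact q.Prime], ‖(r : ℚ_[q])‖ ≤ 1) : ∃ n : ℤ, r = n := by
  refine ⟨r.num, ?_⟩
  have : r.den = 1 := by
    by_contra hd
    obtain ⟨q, hq, hqd⟩ := Nat.exists_prime_and_dvd hd
    have : Fact q.Prime := ⟨hq⟩
    have h1 := PadicInt.isUnit_den r (h q)
    rw [PadicInt.isUnit_iff] at h1
    have h2 := (PadicInt.norm_int_lt_one_iff_dvd (p := q) (r.den : ℤ)).2 (by exact_mod_cast hqd)
    rw [Int.cast_natCast, h1] at h2
    exact lt_irrefl _ h2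
  exact (Rat.den_eq_one_iff r).1 this |>.symm

theorem gram_sum_smul {n : ℕ} (Q : QuadraticForm ℚ V) (v : Fin n → V)
    (P : Matrix (Fin n) (Fin n) ℚ) :
    gram Q (fun i => ∑ j, P i j • v j) = P * gram Q v * P.transpose := by
  ext i k
  simp only [gram, Matrix.of_apply, Matrix.mul_apply, Matrix.transpose_apply, map_sum, map_smul,
    LinearMap.sum_apply, LinearMap.smul_apply, smul_eq_mul, Finset.sum_mul, Finset.mul_sum]
  refine Finset.sum_congr rfl fun j _ => Finset.sum_congr rfl fun l _ => ?_
  ring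

/-- Over each ℤ_q the Gram matrix of M is S A Sᵗ with S integral, so its rational entries are
q-integral for every q. -/
theorem exists_int_gram {n : ℕ} {Q : QuadraticForm ℚ V} {L M : Submodule ℤ V}
    (hL : L.IsLattice ℚ) (hM : M ∈ genus Q L)
    (b : Module.Basis (Fin n) ℤ L) (m : Module.Basis (Fin n) ℤ M) {A : Matrix (Fin n) (Fin n) ℤ}
    (hA : gram Q (fun i => (b i : V)) = A.map ((↑) : ℤ → ℚ)) :
    ∃ G : Matrix (Fin n) (Fin n) ℤ, gram Q (fun i => (m i : V)) = G.map ((↑) : ℤ → ℚ) ∧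
      ∀ (q : ℕ) [Fact q.Prime], ∃ T S : Matrix (Fin n) (Fin n) ℤ_[q], T * S = 1 ∧
        T * G.map ((↑) : ℤ → ℤ_[q]) * T.transpose = A.map ((↑) : ℤ → ℤ_[q]) := by
  have key : ∀ (q : ℕ) [Fact q.Prime], ∃ T S : Matrix (Fin n) (Fin n) ℤ_[q], T * S = 1 ∧
      (T.map (PadicInt.Coe.ringHom)) * (gram Q fun i => (m i : V)).map (Rat.castHom ℚ_[q]) *
        (T.map (PadicInt.Coe.ringHom)).transpose =
      (A.map ((↑) : ℤ → ℤ_[q])).map (PadicInt.Coe.ringHom (p := q)) := by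
    intro q _
    obtain ⟨T, S, h1, h2⟩ := exists_matrix_of_locallyIsometric hL b m (hM.2 q)
    refine ⟨T, S, h1, ?_⟩
    have h3 : (A.map ((↑) : ℤ → ℤ_[q])).map (PadicInt.Coe.ringHom (p := q)) =
        (gram Q fun i => (b i : V)).map ((↑) : ℚ → ℚ_[q]) := by
      rw [hA]
      ext i j
      simp
    rw [h3, ← h2]
    rfl
  have hint : ∀ i j, ∃ k : ℤ, gram Q (fun i => (m i : V)) i j = k := by
    intro i j
    apply Rat.exists_intCast_eq_of_padic_norm_le_one
    intro q _
    obtain ⟨T, S, h1, h2⟩ := key q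
    have h3 : S * T = 1 := mul_eq_one_comm.1 h1
    have h4 : (gram Q fun i => (m i : V)).map (Rat.castHom ℚ_[q]) =
        (S * A.map ((↑) : ℤ → ℤ_[q]) * S.transpose).map (PadicInt.Coe.ringHom (p := q)) := by
      rw [Matrix.map_mul, Matrix.map_mul, ← h2]
      have h5 : S.map (PadicInt.Coe.ringHom (p := q)) * T.map (PadicInt.Coe.ringHom (p := q)) = 1 := by
        rw [← Matrix.map_mul, h3]
        simp
      have h6 : (T.map (PadicInt.Coe.ringHom (p := q))).transpose *
          (S.transpose).map (PadicInt.Coe.ringHom (p := q)) = 1 := by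
        rw [Matrix.transpose_map, ← Matrix.transpose_mul, h5, Matrix.transpose_one]
      calc _ = 1 * (gram Q fun i => (m i : V)).map (Rat.castHom ℚ_[q]) * 1 := by simp
        _ = _ := by
          nth_rw 1 [← h5]
          rw [← h6]
          simp only [Matrix.mul_assoc]
    have h7 := congrFun (congrFun h4 i) j
    simp only [Matrix.map_apply] at h7
    have h8 : ((gram Q (fun i => (m i : V)) i j : ℚ) : ℚ_[q]) = _ := h7
    rw [h8]
    exact PadicInt.norm_le_one _
  choose G hG using hint
  have hG' : gram Q (fun i => (m i : V)) = (Matrix.of G).map ((↑) : ℤ → ℚ) := by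
    ext i j
    simpa using hG i j
  refine ⟨Matrix.of G, hG', fun q _ => ?_⟩
  obtain ⟨T, S, h1, h2⟩ := key q
  refine ⟨T, S, h1, ?_⟩
  have hinj : Function.Injective (PadicInt.Coe.ringHom (p := q)) := Subtype.coe_injective
  apply Matrix.map_injective hinj
  simp only
  rw [← h2, Matrix.map_mul, Matrix.map_mul, Matrix.transpose_map, hG']
  congr 2

/-- `F` is an approximate change of basis, modulo `N`, from the Gram matrix `G` to `A`. -/
def ApproxCongruent {n : ℕ} (G A : Matrix (Fin n) (Fin n) ℤ) (N : ℕ) : Prop :=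
  ∃ F : Matrix (Fin n) (Fin n) ℤ, IsCoprime F.det (N : ℤ) ∧
    (F * G * F.transpose).map ((↑) : ℤ → ZMod N) = A.map ((↑) : ℤ → ZMod N)

/-- Lift `T` modulo qᵏ to an integral matrix. Its determinant stays prime to the modulus because `T`
is invertible. -/
theorem approxCongruent_prime_pow {n : ℕ} {G A : Matrix (Fin n) (Fin n) ℤ} {q : ℕ} [Fact q.Prime]
    (h : ∃ T S : Matrix (Fin n) (Fin n) ℤ_[q], T * S = 1 ∧
        T * G.map ((↑) : ℤ → ℤ_[q]) * T.transpose = A.map ((↑) : ℤ → ℤ_[q])) (k : ℕ) :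
    ApproxCongruent G A (q ^ k) := by
  obtain ⟨T, S, h1, h2⟩ := h
  have hF : ∀ i j, ∃ z : ℤ, (z : ZMod (q ^ k)) = PadicInt.toZModPow k (T i j) :=
    fun i j => ZMod.intCast_surjective _
  choose F hF using hF
  have hF' : (Matrix.of F).map (Int.castRingHom (ZMod (q ^ k))) =
      T.map (PadicInt.toZModPow (p := q) k) := by
    ext i j
    simpa using hF i j
  refine ⟨Matrix.of F, ?_, ?_⟩
  · rw [isCoprime_comm, ← ZMod.coe_int_isUnit_iff_isCoprime]
    have h3 := congrArg (PadicInt.toZModPow (p := q) k) (congrArg Matrix.det h1)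
    rw [Matrix.det_mul, Matrix.det_one, map_mul, map_one, RingHom.map_det,
      RingHom.mapMatrix_apply, ← hF', ← RingHom.mapMatrix_apply, ← RingHom.map_det] at h3
    exact IsUnit.of_mul_eq_one _ h3
  · have h3 := congrArg (fun X : Matrix (Fin n) (Fin n) ℤ_[q] =>
      X.map (PadicInt.toZModPow (p := q) k)) h2
    simp only [Matrix.map_mul] at h3
    change Matrix.map _ (Int.castRingHom (ZMod (q ^ k))) = _
    rw [Matrix.map_mul, Matrix.map_mul, Matrix.transpose_map, hF']
    rw [Matrix.transpose_map] at h3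
    convert! h3 using 1
    · congr 2
      ext i j
      simp
    · ext i j
      simp

theorem ApproxCongruent.mul {n : ℕ} {G A : Matrix (Fin n) (Fin n) ℤ} {M N : ℕ}
    (hM : ApproxCongruent G A M) (hN : ApproxCongruent G A N) (h : M.Coprime N) :
    ApproxCongruent G A (M * N) := by
  obtain ⟨F, hF1, hF2⟩ := hM
  obtain ⟨F', hF1', hF2'⟩ := hN
  obtain ⟨u, v, huv⟩ := Nat.isCoprime_iff_coprime.2 h
  -- Chinese remainder entry by entry: vN is 1 modulo M and 0 modulo N, and uM the reverse.
  let E : Matrix (Fin n) (Fin n) ℤ := Matrix.of fun i j => v * N * F i j + u * M * F' i j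
  have hE : E.map (Int.castRingHom (ZMod M)) = F.map (Int.castRingHom (ZMod M)) := by
    ext i j
    have : ((v : ZMod M) * N) = 1 := by
      have := congrArg (Int.cast : ℤ → ZMod M) huv
      simpa using this
    simp [E, this]
  have hE' : E.map (Int.castRingHom (ZMod N)) = F'.map (Int.castRingHom (ZMod N)) := by
    ext i j
    have : ((u : ZMod N) * M) = 1 := by
      have := congrArg (Int.cast : ℤ → ZMod N) huv
      simpa using this
    simp [E, this]
  have hdet : ∀ (K : ℕ) (X Y : Matrix (Fin n) (Fin n) ℤ),
      X.map (Int.castRingHom (ZMod K)) = Y.map (Int.castRingHom (ZMod K)) →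
      IsCoprime Y.det (K : ℤ) → IsCoprime X.det (K : ℤ) := by
    intro K X Y hXY hY
    have h1 : ((X.det : ℤ) : ZMod K) = Y.det := by
      have h2 := congrArg Matrix.det hXY
      rw [← RingHom.mapMatrix_apply, ← RingHom.mapMatrix_apply, ← RingHom.map_det,
        ← RingHom.map_det] at h2
      simpa using h2
    rw [ZMod.intCast_eq_intCast_iff_dvd_sub] at h1
    obtain ⟨c, hc⟩ := h1
    have : X.det = Y.det + (K : ℤ) * (-c) := by linarith
    rw [this]
    exact (IsCoprime.add_mul_left_left_iff).2 hY
  have hcong : ∀ (K : ℕ) (X Y : Matrix (Fin n) (Fin n) ℤ),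
      X.map (Int.castRingHom (ZMod K)) = Y.map (Int.castRingHom (ZMod K)) →
      (Y * G * Y.transpose).map ((↑) : ℤ → ZMod K) = A.map ((↑) : ℤ → ZMod K) →
      ∀ i j, (K : ℤ) ∣ (X * G * X.transpose) i j - A i j := by
    intro K X Y hXY hY i j
    have h1 : (X * G * X.transpose).map (Int.castRingHom (ZMod K)) =
        A.map (Int.castRingHom (ZMod K)) := by
      refine Eq.trans ?_ hY
      change _ = Matrix.map _ (Int.castRingHom (ZMod K))
      simp only [Matrix.map_mul, Matrix.transpose_map, hXY]
    have h2 := congrFun (congrFun h1 i) j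
    simp only [Matrix.map_apply, Int.coe_castRingHom] at h2
    exact (ZMod.intCast_eq_intCast_iff_dvd_sub _ _ _).1 h2.symm
  refine ⟨E, ?_, ?_⟩
  · rw [Nat.cast_mul]
    exact IsCoprime.mul_right (hdet M E F hE hF1) (hdet N E F' hE' hF1')
  · ext i j
    simp only [Matrix.map_apply]
    refine ((ZMod.intCast_eq_intCast_iff_dvd_sub _ _ _).2 ?_).symm
    rw [Nat.cast_mul]
    exact IsCoprime.mul_dvd (Nat.isCoprime_iff_coprime.2 h) (hcong M E F hE hF2 i j)
      (hcong N E F' hE' hF2' i j)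

/-- In each ℤ_q the determinants differ by the square of a unit, so the same powers of q divide
both. The sign is settled in `det_gram_eq_of_mem_genus`. -/
theorem natAbs_det_eq {n : ℕ} {G A : Matrix (Fin n) (Fin n) ℤ}
    (h : ∀ (q : ℕ) [Fact q.Prime], ∃ T S : Matrix (Fin n) (Fin n) ℤ_[q], T * S = 1 ∧
        T * G.map ((↑) : ℤ → ℤ_[q]) * T.transpose = A.map ((↑) : ℤ → ℤ_[q])) :
    G.det.natAbs = A.det.natAbs := by
  have key : ∀ (q : ℕ) [Fact q.Prime], ∃ u : ℤ_[q], IsUnit u ∧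
      ((G.det : ℤ) : ℤ_[q]) * u = A.det := by
    intro q _
    obtain ⟨T, S, h1, h2⟩ := h q
    have h3 := congrArg Matrix.det h1
    rw [Matrix.det_mul, Matrix.det_one] at h3
    have hu : IsUnit T.det := IsUnit.of_mul_eq_one _ h3
    refine ⟨T.det * T.det, hu.mul hu, ?_⟩
    have h4 := congrArg Matrix.det h2
    rw [Matrix.det_mul, Matrix.det_mul, Matrix.det_transpose] at h4
    have h5 : ∀ X : Matrix (Fin n) (Fin n) ℤ, (X.map ((↑) : ℤ → ℤ_[q])).det = ((X.det : ℤ) : ℤ_[q]) := by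
      intro X
      exact (RingHom.map_det (Int.castRingHom ℤ_[q]) X).symm
    rw [h5, h5] at h4
    rw [← h4]
    ring
  have hdvd : ∀ (q k : ℕ), q.Prime → (q ^ k ∣ G.det.natAbs ↔ q ^ k ∣ A.det.natAbs) := by
    intro q k hq
    have : Fact q.Prime := ⟨hq⟩
    obtain ⟨u, hu, h1⟩ := key q
    rw [← Int.natCast_dvd, ← Int.natCast_dvd, Nat.cast_pow, ← PadicInt.pow_p_dvd_int_iff,
      ← PadicInt.pow_p_dvd_int_iff, ← h1, hu.dvd_mul_right]
  apply Nat.dvd_antisymm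
  · exact (Nat.dvd_iff_prime_pow_dvd_dvd _ _).2 fun q k hq hd => (hdvd q k hq).1 hd
  · exact (Nat.dvd_iff_prime_pow_dvd_dvd _ _).2 fun q k hq hd => (hdvd q k hq).2 hd

end QuadraticSpace

/-! ### Conics and a quadric over a finite field. -/

section PointCounts

variable {F : Type*} [Field F] [Fintype F] [DecidableEq F]

/-- The hyperbola (x − y)(x + y) = c is parametrized by the nonzero value t = x − y. -/
theorem card_sq_sub_sq_eq (h2 : (2 : F) ≠ 0) {c : F} (hc : c ≠ 0) :
    Finset.card {v : F × F | v.1 ^ 2 = v.2 ^ 2 + c} + 1 = Fintype.card F := by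
  have h4 : Finset.card ({v : F × F | v.1 ^ 2 = v.2 ^ 2 + c} : Finset (F × F)) =
      Finset.card (Finset.univ.erase (0 : F)) := by
    refine Finset.card_nbij' (fun v => v.1 - v.2) (fun t => ((c / t + t) / 2, (c / t - t) / 2))
      ?_ ?_ ?_ ?_
    · intro v hv
      simp only [Finset.coe_filter, Finset.mem_univ, true_and, Set.mem_ofPred_eq] at hv
      simp only [Finset.coe_erase, Finset.coe_univ, Set.mem_sdiff, Set.mem_univ,
        Set.mem_singleton_iff, true_and]
      intro h
      apply hc
      linear_combination -hv + (v.1 + v.2) * h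
    · intro t ht
      have ht : t ≠ 0 := by simpa using ht
      simp only [Finset.coe_filter, Finset.mem_univ, true_and, Set.mem_ofPred_eq]
      field_simp
      ring
    · intro v hv
      simp only [Finset.coe_filter, Finset.mem_univ, true_and, Set.mem_ofPred_eq] at hv
      have h : v.1 - v.2 ≠ 0 := by
        intro h
        apply hc
        linear_combination -hv + (v.1 + v.2) * h
      have h3 : c / (v.1 - v.2) = v.1 + v.2 := by
        rw [div_eq_iff h]
        linear_combination -hv
      ext
      · simp only [h3]
        field_simp
        ring
      · simp only [h3]
        field_simp
        ring
    · intro t ht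
      have ht : t ≠ 0 := by simpa using ht
      simp only
      field_simp
      ring
  rw [h4, Finset.card_erase_add_one (Finset.mem_univ _), Finset.card_univ]

theorem card_prod_filter_eq_sum {α β : Type*} [Fintype α] [Fintype β]
    (P : α → β → Prop) [DecidablePred fun v : α × β => P v.1 v.2]
    [∀ y, DecidablePred fun x => P x y] :
    Finset.card {v : α × β | P v.1 v.2} = ∑ y, Finset.card {x : α | P x y} := by
  simp only [Finset.card_filter]
  rw [Fintype.sum_prod_type, Finset.sum_comm]

theorem ringChar_ne_two_of_two_ne_zero {F : Type*} [Field F] (h2 : (2 : F) ≠ 0) : ringChar F ≠ 2 := by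
  intro h
  apply h2
  have := ringChar.Nat.cast_ringChar (R := F)
  rw [h] at this
  exact_mod_cast this

theorem card_sq_eq (h2 : (2 : F) ≠ 0) (c : F) :
    (Finset.card {x : F | x ^ 2 = c} : ℤ) = quadraticChar F c + 1 := by
  rw [← quadraticChar_card_sqrts (ringChar_ne_two_of_two_ne_zero h2) c]
  congr 2
  ext x
  simp

/-- Counting the hyperbola x² = y² + c fibrewise over y gives the sum of χ(y² + c) + 1, which must
equal the number of nonzero elements. -/
theorem sum_quadraticChar_sq_add (h2 : (2 : F) ≠ 0) {c : F} (hc : c ≠ 0) :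
    ∑ y : F, quadraticChar F (y ^ 2 + c) = -1 := by
  have h := card_sq_sub_sq_eq h2 hc
  have e := card_prod_filter_eq_sum (fun x y : F => x ^ 2 = y ^ 2 + c)
  have h := e ▸ h
  have h' : (∑ y : F, (quadraticChar F (y ^ 2 + c) + 1)) + 1 = (Fintype.card F : ℤ) := by
    rw [← h]
    push_cast
    simp only [card_sq_eq h2]
  rw [Finset.sum_add_distrib] at h'
  simp only [Finset.sum_const, Finset.card_univ, nsmul_eq_mul, mul_one] at h'
  linarith

theorem quadraticChar_mul_self {a : F} (ha : a ≠ 0) :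
    quadraticChar F a * quadraticChar F a = 1 := by
  rw [← map_mul, ← sq]
  exact quadraticChar_sq_one' ha

theorem card_mul_sq_eq (h2 : (2 : F) ≠ 0) {α γ : F} (hα : α ≠ 0) :
    (Finset.card {x : F | α * x ^ 2 = γ} : ℤ) = quadraticChar F (α * γ) + 1 := by
  have h : ∀ x : F, α * x ^ 2 = γ ↔ x ^ 2 = γ / α := fun x => by
    rw [eq_div_iff hα, mul_comm]
  simp only [h, card_sq_eq h2]
  have : α * γ = (γ / α) * (α * α) := by field_simp
  rw [this, map_mul, map_mul, quadraticChar_mul_self hα, mul_one]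

/-- Solving for x over each y contributes χ(α(γ − βy²)) + 1, and the character is χ(−αβ) χ(y² −
γ/β), so the previous sum applies. -/
theorem card_conic (h2 : (2 : F) ≠ 0) {α β γ : F} (hα : α ≠ 0) (hβ : β ≠ 0) (hγ : γ ≠ 0) :
    (Finset.card {v : F × F | α * v.1 ^ 2 + β * v.2 ^ 2 = γ} : ℤ) =
      Fintype.card F - quadraticChar F (-(α * β)) := by
  rw [card_prod_filter_eq_sum (fun x y : F => α * x ^ 2 + β * y ^ 2 = γ)]
  have h : ∀ x y : F, α * x ^ 2 + β * y ^ 2 = γ ↔ α * x ^ 2 = γ - β * y ^ 2 := fun x y => by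
    rw [eq_sub_iff_add_eq]
  push_cast
  simp only [h, card_mul_sq_eq h2 hα]
  have h3 : ∀ y : F, quadraticChar F (α * (γ - β * y ^ 2)) =
      quadraticChar F (-(α * β)) * quadraticChar F (y ^ 2 + -(γ / β)) := by
    intro y
    rw [← map_mul]
    congr 1
    field_simp
    ring
  simp only [h3]
  rw [Finset.sum_add_distrib, ← Finset.mul_sum, sum_quadraticChar_sq_add h2
    (neg_ne_zero.2 (div_ne_zero hγ hβ))]
  simp
  ring

theorem card_sum_two_squares_eq_zero (h2 : (2 : F) ≠ 0) :
    (Finset.card {v : F × F | v.1 ^ 2 + v.2 ^ 2 = 0} : ℤ) =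
      Fintype.card F + (Fintype.card F - 1) * quadraticChar F (-1) := by
  rw [card_prod_filter_eq_sum (fun x y : F => x ^ 2 + y ^ 2 = 0)]
  have h : ∀ x y : F, x ^ 2 + y ^ 2 = 0 ↔ x ^ 2 = - y ^ 2 := fun x y => by
    rw [eq_neg_iff_add_eq_zero]
  push_cast
  simp only [h, card_sq_eq h2]
  rw [Finset.sum_add_distrib]
  have h3 : ∀ y : F, quadraticChar F (-y ^ 2) = if y = 0 then 0 else quadraticChar F (-1) := by
    intro y
    split_ifs with hy
    · simp [hy]
    · rw [neg_eq_neg_one_mul, map_mul, quadraticChar_sq_one' hy, mul_one]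
  simp only [h3, Finset.sum_ite, Finset.sum_const_zero, zero_add, Finset.sum_const, nsmul_eq_mul]
  have h4 : Finset.card ({x : F | ¬ x = 0} : Finset F) + 1 = Fintype.card F := by
    rw [← Finset.card_univ, ← Finset.card_erase_add_one (Finset.mem_univ (0 : F))]
    congr 2
    ext x
    simp
  have h5 : (Finset.card ({x : F | ¬ x = 0} : Finset F) : ℤ) = Fintype.card F - 1 := by
    rw [← h4]; simp
  rw [h5]
  simp
  ring

/-- Slice by z: a slice with z² = 1 degenerates to x² + y² = 0, and every other slice is a
nondegenerate conic. -/
theorem card_quadric (h2 : (2 : F) ≠ 0) (h3 : (3 : F) ≠ 0) :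
    (Finset.card {v : (F × F) × F | v.1.1 ^ 2 + v.1.2 ^ 2 + 3 * v.2 ^ 2 = 3} : ℤ) =
      Fintype.card F ^ 2 + Fintype.card F * quadraticChar F (-1) := by
  rw [card_prod_filter_eq_sum (fun (x : F × F) (z : F) => x.1 ^ 2 + x.2 ^ 2 + 3 * z ^ 2 = 3)]
  push_cast
  have h : ∀ z : F, (Finset.card {v : F × F | v.1 ^ 2 + v.2 ^ 2 + 3 * z ^ 2 = 3} : ℤ) =
      (if z ^ 2 = 1 then (Fintype.card F : ℤ) * quadraticChar F (-1) else 0) +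
      (Fintype.card F - quadraticChar F (-1)) := by
    intro z
    split_ifs with hz
    · have h4 : ∀ v : F × F, v.1 ^ 2 + v.2 ^ 2 + 3 * z ^ 2 = 3 ↔ v.1 ^ 2 + v.2 ^ 2 = 0 := by
        intro v
        rw [hz, mul_one, add_eq_right]
      simp only [h4, card_sum_two_squares_eq_zero h2]
      ring
    · have h4 : ∀ v : F × F, v.1 ^ 2 + v.2 ^ 2 + 3 * z ^ 2 = 3 ↔
          1 * v.1 ^ 2 + 1 * v.2 ^ 2 = 3 * (1 - z ^ 2) := by
        intro v
        constructor <;> intro h <;> linear_combination h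
      simp only [h4]
      rw [card_conic h2 one_ne_zero one_ne_zero (mul_ne_zero h3 (sub_ne_zero.2 (Ne.symm hz)))]
      simp
  simp only [h]
  rw [Finset.sum_add_distrib, ← Finset.sum_filter, Finset.sum_const, nsmul_eq_mul, card_sq_eq h2]
  simp
  ring

end PointCounts

/-! ### The group of order 16 and its orbits on the quadric. -/

/-- The group of order sixteen of signed permutations of three coordinates which fix the third
coordinate up to sign: `(t, a, b, c)` multiplies the coordinates by the signs `a`, `b`, `c`, after
swapping the first two if `t` holds. -/
@[ext]
structure SignedSwap where
  t : Bool
  a : ℤˣ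
  b : ℤˣ
  c : ℤˣ

namespace SignedSwap

/-- The tuple of entries. -/
def equivProd : SignedSwap ≃ Bool × ℤˣ × ℤˣ × ℤˣ where
  toFun g := (g.t, g.a, g.b, g.c)
  invFun x := ⟨x.1, x.2.1, x.2.2.1, x.2.2.2⟩
  left_inv _ := rfl
  right_inv _ := rfl

instance : Fintype SignedSwap := Fintype.ofEquiv _ equivProd.symm

instance : Mul SignedSwap where
  mul g h := ⟨xor g.t h.t, g.a * (if g.t then h.b else h.a), g.b * (if g.t then h.a else h.b),
    g.c * h.c⟩

instance : One SignedSwap := ⟨⟨false, 1, 1, 1⟩⟩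

instance : Inv SignedSwap where
  inv g := ⟨g.t, if g.t then g.b else g.a, if g.t then g.a else g.b, g.c⟩

theorem mul_def (g h : SignedSwap) : g * h = ⟨xor g.t h.t, g.a * (if g.t then h.b else h.a),
    g.b * (if g.t then h.a else h.b), g.c * h.c⟩ := rfl

theorem one_def : (1 : SignedSwap) = ⟨false, 1, 1, 1⟩ := rfl

theorem inv_def (g : SignedSwap) : g⁻¹ =
    ⟨g.t, if g.t then g.b else g.a, if g.t then g.a else g.b, g.c⟩ := rfl

instance : Group SignedSwap := Group.ofLeftAxioms
  (by
    rintro ⟨t, a, b, c⟩ ⟨t', a', b', c'⟩ ⟨t'', a'', b'', c''⟩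
    cases t <;> cases t' <;> cases t'' <;> simp [mul_def, mul_assoc])
  (by
    rintro ⟨t, a, b, c⟩
    cases t <;> simp [mul_def, one_def])
  (by
    rintro ⟨t, a, b, c⟩
    cases t <;> simp [mul_def, one_def, inv_def, Int.units_mul_self])

theorem card_eq : Fintype.card SignedSwap = 16 := by
  rw [Fintype.card_congr equivProd]
  simp [Fintype.card_prod]

instance {A : Type*} [AddCommGroup A] : SMul SignedSwap (A × A × A) where
  smul g v := (g.a • (if g.t then v.2.1 else v.1), g.b • (if g.t then v.1 else v.2.1), g.c • v.2.2)

theorem smul_def {A : Type*} [AddCommGroup A] (g : SignedSwap) (v : A × A × A) :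
    g • v = (g.a • (if g.t then v.2.1 else v.1), g.b • (if g.t then v.1 else v.2.1),
      g.c • v.2.2) := rfl

instance {A : Type*} [AddCommGroup A] : MulAction SignedSwap (A × A × A) where
  one_smul v := by simp [smul_def, one_def]
  mul_smul := by
    rintro ⟨t, a, b, c⟩ ⟨t', a', b', c'⟩ v
    cases t <;> cases t' <;> simp [mul_def, smul_def, mul_smul]

end SignedSwap

/-- The points with `x² + y² + 3z² = 3`. -/
def quadricPoints (F : Type*) [Field F] : Set (F × F × F) :=
  {v | v.1 ^ 2 + v.2.1 ^ 2 + 3 * v.2.2 ^ 2 = 3}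

theorem units_smul_sq {F : Type*} [Field F] (a : ℤˣ) (x : F) : (a • x) ^ 2 = x ^ 2 := by
  rcases Int.units_eq_one_or a with rfl | rfl <;> simp

theorem SignedSwap.smul_mem_quadricPoints {F : Type*} [Field F] (g : SignedSwap) {v : F × F × F}
    (hv : v ∈ quadricPoints F) : g • v ∈ quadricPoints F := by
  unfold quadricPoints at hv ⊢
  simp only [Set.mem_ofPred_eq, SignedSwap.smul_def, units_smul_sq] at hv ⊢
  cases g.t <;> simp only [if_true, if_false, Bool.false_eq_true] <;> linear_combination hv

instance (F : Type*) [Field F] : MulAction SignedSwap (quadricPoints F) where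
  smul g v := ⟨g • v.1, g.smul_mem_quadricPoints v.2⟩
  one_smul v := Subtype.ext (one_smul _ v.1)
  mul_smul g h v := Subtype.ext (mul_smul g h v.1)

section

variable {F : Type*} [Field F] [Fintype F] [DecidableEq F]

/-- The number of points of the quadric which are fixed by `g`. -/
def fixedCard (F : Type*) [Field F] [Fintype F] [DecidableEq F] (g : SignedSwap) : ℕ :=
  Finset.card {v : F × F × F | v.1 ^ 2 + v.2.1 ^ 2 + 3 * v.2.2 ^ 2 = 3 ∧ g • v = v}

/-- Burnside's lemma. -/
theorem sum_fixedCard :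
    ∑ g : SignedSwap, fixedCard F g =
      Nat.card (MulAction.orbitRel.Quotient SignedSwap (quadricPoints F)) * 16 := by
  classical
  have h := MulAction.sum_card_fixedBy_eq_card_orbits_mul_card_group SignedSwap (quadricPoints F)
  rw [SignedSwap.card_eq, ← Nat.card_eq_fintype_card] at h
  refine Eq.trans (Finset.sum_congr rfl fun g _ => ?_) h
  unfold fixedCard
  rw [← Set.toFinset_card]
  symm
  refine Finset.card_bij (fun v _ => v.1) ?_ ?_ ?_
  · intro v hv
    simp only [Set.mem_toFinset, MulAction.mem_fixedBy] at hv
    simp only [Finset.mem_filter, Finset.mem_univ, true_and]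
    exact ⟨v.2, congrArg Subtype.val hv⟩
  · intro v _ w _ h
    exact Subtype.ext h
  · intro v hv
    simp only [Finset.mem_filter, Finset.mem_univ, true_and] at hv
    refine ⟨⟨v, hv.1⟩, ?_, rfl⟩
    simp only [Set.mem_toFinset, MulAction.mem_fixedBy]
    exact Subtype.ext hv.2

theorem neg_eq_self_iff_of_two_ne_zero {F : Type*} [Field F] (h2 : (2 : F) ≠ 0) (x : F) : -x = x ↔ x = 0 := by
  constructor
  · intro h
    have : 2 * x = 0 := by linear_combination -h
    simpa [h2] using this
  · rintro rfl
    simp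

/-- Being fixed by g kills or identifies coordinates. This lemma replaces the fixed locus on the
quadric by a conic, or by an equation in one variable, in the remaining coordinates. -/
theorem card_filter_eq_of_parametrization {α β : Type*} [Fintype α] [Fintype β]
    (P : α → Prop) (P' : β → Prop) [DecidablePred P] [DecidablePred P'] (f : β → α)
    (hf : Function.Injective f) (h : ∀ x, P x ↔ ∃ y, P' y ∧ f y = x) :
    Finset.card {x | P x} = Finset.card {y | P' y} := by
  symm
  refine Finset.card_bij (fun y _ => f y) ?_ (fun _ _ _ _ h => hf h) ?_
  · intro y hy
    simp only [Finset.mem_filter, Finset.mem_univ, true_and] at hy ⊢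
    exact (h _).2 ⟨y, hy, rfl⟩
  · intro x hx
    simp only [Finset.mem_filter, Finset.mem_univ, true_and] at hx
    obtain ⟨y, hy, rfl⟩ := (h x).1 hx
    exact ⟨y, by simpa using hy, rfl⟩

theorem fixedCard_one (h2 : (2 : F) ≠ 0) (h3 : (3 : F) ≠ 0) :
    (fixedCard F ⟨false, 1, 1, 1⟩ : ℤ) =
      Fintype.card F ^ 2 + Fintype.card F * quadraticChar F (-1) := by
  rw [← card_quadric h2 h3]
  unfold fixedCard
  congr 1
  refine card_filter_eq_of_parametrization _ _ (fun v => (v.1.1, v.1.2, v.2)) ?_ ?_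
  · rintro ⟨⟨x, y⟩, z⟩ ⟨⟨x', y'⟩, z'⟩ h
    simpa [and_assoc] using h
  · rintro ⟨x, y, z⟩
    simp [SignedSwap.smul_def]

theorem fixedCard_c (h2 : (2 : F) ≠ 0) (h3 : (3 : F) ≠ 0) :
    (fixedCard F ⟨false, 1, 1, -1⟩ : ℤ) = Fintype.card F - quadraticChar F (-1) := by
  have h := card_conic h2 (one_ne_zero : (1 : F) ≠ 0) (one_ne_zero : (1 : F) ≠ 0) h3
  rw [mul_one] at h
  rw [← h]
  unfold fixedCard
  congr 1
  refine card_filter_eq_of_parametrization _ _ (fun v => (v.1, v.2, 0)) ?_ ?_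
  · rintro ⟨x, y⟩ ⟨x', y'⟩ h
    simpa using h
  · rintro ⟨x, y, z⟩
    simp [SignedSwap.smul_def, neg_eq_self_iff_of_two_ne_zero h2]
    grind

theorem fixedCard_b (h2 : (2 : F) ≠ 0) (h3 : (3 : F) ≠ 0) :
    (fixedCard F ⟨false, 1, -1, 1⟩ : ℤ) = Fintype.card F - quadraticChar F (-3) := by
  have h := card_conic h2 (one_ne_zero : (1 : F) ≠ 0) h3 h3
  rw [one_mul] at h
  rw [← h]
  unfold fixedCard
  congr 1
  refine card_filter_eq_of_parametrization _ _ (fun v => (v.1, 0, v.2)) ?_ ?_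
  · rintro ⟨x, y⟩ ⟨x', y'⟩ h
    simpa using h
  · rintro ⟨x, y, z⟩
    simp [SignedSwap.smul_def, neg_eq_self_iff_of_two_ne_zero h2]
    grind

theorem fixedCard_a (h2 : (2 : F) ≠ 0) (h3 : (3 : F) ≠ 0) :
    (fixedCard F ⟨false, -1, 1, 1⟩ : ℤ) = Fintype.card F - quadraticChar F (-3) := by
  have h := card_conic h2 (one_ne_zero : (1 : F) ≠ 0) h3 h3
  rw [one_mul] at h
  rw [← h]
  unfold fixedCard
  congr 1
  refine card_filter_eq_of_parametrization _ _ (fun v => (0, v.1, v.2)) ?_ ?_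
  · rintro ⟨x, y⟩ ⟨x', y'⟩ h
    simpa using h
  · rintro ⟨x, y, z⟩
    simp [SignedSwap.smul_def, neg_eq_self_iff_of_two_ne_zero h2]
    grind

theorem fixedCard_ab (h2 : (2 : F) ≠ 0) (h3 : (3 : F) ≠ 0) :
    (fixedCard F ⟨false, -1, -1, 1⟩ : ℤ) = 2 := by
  have h := card_mul_sq_eq h2 (γ := 3) h3
  rw [map_mul, quadraticChar_mul_self h3] at h
  rw [show (2 : ℤ) = 1 + 1 from rfl, ← h]
  unfold fixedCard
  congr 1
  refine card_filter_eq_of_parametrization _ _ (fun z => (0, 0, z)) ?_ ?_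
  · intro z z' h
    simpa using h
  · rintro ⟨x, y, z⟩
    simp [SignedSwap.smul_def, neg_eq_self_iff_of_two_ne_zero h2]
    grind

theorem fixedCard_ac (h2 : (2 : F) ≠ 0) :
    (fixedCard F ⟨false, -1, 1, -1⟩ : ℤ) = quadraticChar F 3 + 1 := by
  rw [← card_sq_eq h2]
  unfold fixedCard
  congr 1
  refine card_filter_eq_of_parametrization _ _ (fun z => (0, z, 0)) ?_ ?_
  · intro z z' h
    simpa using h
  · rintro ⟨x, y, z⟩
    simp [SignedSwap.smul_def, neg_eq_self_iff_of_two_ne_zero h2]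
    grind

theorem fixedCard_bc (h2 : (2 : F) ≠ 0) :
    (fixedCard F ⟨false, 1, -1, -1⟩ : ℤ) = quadraticChar F 3 + 1 := by
  rw [← card_sq_eq h2]
  unfold fixedCard
  congr 1
  refine card_filter_eq_of_parametrization _ _ (fun z => (z, 0, 0)) ?_ ?_
  · intro z z' h
    simpa using h
  · rintro ⟨x, y, z⟩
    simp [SignedSwap.smul_def, neg_eq_self_iff_of_two_ne_zero h2]
    grind

/-- Only the origin is fixed, and it is not on the quadric since 3 ≠ 0. -/
theorem fixedCard_abc (h2 : (2 : F) ≠ 0) (h3 : (3 : F) ≠ 0) :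
    fixedCard F ⟨false, -1, -1, -1⟩ = 0 := by
  unfold fixedCard
  rw [Finset.card_eq_zero, Finset.filter_eq_empty_iff]
  rintro ⟨x, y, z⟩ -
  simp [SignedSwap.smul_def, neg_eq_self_iff_of_two_ne_zero h2]
  rintro h rfl rfl rfl
  simp at h
  exact h3 h.symm

theorem units_smul_eq_intCast_mul {F : Type*} [Field F] (a : ℤˣ) (x : F) : a • x = ((a : ℤ) : F) * x := by
  rw [Units.smul_def, zsmul_eq_mul]

theorem units_cast_mul_self {F : Type*} [Field F] (a : ℤˣ) : ((a : ℤ) : F) * ((a : ℤ) : F) = 1 := by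
  rw [← Int.cast_mul, ← Units.val_mul, Int.units_mul_self]
  simp

theorem fixedCard_swap (h2 : (2 : F) ≠ 0) (h3 : (3 : F) ≠ 0) (a : ℤˣ) :
    (fixedCard F ⟨true, a, a, 1⟩ : ℤ) = Fintype.card F - quadraticChar F (-6) := by
  have h := card_conic h2 h2 h3 h3
  rw [show (-(2 * 3) : F) = -6 by ring] at h
  rw [← h]
  unfold fixedCard
  congr 1
  refine card_filter_eq_of_parametrization _ _ (fun v => (v.1, a • v.1, v.2)) ?_ ?_
  · rintro ⟨x, y⟩ ⟨x', y'⟩ h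
    have := congrArg Prod.fst h
    have := congrArg (fun x => x.2.2) h
    simp_all
  · rintro ⟨x, y, z⟩
    simp only [SignedSwap.smul_def, units_smul_eq_intCast_mul]
    have ha := units_cast_mul_self (F := F) a
    generalize ((a : ℤ) : F) = α at *
    simp
    grind

theorem fixedCard_swap_c (h2 : (2 : F) ≠ 0) (a : ℤˣ) :
    (fixedCard F ⟨true, a, a, -1⟩ : ℤ) = quadraticChar F 6 + 1 := by
  have h := card_mul_sq_eq h2 (γ := 3) h2
  rw [show (2 * 3 : F) = 6 by ring] at h
  rw [← h]
  unfold fixedCard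
  congr 1
  refine card_filter_eq_of_parametrization _ _ (fun v => (v, a • v, 0)) ?_ ?_
  · intro x x' h
    exact congrArg Prod.fst h
  · rintro ⟨x, y, z⟩
    simp only [SignedSwap.smul_def, units_smul_eq_intCast_mul]
    have ha := units_cast_mul_self (F := F) a
    generalize ((a : ℤ) : F) = α at *
    simp [neg_eq_self_iff_of_two_ne_zero h2]
    grind

/-- A fixed point has x = ay and y = −ax, hence 2x = 0 and x = y = 0. This leaves 3z² = 3. -/
theorem fixedCard_rotation (h2 : (2 : F) ≠ 0) (h3 : (3 : F) ≠ 0) (a : ℤˣ) :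
    (fixedCard F ⟨true, a, -a, 1⟩ : ℤ) = 2 := by
  have h := card_mul_sq_eq h2 (γ := 3) h3
  rw [map_mul, quadraticChar_mul_self h3] at h
  rw [show (2 : ℤ) = 1 + 1 from rfl, ← h]
  unfold fixedCard
  congr 1
  refine card_filter_eq_of_parametrization _ _ (fun z => (0, 0, z)) ?_ ?_
  · intro z z' h
    simpa using h
  · rintro ⟨x, y, z⟩
    simp only [SignedSwap.smul_def, units_smul_eq_intCast_mul]
    have ha := units_cast_mul_self (F := F) a
    simp
    generalize ((a : ℤ) : F) = α at *
    constructor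
    · rintro ⟨h, h4, h5⟩
      have : 2 * x = 0 := by
        linear_combination -x * ha - α * h5 - h4
      have hx : x = 0 := by simpa [h2] using this
      have hy : y = 0 := by rw [hx] at h5; simpa using h5.symm
      refine ⟨?_, hx.symm, hy.symm⟩
      rw [hx, hy] at h
      linear_combination h
    · rintro ⟨h, rfl, rfl⟩
      simpa using h

theorem fixedCard_rotation_c (h2 : (2 : F) ≠ 0) (h3 : (3 : F) ≠ 0) (a : ℤˣ) :
    fixedCard F ⟨true, a, -a, -1⟩ = 0 := by
  unfold fixedCard
  rw [Finset.card_eq_zero, Finset.filter_eq_empty_iff]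
  rintro ⟨x, y, z⟩ -
  simp only [SignedSwap.smul_def, units_smul_eq_intCast_mul]
  have ha := units_cast_mul_self (F := F) a
  simp [neg_eq_self_iff_of_two_ne_zero h2]
  generalize ((a : ℤ) : F) = α at *
  rintro h h4 h5 rfl
  have : 2 * x = 0 := by
    linear_combination -x * ha - α * h5 - h4
  have hx : x = 0 := by simpa [h2] using this
  have hy : y = 0 := by rw [hx] at h5; simpa using h5.symm
  rw [hx, hy] at h
  apply h3
  linear_combination -h

/-- The sixteen terms of Burnside's sum: eight diagonal sign changes, four swaps whose first two
signs agree, and four quarter turns with or without a sign on z, which contribute 2, 2, 0 and 0. -/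
theorem card_orbits_quadricPoints (h2 : (2 : F) ≠ 0) (h3 : (3 : F) ≠ 0) :
    (16 * Nat.card (MulAction.orbitRel.Quotient SignedSwap (quadricPoints F)) : ℤ) =
      Fintype.card F ^ 2 + 5 * Fintype.card F + Fintype.card F * quadraticChar F (-1) + 10
      - 2 * quadraticChar F (-3) - quadraticChar F (-1) + 2 * quadraticChar F 3
      - 2 * quadraticChar F (-6) + 2 * quadraticChar F 6 := by
  have h := sum_fixedCard (F := F)
  rw [← Equiv.sum_comp SignedSwap.equivProd.symm] at h
  have hu : (Finset.univ : Finset ℤˣ) = {1, -1} := rfl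
  have hs : ∀ f : ℤˣ → ℕ, ∑ x, f x = f 1 + f (-1) := by
    intro f
    rw [hu, Finset.sum_pair (by decide)]
  simp only [Fintype.sum_prod_type, Fintype.sum_bool, hs, SignedSwap.equivProd,
    Equiv.coe_fn_symm_mk] at h
  have e1 := fixedCard_rotation h2 h3 1
  have e2 := fixedCard_rotation h2 h3 (-1)
  have e3 := fixedCard_rotation_c h2 h3 1
  have e4 := fixedCard_rotation_c h2 h3 (-1)
  rw [neg_neg] at e2 e4
  zify at h e3 e4
  rw [mul_comm, ← h, e1, e2, e3, e4, fixedCard_swap h2 h3, fixedCard_swap h2 h3,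
    fixedCard_swap_c h2, fixedCard_swap_c h2, fixedCard_one h2 h3, fixedCard_c h2 h3,
    fixedCard_b h2 h3, fixedCard_a h2 h3, fixedCard_ab h2 h3, fixedCard_ac h2, fixedCard_bc h2,
    fixedCard_abc h2 h3]
  push_cast
  ring

end

/-! ### Evaluation of the quadratic symbols modulo 24. -/

section QuadraticSymbols

variable {p : ℕ} [Fact p.Prime]

theorem quadraticChar_neg_one_eq (h2 : p ≠ 2) :
    quadraticChar (ZMod p) (-1) = ZMod.χ₄ p := by
  have := legendreSym.at_neg_one h2
  rw [← this, legendreSym]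
  simp

theorem quadraticChar_two_eq (h2 : p ≠ 2) :
    quadraticChar (ZMod p) 2 = ZMod.χ₈ p := by
  have := legendreSym.at_two h2
  rw [← this, legendreSym]
  simp

theorem quadraticChar_three_eq (h2 : p ≠ 2) :
    quadraticChar (ZMod p) 3 = (-1) ^ (p / 2) * quadraticChar (ZMod 3) p := by
  have : Fact (Nat.Prime 3) := ⟨Nat.prime_three⟩
  by_cases h3 : p = 3
  · subst h3
    have e : (3 : ZMod 3) = 0 := by rfl
    simp [e]
  have h := legendreSym.quadratic_reciprocity' (p := 3) (q := p) (by norm_num) h2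
  rw [legendreSym, legendreSym] at h
  simpa using h

theorem quadraticChar_zmod_three : quadraticChar (ZMod 3) 1 = 1 ∧
    quadraticChar (ZMod 3) 2 = -1 := by
  constructor
  · simp
  · rw [quadraticChar_neg_one_iff_not_isSquare]
    decide

/-- By multiplicativity only χ(−1), χ(2) and χ(3) matter. They depend on p modulo 4, on p modulo 8,
and (by reciprocity) on p modulo 3 together with the parity of p / 2. -/
theorem card_orbits_quadricPoints_zmod (hp3 : 3 < p) :
    ((p % 24 = 1 ∨ p % 24 = 5 ∨ p % 24 = 13 ∨ p % 24 = 17 →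
      16 * (Nat.card (MulAction.orbitRel.Quotient SignedSwap (quadricPoints (ZMod p))) : ℤ) =
        (p : ℤ) ^ 2 + 6 * p + 9) ∧
    (p % 24 = 7 →
      16 * (Nat.card (MulAction.orbitRel.Quotient SignedSwap (quadricPoints (ZMod p))) : ℤ) =
        (p : ℤ) ^ 2 + 4 * p + 3) ∧
    (p % 24 = 11 ∨ p % 24 = 19 →
      16 * (Nat.card (MulAction.orbitRel.Quotient SignedSwap (quadricPoints (ZMod p))) : ℤ) =
        (p : ℤ) ^ 2 + 4 * p + 11) ∧
    (p % 24 = 23 →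
      16 * (Nat.card (MulAction.orbitRel.Quotient SignedSwap (quadricPoints (ZMod p))) : ℤ) =
        (p : ℤ) ^ 2 + 4 * p + 19)) := by
  have hcast : ∀ n : ℕ, 0 < n → n < p → (n : ZMod p) ≠ 0 := by
    intro n h0 hn h
    rw [ZMod.natCast_eq_zero_iff] at h
    exact absurd (Nat.le_of_dvd h0 h) (by omega)
  have h2 : (2 : ZMod p) ≠ 0 := by exact_mod_cast hcast 2 (by norm_num) (by omega)
  have h3 : (3 : ZMod p) ≠ 0 := by exact_mod_cast hcast 3 (by norm_num) (by omega)
  have h := card_orbits_quadricPoints h2 h3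
  rw [ZMod.card, show (-3 : ZMod p) = -1 * 3 by ring, show (-6 : ZMod p) = -1 * (2 * 3) by ring,
    show (6 : ZMod p) = 2 * 3 by ring] at h
  simp only [map_mul] at h
  have hp2 : p ≠ 2 := by omega
  rw [quadraticChar_neg_one_eq hp2, quadraticChar_two_eq hp2, quadraticChar_three_eq hp2] at h
  have e4 : (p : ZMod 4) = ((p % 24 % 4 : ℕ) : ZMod 4) := by
    rw [Nat.mod_mod_of_dvd _ (by norm_num), ZMod.natCast_mod]
  have e8 : (p : ZMod 8) = ((p % 24 % 8 : ℕ) : ZMod 8) := by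
    rw [Nat.mod_mod_of_dvd _ (by norm_num), ZMod.natCast_mod]
  have e3 : (p : ZMod 3) = ((p % 24 % 3 : ℕ) : ZMod 3) := by
    rw [Nat.mod_mod_of_dvd _ (by norm_num), ZMod.natCast_mod]
  have e2 : (-1 : ℤ) ^ (p / 2) = (-1) ^ (p % 24 / 2) := by
    rw [neg_one_pow_eq_pow_mod_two, neg_one_pow_eq_pow_mod_two (p % 24 / 2)]
    congr 1
    omega
  rw [e4, e8, e3, e2] at h
  obtain ⟨q1, q2⟩ := quadraticChar_zmod_three
  have c1 : ZMod.χ₄ 1 = 1 := by decide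
  have c3 : ZMod.χ₄ 3 = -1 := by decide
  have d1 : ZMod.χ₈ 1 = 1 := by decide
  have d3 : ZMod.χ₈ 3 = -1 := by decide
  have d5 : ZMod.χ₈ 5 = -1 := by decide
  have d7 : ZMod.χ₈ 7 = 1 := by decide
  refine ⟨?_, ?_, ?_, ?_⟩
  · rintro (hm | hm | hm | hm) <;> rw [hm] at h <;>
      simp only [Nat.reduceMod, Nat.reduceDiv, Nat.cast_one, Nat.cast_ofNat, q1, q2, c1, c3, d1, d3, d5,
        d7] at h <;> linarith
  · intro hm
    rw [hm] at h
    simp only [Nat.reduceMod, Nat.reduceDiv, Nat.cast_one, Nat.cast_ofNat, q1, q2, c1, c3, d1, d3, d5,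
        d7] at h
    linarith
  · rintro (hm | hm) <;> rw [hm] at h <;>
      simp only [Nat.reduceMod, Nat.reduceDiv, Nat.cast_one, Nat.cast_ofNat, q1, q2, c1, c3, d1, d3, d5,
        d7] at h <;> linarith
  · intro hm
    rw [hm] at h
    simp only [Nat.reduceMod, Nat.reduceDiv, Nat.cast_one, Nat.cast_ofNat, q1, q2, c1, c3, d1, d3, d5,
        d7] at h
    linarith

end QuadraticSymbols

/-! ### Reduction of ternary forms of determinant 3. -/

section TernaryReduction

variable {V : Type*} [AddCommGroup V] [Module ℚ V]

/-- The Gram determinant of three vectors with respect to a symmetric bilinear form. -/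
def gramDet (B : LinearMap.BilinForm ℚ V) (u v w : V) : ℚ :=
  B u u * (B v v * B w w - B v w ^ 2) - B u v * (B u v * B w w - B v w * B u w) +
    B u w * (B u v * B v w - B v v * B u w)

/-- `u`, `v`, `w` span `I` and have Gram determinant `d`. -/
def SpansWithDet (B : LinearMap.BilinForm ℚ V) (I : Submodule ℤ V) (d : ℚ) (u v w : V) : Prop :=
  Submodule.span ℤ {u, v, w} = I ∧ gramDet B u v w = d

variable {B : LinearMap.BilinForm ℚ V} {I : Submodule ℤ V} {d : ℚ} {u v w : V}

theorem SpansWithDet.swap12 (hB : ∀ x y, B x y = B y x) (h : SpansWithDet B I d u v w) :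
    SpansWithDet B I d v u w := by
  refine ⟨by rw [Set.insert_comm]; exact h.1, ?_⟩
  rw [← h.2]
  unfold gramDet
  rw [hB v u]
  ring

theorem SpansWithDet.swap23 (hB : ∀ x y, B x y = B y x) (h : SpansWithDet B I d u v w) :
    SpansWithDet B I d u w v := by
  refine ⟨by rw [Set.pair_comm]; exact h.1, ?_⟩
  rw [← h.2]
  unfold gramDet
  rw [hB w v]
  ring

theorem SpansWithDet.add12 (hB : ∀ x y, B x y = B y x) (h : SpansWithDet B I d u v w) (k : ℤ) :
    SpansWithDet B I d u (v + k • u) w := by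
  constructor
  · rw [← h.1]
    apply le_antisymm
    · rw [Submodule.span_le]
      rintro x (rfl | rfl | rfl)
      · exact Submodule.subset_span (by simp)
      · exact add_mem (Submodule.subset_span (by simp))
          (Submodule.smul_mem _ _ (Submodule.subset_span (by simp)))
      · exact Submodule.subset_span (by simp)
    · rw [Submodule.span_le]
      rintro x (rfl | rfl | rfl)
      · exact Submodule.subset_span (by simp)
      · have h1 : x + k • u ∈ Submodule.span ℤ {u, x + k • u, w} :=
          Submodule.subset_span (by simp)
        have h2 : u ∈ Submodule.span ℤ {u, x + k • u, w} := Submodule.subset_span (by simp)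
        have h3 := sub_mem h1 (Submodule.smul_mem _ k h2)
        simpa using h3
      · exact Submodule.subset_span (by simp)
  · rw [← h.2]
    unfold gramDet
    rw [← Int.cast_smul_eq_zsmul ℚ]
    simp only [map_add, map_smul, LinearMap.add_apply, LinearMap.smul_apply, smul_eq_mul]
    rw [hB v u]
    ring

theorem SpansWithDet.add13 (hB : ∀ x y, B x y = B y x) (h : SpansWithDet B I d u v w) (k : ℤ) :
    SpansWithDet B I d u v (w + k • u) :=
  ((h.swap23 hB).add12 hB k).swap23 hB

theorem SpansWithDet.add23 (hB : ∀ x y, B x y = B y x) (h : SpansWithDet B I d u v w) (k : ℤ) :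
    SpansWithDet B I d u v (w + k • v) :=
  ((h.swap12 hB).add13 hB k).swap12 hB

theorem Int.exists_two_mul_abs_add_mul_le (x : ℤ) {a : ℤ} (ha : 0 < a) :
    ∃ k : ℤ, 2 * |x + k * a| ≤ a := by
  -- The negative of the integer nearest to x / a.
  refine ⟨-((2 * x + a) / (2 * a)), ?_⟩
  have h1 := Int.emod_add_mul_ediv (2 * x + a) (2 * a)
  have h2 := Int.emod_nonneg (2 * x + a) (show 2 * a ≠ 0 by omega)
  have h3 := Int.emod_lt_of_pos (2 * x + a) (show 0 < 2 * a by omega)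
  have : 2 * |x + -((2 * x + a) / (2 * a)) * a| = |2 * (x + -((2 * x + a) / (2 * a)) * a)| := by
    rw [abs_mul]; simp
  rw [this, abs_le]
  constructor <;> nlinarith

theorem SpansWithDet.mem (h : SpansWithDet B I d u v w) : u ∈ I ∧ v ∈ I ∧ w ∈ I := by
  rw [← h.1]
  exact ⟨Submodule.subset_span (by simp), Submodule.subset_span (by simp),
    Submodule.subset_span (by simp)⟩

/-- A positive definite ternary form of determinant `3` with integral Gram matrix has a basis in
which it is `1 ⊥ J` with `J` a reduced binary form. -/
theorem exists_spansWithDet_reduced (hB : ∀ x y, B x y = B y x) (hpos : ∀ x, x ≠ 0 → 0 < B x x)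
    (hint : ∀ x ∈ I, ∀ y ∈ I, ∃ n : ℤ, B x y = n) (h : SpansWithDet B I 3 u v w) :
    ∃ (u v w : V) (b c e : ℤ), SpansWithDet B I 3 u v w ∧ B u u = 1 ∧ B u v = 0 ∧ B u w = 0 ∧
      B v v = b ∧ B v w = c ∧ B w w = e ∧ 2 * |c| ≤ b ∧ b ^ 2 ≤ 4 ∧ 0 < b := by
  classical
  have hnn : ∀ x, 0 ≤ B x x := by
    intro x
    by_cases hx : x = 0
    · simp [hx]
    · exact (hpos x hx).le
  have hnat : ∀ x ∈ I, ∃ n : ℕ, B x x = n := by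
    intro x hx
    obtain ⟨n, hn⟩ := hint x hx x hx
    have h0 : (0 : ℚ) ≤ n := hn ▸ hnn x
    refine ⟨n.toNat, ?_⟩
    rw [hn]
    have : ((n.toNat : ℤ) : ℚ) = n := by
      rw [Int.toNat_of_nonneg (by exact_mod_cast h0)]
    rw [← this, Int.cast_natCast]
  -- Among all admissible bases, take one whose first vector has least norm a.
  have hS : ∃ n : ℕ, ∃ u v w, SpansWithDet B I 3 u v w ∧ B u u = n := by
    obtain ⟨n, hn⟩ := hnat u h.mem.1
    exact ⟨n, u, v, w, h, hn⟩
  obtain ⟨u, v, w, h, ha⟩ := Nat.find_spec hS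
  have hamin : ∀ u' v' w', SpansWithDet B I 3 u' v' w' → B u u ≤ B u' u' := by
    intro u' v' w' h'
    obtain ⟨n, hn⟩ := hnat u' h'.mem.1
    rw [ha, hn]
    exact_mod_cast Nat.find_min' hS ⟨u', v', w', h', hn⟩
  generalize Nat.find hS = a at ha
  -- The minor B(u,u)B(v,v) − B(u,v)² is a times the norm of the projection of v orthogonal to u. It
  -- is a nonnegative integer, so with u fixed it can be minimized as well.
  have hAex : ∀ v w, SpansWithDet B I 3 u v w →
      ∃ n : ℕ, B u u * B v v - B u v ^ 2 = n := by
    intro v w h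
    obtain ⟨x, hx⟩ := hint u h.mem.1 u h.mem.1
    obtain ⟨y, hy⟩ := hint v h.mem.2.1 v h.mem.2.1
    obtain ⟨z, hz⟩ := hint u h.mem.1 v h.mem.2.1
    have hnn2 : 0 ≤ B u u * B v v - B u v ^ 2 := by
      by_cases hu : u = 0
      · simp [hu]
      have h1 := hnn (B u u • v - B u v • u)
      simp only [map_sub, map_smul, LinearMap.sub_apply, LinearMap.smul_apply, smul_eq_mul] at h1
      rw [hB v u] at h1
      have h2 : 0 ≤ B u u * (B u u * B v v - B u v ^ 2) := by linarith
      exact nonneg_of_mul_nonneg_right h2 (hpos u hu)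
    rw [hx, hy, hz] at hnn2 ⊢
    refine ⟨(x * y - z ^ 2).toNat, ?_⟩
    have : (((x * y - z ^ 2).toNat : ℤ) : ℚ) = ((x * y - z ^ 2 : ℤ) : ℚ) := by
      rw [Int.toNat_of_nonneg (by exact_mod_cast hnn2)]
    push_cast at this
    rw [← this]
  have hS' : ∃ n : ℕ, ∃ v w, SpansWithDet B I 3 u v w ∧ B u u * B v v - B u v ^ 2 = n := by
    obtain ⟨n, hn⟩ := hAex v w h
    exact ⟨n, v, w, h, hn⟩
  clear h
  obtain ⟨v, w, h, hA⟩ := Nat.find_spec hS'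
  have hAmin : ∀ v' w', SpansWithDet B I 3 u v' w' →
      B u u * B v v - B u v ^ 2 ≤ B u u * B v' v' - B u v' ^ 2 := by
    intro v' w' h'
    obtain ⟨n, hn⟩ := hAex v' w' h'
    rw [hA, hn]
    exact_mod_cast Nat.find_min' hS' ⟨v', w', h', hn⟩
  clear hA
  have ha0 : 0 < B u u := by
    apply hpos
    rintro rfl
    have := h.2
    simp [gramDet] at this
  have ha0' : 0 < (a : ℤ) := by
    rw [ha] at ha0
    exact_mod_cast ha0
  -- Shift `v` by a multiple of `u`.
  obtain ⟨z, hz⟩ := hint u h.mem.1 v h.mem.2.1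
  obtain ⟨k, hk⟩ := Int.exists_two_mul_abs_add_mul_le z ha0'
  have h1 := h.add12 hB k
  have e1 : B u (v + k • u) = ((z + k * a : ℤ) : ℚ) := by
    rw [← Int.cast_smul_eq_zsmul ℚ]
    simp [hz, ha]
  have e2 : B u u * B (v + k • u) (v + k • u) - B u (v + k • u) ^ 2 =
      B u u * B v v - B u v ^ 2 := by
    rw [← Int.cast_smul_eq_zsmul ℚ]
    simp only [map_add, map_smul, LinearMap.add_apply, LinearMap.smul_apply, smul_eq_mul]
    rw [hB v u]
    ring
  rw [← e2] at hAmin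
  generalize z + k * a = q12 at hk e1
  generalize v + k • u = v' at h1 e1 e2 hAmin
  clear e2 hz h
  clear v
  -- Shift `w` by a multiple of `v'`.
  obtain ⟨q22, hq22⟩ := hint v' h1.mem.2.1 v' h1.mem.2.1
  obtain ⟨y, hy⟩ := hint v' h1.mem.2.1 w h1.mem.2.2
  obtain ⟨x, hx⟩ := hint u h1.mem.1 w h1.mem.2.2
  have hle : (a : ℤ) ≤ q22 := by
    have := hamin _ _ _ (h1.swap12 hB)
    rw [ha, hq22] at this
    exact_mod_cast this
  have hq12 : 4 * q12 ^ 2 ≤ a ^ 2 := by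
    have : (2 * |q12|) ^ 2 ≤ (a : ℤ) ^ 2 := pow_le_pow_left₀ (by positivity) hk 2
    rw [mul_pow, sq_abs] at this
    linarith
  obtain ⟨A, hA⟩ : ∃ A : ℤ, A = a * q22 - q12 ^ 2 := ⟨_, rfl⟩
  have hA0 : 3 * (a : ℤ) ^ 2 ≤ 4 * A := by nlinarith
  have hA1 : 0 < A := by nlinarith
  obtain ⟨l, hl⟩ := Int.exists_two_mul_abs_add_mul_le (a * y - q12 * x) hA1
  have h2 := h1.add23 hB l
  obtain ⟨q13, hq13⟩ := hint u h2.mem.1 _ h2.mem.2.2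
  obtain ⟨q23, hq23⟩ := hint v' h2.mem.2.1 _ h2.mem.2.2
  obtain ⟨q33, hq33⟩ := hint _ h2.mem.2.2 _ h2.mem.2.2
  have e3 : a * q23 - q12 * q13 = a * y - q12 * x + l * A := by
    have : ((a * q23 - q12 * q13 : ℤ) : ℚ) = ((a * y - q12 * x + l * A : ℤ) : ℚ) := by
      push_cast
      rw [← hq23, ← hq13, ← Int.cast_smul_eq_zsmul ℚ, hA]
      simp only [map_add, map_smul, smul_eq_mul, hy, hx, e1, hq22]
      push_cast
      ring
    exact_mod_cast this
  rw [← e3] at hl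
  clear hx hy e3
  generalize w + l • v' = w' at h2 hq13 hq23 hq33
  clear h1
  obtain ⟨C, hC⟩ : ∃ C : ℤ, C = a * q33 - q13 ^ 2 := ⟨_, rfl⟩
  have hAC : A ≤ C := by
    have := hAmin _ _ (h2.swap23 hB)
    rw [ha, hq22, e1, hq33, hq13] at this
    rw [hA, hC]
    exact_mod_cast this
  obtain ⟨D, hD⟩ : ∃ D : ℤ, D = a * q23 - q12 * q13 := ⟨_, rfl⟩
  rw [← hD] at hl
  -- A, C, D are a times the Gram entries of the projections of the last two vectors orthogonal to
  -- u, so AC − D² is a times the full determinant.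
  have hdet : A * C - D ^ 2 = 3 * a := by
    have h3 := h2.2
    unfold gramDet at h3
    rw [ha, e1, hq22, hq13, hq23, hq33] at h3
    have h4 : (a * (q22 * q33 - q23 ^ 2) - q12 * (q12 * q33 - q23 * q13) +
      q13 * (q12 * q23 - q22 * q13) : ℤ) = 3 := by exact_mod_cast h3
    rw [hA, hC, hD]
    linear_combination (a : ℤ) * h4
  have hD2 : 4 * D ^ 2 ≤ A ^ 2 := by
    have : (2 * |D|) ^ 2 ≤ A ^ 2 := pow_le_pow_left₀ (by positivity) hl 2
    rw [mul_pow, sq_abs] at this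
    linarith
  -- From C ≥ A and 4D² ≤ A² follows 3A²/4 ≤ AC − D² = 3a.
  have hA4 : A ^ 2 ≤ 4 * a := by nlinarith
  have ha1 : (a : ℤ) = 1 := by
    -- Combine 3a² ≤ 4A with A² ≤ 4a. The result 9a³ ≤ 64 excludes a ≥ 2.
    have h5 : 9 * (a : ℤ) ^ 4 ≤ 64 * a := by nlinarith
    have h6 : (a : ℤ) < 2 := by
      by_contra hcon
      have h7 : 2 ≤ (a : ℤ) := by omega
      have h8 : 2 ^ 3 ≤ (a : ℤ) ^ 3 := pow_le_pow_left₀ (by norm_num) h7 3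
      nlinarith
    omega
  have hq0 : q12 = 0 := by
    rw [ha1] at hk
    rw [← abs_nonpos_iff]
    omega
  subst hq0
  rw [ha1] at hA hC hD hA4
  have hau : B u u = 1 := by
    rw [ha]
    exact_mod_cast ha1
  refine ⟨u, v', w' + (-q13) • u, A, D, C, h2.add13 hB _, hau, by simpa using e1, ?_, ?_, ?_, ?_,
    hl, by simpa using hA4, hA1⟩
  · rw [← Int.cast_smul_eq_zsmul ℚ]
    simp [hq13, hau]
  · rw [hq22, hA]
    simp
  · rw [← Int.cast_smul_eq_zsmul ℚ]
    simp [hq23, hB v' u, e1, hD]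
  · rw [← Int.cast_smul_eq_zsmul ℚ]
    simp [hq13, hq33, hB w' u, hau, hC]
    ring

/-- Reduction leaves 1 ⊥ 1 ⊥ 3 and the sum of 1 with a binary form of diagonal (2, 2) and
determinant 3. The hypothesis `h3` excludes the latter: adding vectors of norms 1 and 2 gives norm
3, but the product with the first is 1. -/
theorem exists_orthogonal_of_gramDet_eq_three (hB : ∀ x y, B x y = B y x)
    (hpos : ∀ x, x ≠ 0 → 0 < B x x)
    (hint : ∀ x ∈ I, ∀ y ∈ I, ∃ n : ℤ, B x y = n) (h : SpansWithDet B I 3 u v w)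
    (h3 : ∀ x ∈ I, ∀ y ∈ I, (∃ n : ℤ, B x x = 3 * n) → ∃ n : ℤ, B x y = 3 * n) :
    ∃ u v w : V, Submodule.span ℤ {u, v, w} = I ∧ B u u = 1 ∧ B v v = 1 ∧ B w w = 3 ∧
      B u v = 0 ∧ B u w = 0 ∧ B v w = 0 := by
  obtain ⟨u, v, w, b, c, e, h, huu, huv, huw, hb, hc, he, hcb, hb4, hb0⟩ :=
    exists_spansWithDet_reduced hB hpos hint h
  have hdet : b * e - c ^ 2 = 3 := by
    have h4 := h.2
    unfold gramDet at h4
    rw [huu, huv, huw, hb, hc, he] at h4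
    have : ((b * e - c ^ 2 : ℤ) : ℚ) = 3 := by
      push_cast
      linarith
    exact_mod_cast this
  have hb2 : b ≤ 2 := by nlinarith
  have hc1 : |c| ≤ 1 := by omega
  have hb12 : b = 1 ∨ b = 2 := by omega
  rcases hb12 with rfl | rfl
  · have hc0 : c = 0 := by
      rw [← abs_nonpos_iff]
      omega
    subst hc0
    have he3 : e = 3 := by linarith
    subst he3
    exact ⟨u, v, w, h.1, huu, by simpa using hb, by simpa using he, huv, huw, by simpa using hc⟩
  · exfalso
    obtain ⟨n, hn⟩ := h3 (u + v) (add_mem h.mem.1 h.mem.2.1) u h.mem.1 ⟨1, by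
      simp [huu, huv, hB v u, hb]; norm_num⟩
    simp only [map_add, LinearMap.add_apply, huu, hB v u, huv] at hn
    have : (1 : ℤ) = 3 * n := by
      have : ((1 : ℤ) : ℚ) = ((3 * n : ℤ) : ℚ) := by
        push_cast
        linarith
      exact_mod_cast this
    omega

end TernaryReduction

/-! ### Diagonal coordinates and model lattices. -/

namespace QuadraticSpace

variable {V : Type*} [AddCommGroup V] [Module ℚ V]

/-- `Q` is the form `2x² + 2y² + 6z²` in the coordinates `c`. -/
def IsDiagonal (Q : QuadraticForm ℚ V) (c : V ≃ₗ[ℚ] ℚ × ℚ × ℚ) : Prop :=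
  ∀ v, Q v = 2 * (c v).1 ^ 2 + 2 * (c v).2.1 ^ 2 + 6 * (c v).2.2 ^ 2

variable {Q : QuadraticForm ℚ V} {c : V ≃ₗ[ℚ] ℚ × ℚ × ℚ}

theorem IsDiagonal.associated_eq (hQ : IsDiagonal Q c) (v w : V) :
    QuadraticMap.associated (R := ℚ) Q v w =
      2 * (c v).1 * (c w).1 + 2 * (c v).2.1 * (c w).2.1 + 6 * (c v).2.2 * (c w).2.2 := by
  rw [QuadraticMap.associated_apply, hQ, hQ, hQ]
  simp
  ring

theorem IsDiagonal.eq_zero (hQ : IsDiagonal Q c) {v : V} (h : Q v = 0) : v = 0 := by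
  rw [hQ] at h
  apply c.injective
  rw [map_zero]
  have h1 : (c v).1 = 0 := by nlinarith [sq_nonneg (c v).1, sq_nonneg (c v).2.1, sq_nonneg (c v).2.2]
  have h2 : (c v).2.1 = 0 := by nlinarith [sq_nonneg (c v).1, sq_nonneg (c v).2.1, sq_nonneg (c v).2.2]
  have h3 : (c v).2.2 = 0 := by nlinarith [sq_nonneg (c v).1, sq_nonneg (c v).2.1, sq_nonneg (c v).2.2]
  exact Prod.ext h1 (Prod.ext h2 h3)

/-- Definiteness makes a norm-preserving map injective, hence bijective in finite dimension. -/
theorem IsDiagonal.exists_isometryEquiv (hQ : IsDiagonal Q c) (f : V →ₗ[ℚ] V)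
    (hf : ∀ v, Q (f v) = Q v) : ∃ σ : Q.IsometryEquiv Q, ∀ v, σ v = f v := by
  have : FiniteDimensional ℚ V := Module.Finite.equiv c.symm
  have hinj : Function.Injective f := by
    rw [injective_iff_map_eq_zero]
    intro v hv
    apply hQ.eq_zero
    rw [← hf, hv, QuadraticMap.map_zero]
  exact ⟨⟨LinearEquiv.ofInjectiveEndo f hinj, fun v => hf v⟩, fun v => rfl⟩

theorem associated_isometryEquiv (σ : Q.IsometryEquiv Q) (v w : V) :
    QuadraticMap.associated (R := ℚ) Q (σ v) (σ w) =
      QuadraticMap.associated (R := ℚ) Q v w := by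
  simp only [QuadraticMap.associated_apply, ← map_add, QuadraticMap.IsometryEquiv.map_app]

/-- The vectors with integral coordinates. -/
def standardLattice (c : V ≃ₗ[ℚ] ℚ × ℚ × ℚ) : Submodule ℤ V where
  carrier := {v | ∃ x y z : ℤ, c v = ((x : ℚ), (y : ℚ), (z : ℚ))}
  add_mem' := by
    rintro v w ⟨x, y, z, h⟩ ⟨x', y', z', h'⟩
    exact ⟨x + x', y + y', z + z', by rw [map_add, h, h']; simp⟩
  zero_mem' := ⟨0, 0, 0, by simp; rfl⟩
  smul_mem' := by
    rintro n v ⟨x, y, z, h⟩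
    exact ⟨n * x, n * y, n * z, by rw [← Int.cast_smul_eq_zsmul ℚ, map_smul, h]; simp⟩

theorem mem_standardLattice {v : V} :
    v ∈ standardLattice c ↔ ∃ x y z : ℤ, c v = ((x : ℚ), (y : ℚ), (z : ℚ)) := Iff.rfl

/-- The vectors with coordinates `(a / 2, b / 2, k)`, where `a`, `b`, `k` are integers of the same
parity, which are orthogonal to `s` modulo `p`. -/
def modelLattice (c : V ≃ₗ[ℚ] ℚ × ℚ × ℚ) {p : ℕ} (s : ZMod p × ZMod p × ZMod p) :
    Submodule ℤ V where
  carrier := {v | ∃ a b k : ℤ, c v = ((a : ℚ) / 2, (b : ℚ) / 2, (k : ℚ)) ∧ 2 ∣ a - k ∧ 2 ∣ b - k ∧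
    (a : ZMod p) * s.1 + b * s.2.1 + 6 * k * s.2.2 = 0}
  add_mem' := by
    rintro v w ⟨a, b, k, h, h1, h2, h3⟩ ⟨a', b', k', h', h1', h2', h3'⟩
    refine ⟨a + a', b + b', k + k', by rw [map_add, h, h']; simp [add_div], by omega, by omega, ?_⟩
    push_cast
    linear_combination h3 + h3'
  zero_mem' := ⟨0, 0, 0, by simp; rfl, by simp, by simp, by simp⟩
  smul_mem' := by
    rintro n v ⟨a, b, k, h, h1, h2, h3⟩
    refine ⟨n * a, n * b, n * k,
      by rw [← Int.cast_smul_eq_zsmul ℚ, map_smul, h]; simp [mul_div_assoc], ?_, ?_, ?_⟩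
    · rw [← mul_sub]
      exact Dvd.dvd.mul_left h1 n
    · rw [← mul_sub]
      exact Dvd.dvd.mul_left h2 n
    · push_cast
      linear_combination n * h3

theorem mem_modelLattice {p : ℕ} {s : ZMod p × ZMod p × ZMod p} {v : V} :
    v ∈ modelLattice c s ↔ ∃ a b k : ℤ, c v = ((a : ℚ) / 2, (b : ℚ) / 2, (k : ℚ)) ∧
      2 ∣ a - k ∧ 2 ∣ b - k ∧ (a : ZMod p) * s.1 + b * s.2.1 + 6 * k * s.2.2 = 0 := Iff.rfl

theorem symm_mem_modelLattice {p : ℕ} {s : ZMod p × ZMod p × ZMod p} {x y z : ℚ} (a b k : ℤ)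
    (hx : x = a / 2) (hy : y = b / 2) (hz : z = k) (h1 : 2 ∣ a - k) (h2 : 2 ∣ b - k)
    (h : (a : ZMod p) * s.1 + b * s.2.1 + 6 * k * s.2.2 = 0) :
    c.symm (x, y, z) ∈ modelLattice c s :=
  ⟨a, b, k, by rw [LinearEquiv.apply_symm_apply, hx, hy, hz], h1, h2, h⟩

theorem isLattice_modelLattice {p : ℕ} (hp : p ≠ 0) (s : ZMod p × ZMod p × ZMod p) :
    (modelLattice c s).IsLattice ℚ where
  fg := by
    have hle : modelLattice c s ≤ Submodule.span ℤ
        {c.symm (1 / 2, 0, 0), c.symm (0, 1 / 2, 0), c.symm (0, 0, 1)} := by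
      rintro v ⟨a, b, k, h, -⟩
      have hv : v = a • c.symm (1 / 2, 0, 0) + b • c.symm (0, 1 / 2, 0) + k • c.symm (0, 0, 1) := by
        apply c.injective
        simp only [← Int.cast_smul_eq_zsmul ℚ, map_add, map_smul, LinearEquiv.apply_symm_apply, h]
        simp [div_eq_mul_inv]
      rw [hv]
      refine add_mem (add_mem ?_ ?_) ?_ <;>
        exact Submodule.smul_mem _ _ (Submodule.subset_span (by simp))
    have : IsNoetherian ℤ (Submodule.span ℤ
        {c.symm (1 / 2, 0, 0), c.symm (0, 1 / 2, 0), c.symm (0, 0, 1)}) :=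
      isNoetherian_span_of_finite ℤ (Set.toFinite _)
    have : IsNoetherian ℤ (modelLattice c s) := isNoetherian_of_le hle
    rw [← Module.Finite.iff_fg]
    infer_instance
  span_eq_top := by
    rw [eq_top_iff]
    intro v _
    have hp' : (p : ℚ) ≠ 0 := by exact_mod_cast hp
    have hv : v = ((c v).1 / p) • c.symm (p, 0, 0) + ((c v).2.1 / p) • c.symm (0, p, 0) +
        ((c v).2.2 / (2 * p)) • c.symm (0, 0, 2 * p) := by
      apply c.injective
      simp only [map_add, map_smul, LinearEquiv.apply_symm_apply]
      ext <;> simp <;> field_simp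
    rw [hv]
    refine add_mem (add_mem ?_ ?_) ?_ <;>
      refine Submodule.smul_mem _ _ (Submodule.subset_span ?_)
    · exact symm_mem_modelLattice (2 * p) 0 0 (by push_cast; ring) (by simp) (by simp) (by simp)
        (by simp) (by simp)
    · exact symm_mem_modelLattice 0 (2 * p) 0 (by simp) (by push_cast; ring) (by simp) (by simp)
        (by simp) (by simp)
    · exact symm_mem_modelLattice 0 0 (2 * p) (by simp) (by simp) (by push_cast; ring) (by simp)
        (by simp) (by simp)

/-- On a model lattice the form is even exactly where the third coordinate is even. -/
theorem IsDiagonal.even_iff (hQ : IsDiagonal Q c) {v : V} {a b k : ℤ}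
    (h : c v = ((a : ℚ) / 2, (b : ℚ) / 2, (k : ℚ))) (h1 : 2 ∣ a - k) (h2 : 2 ∣ b - k) :
    (∃ n : ℤ, Q v = 2 * n) ↔ 2 ∣ k := by
  rw [hQ, h]
  simp only
  constructor
  · rintro ⟨n, hn⟩
    have h3 : a ^ 2 + b ^ 2 + 12 * k ^ 2 = 4 * n := by
      have : ((a ^ 2 + b ^ 2 + 12 * k ^ 2 : ℤ) : ℚ) = ((4 * n : ℤ) : ℚ) := by
        push_cast
        linarith
      exact_mod_cast this
    by_contra hk
    obtain ⟨k', rfl⟩ : ∃ k', k = 2 * k' + 1 := ⟨k / 2, by omega⟩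
    obtain ⟨a', rfl⟩ : ∃ a', a = 2 * a' + 1 := ⟨a / 2, by omega⟩
    obtain ⟨b', rfl⟩ : ∃ b', b = 2 * b' + 1 := ⟨b / 2, by omega⟩
    ring_nf at h3
    omega
  · intro hk
    obtain ⟨k', rfl⟩ := hk
    obtain ⟨a', rfl⟩ : ∃ a', a = 2 * a' := ⟨a / 2, by omega⟩
    obtain ⟨b', rfl⟩ : ∃ b', b = 2 * b' := ⟨b / 2, by omega⟩
    refine ⟨a' ^ 2 + b' ^ 2 + 12 * k' ^ 2, ?_⟩
    push_cast
    ring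

/-- Twice an integral vector orthogonal to s modulo p lies in the lattice of s, so orthogonality to
s implies orthogonality to t. Hence t = l s, and since both have norm 3, l² = 1. -/
theorem eq_or_neg_eq_of_modelLattice_le {p : ℕ} [Fact p.Prime] (hp3 : 3 < p)
    {s t : ZMod p × ZMod p × ZMod p} (hs : s ∈ quadricPoints (ZMod p))
    (ht : t ∈ quadricPoints (ZMod p)) (h : modelLattice c s ≤ modelLattice c t) :
    t = s ∨ t = -s := by
  have hcast : ∀ n : ℕ, 0 < n → n < p → (n : ZMod p) ≠ 0 := by
    intro n h0 hn h
    rw [ZMod.natCast_eq_zero_iff] at h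
    exact absurd (Nat.le_of_dvd h0 h) (by omega)
  have h2 : (2 : ZMod p) ≠ 0 := by exact_mod_cast hcast 2 (by norm_num) (by omega)
  have h3 : (3 : ZMod p) ≠ 0 := by exact_mod_cast hcast 3 (by norm_num) (by omega)
  obtain ⟨x, hx⟩ := ZMod.intCast_surjective s.1
  obtain ⟨y, hy⟩ := ZMod.intCast_surjective s.2.1
  obtain ⟨z, hz⟩ := ZMod.intCast_surjective s.2.2
  have key : ∀ a b k : ℤ, (a : ZMod p) * s.1 + b * s.2.1 + 3 * k * s.2.2 = 0 →
      (a : ZMod p) * t.1 + b * t.2.1 + 3 * k * t.2.2 = 0 := by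
    intro a b k h0
    have hm : c.symm ((a : ℚ), (b : ℚ), (k : ℚ)) + c.symm ((a : ℚ), (b : ℚ), (k : ℚ)) ∈
        modelLattice c s := by
      rw [← map_add]
      refine symm_mem_modelLattice (4 * a) (4 * b) (2 * k) ?_ ?_ ?_ ?_ ?_ ?_
      · push_cast; ring
      · push_cast; ring
      · push_cast; ring
      · omega
      · omega
      · push_cast
        linear_combination 4 * h0
    obtain ⟨a', b', k', h4, -, -, h5⟩ := h hm
    rw [← map_add, LinearEquiv.apply_symm_apply] at h4
    simp only [Prod.mk_add_mk, Prod.mk.injEq] at h4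
    obtain ⟨h6, h7, h8⟩ := h4
    have e1 : a' = 4 * a := by
      have : ((a' : ℤ) : ℚ) = ((4 * a : ℤ) : ℚ) := by push_cast; linarith
      exact_mod_cast this
    have e2 : b' = 4 * b := by
      have : ((b' : ℤ) : ℚ) = ((4 * b : ℤ) : ℚ) := by push_cast; linarith
      exact_mod_cast this
    have e3 : k' = 2 * k := by
      have : ((k' : ℤ) : ℚ) = ((2 * k : ℤ) : ℚ) := by push_cast; linarith
      exact_mod_cast this
    rw [e1, e2, e3] at h5
    push_cast at h5
    have h9 : (2 * 2 : ZMod p) * ((a : ZMod p) * t.1 + b * t.2.1 + 3 * k * t.2.2) = 0 := by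
      linear_combination h5
    exact (mul_eq_zero.1 h9).resolve_left (mul_ne_zero h2 h2)
  -- These three vectors are orthogonal to s, and orthogonality of t to them makes t proportional to
  -- s.
  have k1 := key (-y) x 0 (by push_cast; rw [hx, hy]; ring)
  have k2 := key (-3 * z) 0 x (by push_cast; rw [hx, hz]; ring)
  have k3 := key 0 (-3 * z) y (by push_cast; rw [hy, hz]; ring)
  push_cast at k1 k2 k3
  rw [hx, hy] at k1
  rw [hx, hz] at k2
  rw [hy, hz] at k3
  replace k2 : s.1 * t.2.2 = s.2.2 * t.1 := by
    apply mul_left_cancel₀ h3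
    linear_combination k2
  replace k3 : s.2.1 * t.2.2 = s.2.2 * t.2.1 := by
    apply mul_left_cancel₀ h3
    linear_combination k3
  unfold quadricPoints at hs ht
  simp only [Set.mem_ofPred_eq] at hs ht
  obtain ⟨l, hl⟩ : ∃ l, 3 * l = t.1 * s.1 + t.2.1 * s.2.1 + 3 * t.2.2 * s.2.2 :=
    ⟨(t.1 * s.1 + t.2.1 * s.2.1 + 3 * t.2.2 * s.2.2) / 3, by field_simp⟩
  have t1 : t.1 = l * s.1 := by
    apply mul_left_cancel₀ h3
    linear_combination -s.1 * hl - t.1 * hs - 3 * s.2.2 * k2 - s.2.1 * k1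
  have t2 : t.2.1 = l * s.2.1 := by
    apply mul_left_cancel₀ h3
    linear_combination -s.2.1 * hl - t.2.1 * hs - 3 * s.2.2 * k3 + s.1 * k1
  have t3 : t.2.2 = l * s.2.2 := by
    apply mul_left_cancel₀ h3
    linear_combination -s.2.2 * hl - t.2.2 * hs + s.1 * k2 + s.2.1 * k3
  have hl1 : (l - 1) * (l + 1) = 0 := by
    apply mul_left_cancel₀ h3
    rw [t1, t2, t3] at ht
    linear_combination ht - l ^ 2 * hs
  rcases mul_eq_zero.1 hl1 with hl1 | hl1
  · left
    have hl1 : l = 1 := by linear_combination hl1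
    rw [hl1, one_mul] at t1 t2 t3
    exact Prod.ext t1 (Prod.ext t2 t3)
  · right
    have hl1 : l = -1 := by linear_combination hl1
    rw [hl1, neg_one_mul] at t1 t2 t3
    exact Prod.ext t1 (Prod.ext t2 t3)

theorem SignedSwap_smul_add {A : Type*} [AddCommGroup A] (g : SignedSwap) (v w : A × A × A) :
    g • (v + w) = g • v + g • w := by
  obtain ⟨t, a, b, e⟩ := g
  cases t <;> simp [SignedSwap.smul_def, smul_add]

theorem SignedSwap_smul_smul (g : SignedSwap) (r : ℚ) (v : ℚ × ℚ × ℚ) :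
    g • (r • v) = r • (g • v) := by
  obtain ⟨t, a, b, e⟩ := g
  cases t <;> simp [SignedSwap.smul_def, units_smul_eq_intCast_mul] <;>
    refine ⟨?_, ?_, ?_⟩ <;> ring

theorem IsDiagonal.exists_isometryEquiv_smul (hQ : IsDiagonal Q c) (g : SignedSwap) :
    ∃ σ : Q.IsometryEquiv Q, ∀ v, c (σ v) = g • c v := by
  obtain ⟨σ, hσ⟩ := hQ.exists_isometryEquiv
    { toFun := fun v => c.symm (g • c v)
      map_add' := fun v w => by rw [map_add, SignedSwap_smul_add, map_add]
      map_smul' := fun r v => by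
        rw [c.map_smul, SignedSwap_smul_smul, c.symm.map_smul, RingHom.id_apply] }
    (by
      intro v
      simp only [LinearMap.coe_mk, AddHom.coe_mk]
      rw [hQ, hQ, LinearEquiv.apply_symm_apply]
      obtain ⟨t, a, b, e⟩ := g
      cases t <;> simp [SignedSwap.smul_def, units_smul_sq]
      ring)
  exact ⟨σ, fun v => by rw [hσ]; simp⟩

theorem smul_mem_modelLattice {p : ℕ} [Fact p.Prime] {s : ZMod p × ZMod p × ZMod p}
    (g : SignedSwap) {v w : V} (hw : c w = g • c v) (hv : v ∈ modelLattice c s) :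
    w ∈ modelLattice c (g • s) := by
  obtain ⟨a, b, k, h, h1, h2, h3⟩ := hv
  obtain ⟨t, α, β, γ⟩ := g
  rw [h] at hw
  have hpar : ∀ (u v : ℤˣ) (x y : ℤ), 2 ∣ x - y → 2 ∣ (u : ℤ) * x - v * y := by
    intro u v x y h
    rcases Int.units_eq_one_or u with rfl | rfl <;> rcases Int.units_eq_one_or v with rfl | rfl <;>
      simp <;> omega
  have hα := units_cast_mul_self (F := ZMod p) α
  have hβ := units_cast_mul_self (F := ZMod p) β
  have hγ := units_cast_mul_self (F := ZMod p) γ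
  cases t
  · refine ⟨α * a, β * b, γ * k, ?_, hpar _ _ _ _ h1, hpar _ _ _ _ h2, ?_⟩
    · rw [hw]
      simp [SignedSwap.smul_def, units_smul_eq_intCast_mul, mul_div_assoc]
    · simp only [SignedSwap.smul_def, units_smul_eq_intCast_mul]
      push_cast
      linear_combination h3 + a * s.1 * hα + b * s.2.1 * hβ + 6 * k * s.2.2 * hγ
  · refine ⟨α * b, β * a, γ * k, ?_, hpar _ _ _ _ h2, hpar _ _ _ _ h1, ?_⟩
    · rw [hw]
      simp [SignedSwap.smul_def, units_smul_eq_intCast_mul, mul_div_assoc]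
    · simp only [SignedSwap.smul_def, units_smul_eq_intCast_mul]
      push_cast
      linear_combination h3 + b * s.2.1 * hα + a * s.1 * hβ + 6 * k * s.2.2 * hγ

theorem image_modelLattice_smul {p : ℕ} [Fact p.Prime] {s : ZMod p × ZMod p × ZMod p}
    (g : SignedSwap) {σ : Q.IsometryEquiv Q} (hσ : ∀ v, c (σ v) = g • c v) :
    σ '' (modelLattice c s : Set V) = modelLattice c (g • s) := by
  apply Set.Subset.antisymm
  · rintro _ ⟨v, hv, rfl⟩
    exact smul_mem_modelLattice g (hσ v) hv
  · intro w hw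
    refine ⟨σ.symm w, ?_, by simp⟩
    have h := hσ (σ.symm w)
    rw [QuadraticMap.IsometryEquiv.apply_symm_apply] at h
    have h1 := smul_mem_modelLattice (w := σ.symm w) g⁻¹ (by rw [h, inv_smul_smul]) hw
    rwa [inv_smul_smul] at h1

end QuadraticSpace

/-! ### Isometries between model lattices. -/

namespace QuadraticSpace

variable {V : Type*} [AddCommGroup V] [Module ℚ V]
variable {Q : QuadraticForm ℚ V} {c : V ≃ₗ[ℚ] ℚ × ℚ × ℚ}

theorem exists_intCast_eq_and_two_dvd_sub {p : ℕ} (hp : p % 2 = 1) (r : ZMod p) (z : ℤ) :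
    ∃ n : ℤ, (n : ZMod p) = r ∧ 2 ∣ n - z := by
  obtain ⟨m, rfl⟩ := ZMod.intCast_surjective r
  refine ⟨m + p * (z - m), by simp, ?_⟩
  obtain ⟨k, hk⟩ : ∃ k : ℤ, (p : ℤ) = 2 * k + 1 := ⟨p / 2, by omega⟩
  rw [hk]
  exact ⟨k * (z - m), by ring⟩

theorem natCast_zmod_ne_zero {p n : ℕ} (h0 : 0 < n) (hn : n < p) : (n : ZMod p) ≠ 0 := by
  intro h
  rw [ZMod.natCast_eq_zero_iff] at h
  exact absurd (Nat.le_of_dvd h0 h) (by omega)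

theorem two_mul_dvd_of_dvd {p : ℕ} (hp : p % 2 = 1) {n : ℤ} (h2 : 2 ∣ n) (h : (n : ZMod p) = 0) :
    2 * (p : ℤ) ∣ n := by
  rw [ZMod.intCast_zmod_eq_zero_iff_dvd] at h
  refine IsCoprime.mul_dvd ?_ h2 h
  have : Nat.Coprime 2 p := by
    rw [Nat.coprime_two_left, Nat.odd_iff]
    exact hp
  exact_mod_cast Nat.isCoprime_iff_coprime.2 this

/-- The standard lattice is determined by any of the model lattices. -/
theorem IsDiagonal.mem_standardLattice_iff (hQ : IsDiagonal Q c) {p : ℕ} [hp : Fact p.Prime]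
    (hp3 : 3 < p) {s : ZMod p × ZMod p × ZMod p} (hs : s ∈ quadricPoints (ZMod p)) (v : V) :
    v ∈ standardLattice c ↔ ∃ m w, v = m + w ∧ (m ∈ modelLattice c s ∧ ∃ n : ℤ, Q m = 2 * n) ∧
      (2 * p : ℤ) • w ∈ modelLattice c s ∧
      ∀ m' ∈ modelLattice c s, (∃ n : ℤ, Q m' = 2 * n) →
        ∃ n : ℤ, QuadraticMap.associated (R := ℚ) Q w m' = 4 * p * n := by
  have hodd : p % 2 = 1 := Nat.odd_iff.1 (hp.out.odd_of_ne_two (by omega))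
  have hp0 : (p : ℚ) ≠ 0 := by exact_mod_cast hp.out.ne_zero
  have h2 : (2 : ZMod p) ≠ 0 := by exact_mod_cast natCast_zmod_ne_zero (n := 2) (by norm_num) (by omega)
  have h3 : (3 : ZMod p) ≠ 0 := by exact_mod_cast natCast_zmod_ne_zero (n := 3) (by norm_num) hp3
  constructor
  · rintro ⟨x, y, z, hv⟩
    -- Write ⟨v, s⟩ = x s₁ + y s₂ + 3 z s₃, so that ⟨s, s⟩ = 3. Take an integral lift w₀ of s with
    -- coordinates even, even, odd, and n ≡ ⟨v, s⟩ / 3 mod p with n ≡ z mod 2. Then v − n w₀ is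
    -- orthogonal to s modulo p and its third coordinate is even.
    obtain ⟨x0, hx0, hx2⟩ := exists_intCast_eq_and_two_dvd_sub hodd s.1 0
    obtain ⟨y0, hy0, hy2⟩ := exists_intCast_eq_and_two_dvd_sub hodd s.2.1 0
    obtain ⟨z0, hz0, hz2⟩ := exists_intCast_eq_and_two_dvd_sub hodd s.2.2 1
    obtain ⟨n, hn, hn2⟩ := exists_intCast_eq_and_two_dvd_sub hodd
      ((x * s.1 + y * s.2.1 + 3 * z * s.2.2) / 3) z
    have hs' : s.1 ^ 2 + s.2.1 ^ 2 + 3 * s.2.2 ^ 2 = 3 := hs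
    obtain ⟨x1, rfl⟩ : ∃ x1, x0 = 2 * x1 := ⟨x0 / 2, by omega⟩
    obtain ⟨y1, rfl⟩ : ∃ y1, y0 = 2 * y1 := ⟨y0 / 2, by omega⟩
    obtain ⟨z1, rfl⟩ : ∃ z1, z0 = 2 * z1 + 1 := ⟨z0 / 2, by omega⟩
    obtain ⟨n1, rfl⟩ : ∃ n1, n = 2 * n1 + z := ⟨(n - z) / 2, by omega⟩
    set w0 : V := c.symm (((2 * x1 : ℤ) : ℚ), ((2 * y1 : ℤ) : ℚ), ((2 * z1 + 1 : ℤ) : ℚ)) with hw0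
    refine ⟨v - (2 * n1 + z) • w0, (2 * n1 + z) • w0, by abel, ?_, ?_, ?_⟩
    · have hc : c (v - (2 * n1 + z) • w0) = (((2 * (x - (2 * n1 + z) * (2 * x1)) : ℤ) : ℚ) / 2,
          ((2 * (y - (2 * n1 + z) * (2 * y1)) : ℤ) : ℚ) / 2,
          ((z - (2 * n1 + z) * (2 * z1 + 1) : ℤ) : ℚ)) := by
        rw [map_sub, hv, ← Int.cast_smul_eq_zsmul ℚ, map_smul, hw0, LinearEquiv.apply_symm_apply]
        ext <;> simp
      have hk : 2 ∣ z - (2 * n1 + z) * (2 * z1 + 1) := ⟨-(n1 * (2 * z1 + 1) + z * z1), by ring⟩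
      have ha := (dvd_mul_right 2 (x - (2 * n1 + z) * (2 * x1))).sub hk
      have hb := (dvd_mul_right 2 (y - (2 * n1 + z) * (2 * y1))).sub hk
      refine ⟨⟨_, _, _, hc, ha, hb, ?_⟩, (hQ.even_iff hc ha hb).2 hk⟩
      rw [eq_div_iff h3] at hn
      push_cast at hx0 hy0 hz0 hn ⊢
      rw [hx0, hy0, hz0]
      linear_combination -2 * hn - 2 * (2 * n1 + z) * hs'
    · rw [smul_smul, ← Int.cast_smul_eq_zsmul ℚ, hw0, ← map_smul]
      refine symm_mem_modelLattice (2 * (2 * p * (2 * n1 + z)) * (2 * x1))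
        (2 * (2 * p * (2 * n1 + z)) * (2 * y1)) ((2 * p * (2 * n1 + z)) * (2 * z1 + 1))
        (by simp; ring) (by simp; ring) (by simp) ?_ ?_ ?_
      · exact ⟨(2 * p * (2 * n1 + z)) * (2 * x1) - p * (2 * n1 + z) * (2 * z1 + 1), by ring⟩
      · exact ⟨(2 * p * (2 * n1 + z)) * (2 * y1) - p * (2 * n1 + z) * (2 * z1 + 1), by ring⟩
      · push_cast
        simp
    · rintro m' ⟨a, b, k, hm, ha, hb, h0⟩ he
      rw [hQ.even_iff hm ha hb] at he
      obtain ⟨k, rfl⟩ := he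
      obtain ⟨a, rfl⟩ : ∃ a', a = 2 * a' := ⟨a / 2, by omega⟩
      obtain ⟨b, rfl⟩ : ∃ b', b = 2 * b' := ⟨b / 2, by omega⟩
      obtain ⟨t, ht⟩ : 2 * (p : ℤ) ∣ (2 * x1) * a + (2 * y1) * b + 3 * (2 * z1 + 1) * (2 * k) := by
        apply two_mul_dvd_of_dvd hodd
        · exact ⟨x1 * a + y1 * b + 3 * (2 * z1 + 1) * k, by ring⟩
        · apply mul_left_cancel₀ h2
          push_cast at hx0 hy0 hz0 h0 ⊢
          rw [hx0, hy0, hz0]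
          linear_combination h0
      refine ⟨(2 * n1 + z) * t, ?_⟩
      rw [hQ.associated_eq, ← Int.cast_smul_eq_zsmul ℚ, map_smul, hw0, LinearEquiv.apply_symm_apply,
        hm]
      have ht' := congrArg (Int.cast : ℤ → ℚ) ht
      push_cast at ht' ⊢
      simp only [Prod.smul_mk, smul_eq_mul]
      linear_combination 2 * (2 * n1 + z) * ht'
  · rintro ⟨m, w, rfl, ⟨⟨a, b, k, hm, ha, hb, -⟩, he⟩, hw, hw'⟩
    apply add_mem
    · rw [hQ.even_iff hm ha hb] at he
      refine ⟨a / 2, b / 2, k, ?_⟩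
      obtain ⟨a, rfl⟩ : ∃ a', a = 2 * a' := ⟨a / 2, by omega⟩
      obtain ⟨b, rfl⟩ : ∃ b', b = 2 * b' := ⟨b / 2, by omega⟩
      rw [hm]
      simp
    -- Testing w against 2p times integral vectors makes its first two coordinates and three times
    -- its third integral. Since 2p w is in the model lattice, 2p times the third is integral too,
    -- and 3 is prime to 2p.
    · have test : ∀ x y z : ℤ, ∃ n : ℤ, QuadraticMap.associated (R := ℚ) Q w
          (c.symm (2 * p * x, 2 * p * y, 2 * p * z)) = 4 * p * n := by
        intro x y z
        have hm : c.symm (2 * p * x, 2 * p * y, 2 * p * z) ∈ modelLattice c s := by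
          refine symm_mem_modelLattice (4 * p * x) (4 * p * y) (2 * p * z) ?_ ?_ ?_ ?_ ?_ ?_
          · push_cast; ring
          · push_cast; ring
          · push_cast; ring
          · exact ⟨2 * p * x - p * z, by ring⟩
          · exact ⟨2 * p * y - p * z, by ring⟩
          · push_cast; simp
        refine hw' _ hm ⟨4 * p ^ 2 * x ^ 2 + 4 * p ^ 2 * y ^ 2 + 12 * p ^ 2 * z ^ 2, ?_⟩
        rw [hQ, LinearEquiv.apply_symm_apply]
        push_cast
        ring
      simp only [hQ.associated_eq, LinearEquiv.apply_symm_apply] at test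
      obtain ⟨n1, hn1⟩ := test 1 0 0
      obtain ⟨n2, hn2⟩ := test 0 1 0
      obtain ⟨n3, hn3⟩ := test 0 0 1
      push_cast at hn1 hn2 hn3
      obtain ⟨_, _, k, hk, -⟩ := hw
      rw [← Int.cast_smul_eq_zsmul ℚ, map_smul] at hk
      have hk3 := congrArg (fun x => x.2.2) hk
      simp only [Prod.smul_snd, smul_eq_mul] at hk3
      push_cast at hk3
      have e1 : (c w).1 = n1 := by
        apply mul_left_cancel₀ (mul_ne_zero (four_ne_zero) hp0)
        linear_combination hn1
      have e2 : (c w).2.1 = n2 := by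
        apply mul_left_cancel₀ (mul_ne_zero (four_ne_zero) hp0)
        linear_combination hn2
      have e3 : 3 * (c w).2.2 = n3 := by
        apply mul_left_cancel₀ (mul_ne_zero (four_ne_zero) hp0)
        linear_combination hn3
      have hcop : IsCoprime (3 : ℤ) (2 * p : ℤ) := by
        have h : Nat.Coprime 3 (2 * p) := by
          apply Nat.Coprime.mul_right (by norm_num)
          exact (Nat.coprime_primes Nat.prime_three hp.out).2 (by omega)
        exact_mod_cast Nat.isCoprime_iff_coprime.2 h
      obtain ⟨α, β, hαβ⟩ := hcop
      have hαβ' := congrArg (Int.cast : ℤ → ℚ) hαβ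
      push_cast at hαβ'
      refine ⟨n1, n2, α * n3 + β * k, Prod.ext e1 (Prod.ext e2 ?_)⟩
      push_cast
      linear_combination -(c w).2.2 * hαβ' + α * e3 + β * hk3

/-- The description in `mem_standardLattice_iff` mentions only the model lattice and the form, so an
isometry transports it. -/
theorem IsDiagonal.map_standardLattice (hQ : IsDiagonal Q c) {p : ℕ} [hp : Fact p.Prime]
    (hp3 : 3 < p) {s t : ZMod p × ZMod p × ZMod p} (hs : s ∈ quadricPoints (ZMod p))
    (ht : t ∈ quadricPoints (ZMod p)) {σ : Q.IsometryEquiv Q}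
    (hσ : σ '' (modelLattice c s : Set V) = modelLattice c t) {v : V}
    (hv : v ∈ standardLattice c) : σ v ∈ standardLattice c := by
  have hmem : ∀ {m}, m ∈ modelLattice c s → σ m ∈ modelLattice c t := by
    intro m hm
    rw [← SetLike.mem_coe, ← hσ]
    exact ⟨m, hm, rfl⟩
  rw [hQ.mem_standardLattice_iff hp3 ht]
  obtain ⟨m, w, rfl, ⟨hm, n, hn⟩, hw, hw'⟩ := (hQ.mem_standardLattice_iff hp3 hs v).1 hv
  refine ⟨σ m, σ w, map_add _ _ _, ⟨hmem hm, n, by rw [QuadraticMap.IsometryEquiv.map_app, hn]⟩, ?_, ?_⟩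
  · have := hmem hw
    rwa [map_zsmul] at this
  · intro m' hm' he
    rw [← SetLike.mem_coe, ← hσ] at hm'
    obtain ⟨m', hm', rfl⟩ := hm'
    rw [QuadraticMap.IsometryEquiv.map_app] at he
    rw [associated_isometryEquiv]
    exact hw' m' hm' he

/-- The first two basis vectors go to integral solutions of x² + y² + 3z² = 1, which are ± one of
these two vectors. The third goes to a vector orthogonal to both images, hence to ± itself. -/
theorem IsDiagonal.exists_signedSwap (hQ : IsDiagonal Q c) {σ : Q.IsometryEquiv Q}
    (hσ : ∀ v ∈ standardLattice c, σ v ∈ standardLattice c) :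
    ∃ g : SignedSwap, ∀ v, c (σ v) = g • c v := by
  obtain ⟨x0, y0, z0, h0⟩ := hσ (c.symm (1, 0, 0)) ⟨1, 0, 0, by simp⟩
  obtain ⟨x1, y1, z1, h1⟩ := hσ (c.symm (0, 1, 0)) ⟨0, 1, 0, by simp⟩
  obtain ⟨x2, y2, z2, h2⟩ := hσ (c.symm (0, 0, 1)) ⟨0, 0, 1, by simp⟩
  have q0 := associated_isometryEquiv σ (c.symm (1, 0, 0)) (c.symm (1, 0, 0))
  have q1 := associated_isometryEquiv σ (c.symm (0, 1, 0)) (c.symm (0, 1, 0))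
  have q2 := associated_isometryEquiv σ (c.symm (0, 0, 1)) (c.symm (0, 0, 1))
  have q01 := associated_isometryEquiv σ (c.symm (1, 0, 0)) (c.symm (0, 1, 0))
  have q02 := associated_isometryEquiv σ (c.symm (1, 0, 0)) (c.symm (0, 0, 1))
  have q12 := associated_isometryEquiv σ (c.symm (0, 1, 0)) (c.symm (0, 0, 1))
  simp only [hQ.associated_eq, h0, h1, h2, LinearEquiv.apply_symm_apply] at q0 q1 q2 q01 q02 q12
  replace q0 : x0 * x0 + y0 * y0 + 3 * (z0 * z0) = 1 := by
    have : ((x0 * x0 + y0 * y0 + 3 * (z0 * z0) : ℤ) : ℚ) = 1 := by push_cast; linarith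
    exact_mod_cast this
  replace q1 : x1 * x1 + y1 * y1 + 3 * (z1 * z1) = 1 := by
    have : ((x1 * x1 + y1 * y1 + 3 * (z1 * z1) : ℤ) : ℚ) = 1 := by push_cast; linarith
    exact_mod_cast this
  replace q2 : x2 * x2 + y2 * y2 + 3 * (z2 * z2) = 3 := by
    have : ((x2 * x2 + y2 * y2 + 3 * (z2 * z2) : ℤ) : ℚ) = 3 := by push_cast; linarith
    exact_mod_cast this
  replace q01 : x0 * x1 + y0 * y1 + 3 * (z0 * z1) = 0 := by
    have : ((x0 * x1 + y0 * y1 + 3 * (z0 * z1) : ℤ) : ℚ) = 0 := by push_cast; linarith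
    exact_mod_cast this
  replace q02 : x0 * x2 + y0 * y2 + 3 * (z0 * z2) = 0 := by
    have : ((x0 * x2 + y0 * y2 + 3 * (z0 * z2) : ℤ) : ℚ) = 0 := by push_cast; linarith
    exact_mod_cast this
  replace q12 : x1 * x2 + y1 * y2 + 3 * (z1 * z2) = 0 := by
    have : ((x1 * x2 + y1 * y2 + 3 * (z1 * z2) : ℤ) : ℚ) = 0 := by push_cast; linarith
    exact_mod_cast this
  have unit : ∀ x y z : ℤ, x * x + y * y + 3 * (z * z) = 1 →
      z = 0 ∧ ((∃ u : ℤˣ, x = u ∧ y = 0) ∨ (∃ u : ℤˣ, x = 0 ∧ y = u)) := by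
    intro x y z h
    have hz : z = 0 := by
      by_contra hz
      have : 0 < z * z := mul_self_pos.2 hz
      nlinarith [mul_self_nonneg x, mul_self_nonneg y]
    subst hz
    refine ⟨rfl, ?_⟩
    by_cases hx : x = 0
    · subst hx
      have hy : y * y = 1 := by linarith
      exact Or.inr ⟨⟨y, y, hy, hy⟩, rfl, rfl⟩
    · have hx1 : 0 < x * x := mul_self_pos.2 hx
      have hy : y = 0 := by
        by_contra hy
        have : 0 < y * y := mul_self_pos.2 hy
        linarith
      subst hy
      have hx : x * x = 1 := by linarith
      exact Or.inl ⟨⟨x, x, hx, hx⟩, rfl, rfl⟩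
  have key : ∀ v, c (σ v) = (c v).1 • ((x0 : ℚ), (y0 : ℚ), (z0 : ℚ)) +
      (c v).2.1 • ((x1 : ℚ), (y1 : ℚ), (z1 : ℚ)) + (c v).2.2 • ((x2 : ℚ), (y2 : ℚ), (z2 : ℚ)) := by
    intro v
    have hv : v = (c v).1 • c.symm (1, 0, 0) + (c v).2.1 • c.symm (0, 1, 0) +
        (c v).2.2 • c.symm (0, 0, 1) := by
      apply c.injective
      simp only [map_add, map_smul, LinearEquiv.apply_symm_apply]
      ext <;> simp
    have hlin : ∀ (r : ℚ) (x : V), σ (r • x) = r • σ x := fun r x => σ.toLinearEquiv.map_smul r x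
    conv_lhs => rw [hv]
    have hadd : ∀ x y : V, σ (x + y) = σ x + σ y := fun x y => map_add σ x y
    rw [hadd, hadd, hlin, hlin, hlin, map_add, map_add, c.map_smul, c.map_smul, c.map_smul,
      h0, h1, h2]
  obtain ⟨rfl, u0⟩ := unit _ _ _ q0
  obtain ⟨rfl, u1⟩ := unit _ _ _ q1
  have third : x2 = 0 → y2 = 0 → ∃ u : ℤˣ, z2 = u := by
    rintro rfl rfl
    have : z2 * z2 = 1 := by linarith
    exact ⟨⟨z2, z2, this, this⟩, rfl⟩
  have hu : ∀ u : ℤˣ, (u : ℤ) ≠ 0 := fun u => u.ne_zero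
  rcases u0 with ⟨a, rfl, rfl⟩ | ⟨b, rfl, rfl⟩ <;> rcases u1 with ⟨a', rfl, rfl⟩ | ⟨b', rfl, rfl⟩
  · simp at q01
  · have hx2 : x2 = 0 := by simpa [hu] using q02
    have hy2 : y2 = 0 := by simpa [hu] using q12
    obtain ⟨e, rfl⟩ := third hx2 hy2
    refine ⟨⟨false, a, b', e⟩, fun v => ?_⟩
    rw [key, hx2, hy2]
    simp [SignedSwap.smul_def, units_smul_eq_intCast_mul, mul_comm]
  · have hx2 : x2 = 0 := by simpa [hu] using q12
    have hy2 : y2 = 0 := by simpa [hu] using q02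
    obtain ⟨e, rfl⟩ := third hx2 hy2
    refine ⟨⟨true, a', b, e⟩, fun v => ?_⟩
    rw [key, hx2, hy2]
    simp [SignedSwap.smul_def, units_smul_eq_intCast_mul, mul_comm]
  · simp at q01

/-- The sign left open by `eq_or_neg_eq_of_modelLattice_le` is absorbed because −1 belongs to the
group. -/
theorem IsDiagonal.isometric_modelLattice_iff (hQ : IsDiagonal Q c) {p : ℕ} [hp : Fact p.Prime]
    (hp3 : 3 < p) {s t : ZMod p × ZMod p × ZMod p} (hs : s ∈ quadricPoints (ZMod p))
    (ht : t ∈ quadricPoints (ZMod p)) :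
    Isometric Q (modelLattice c s) (modelLattice c t) ↔ ∃ g : SignedSwap, t = g • s := by
  constructor
  · rintro ⟨σ, hσ⟩
    obtain ⟨g, hg⟩ := hQ.exists_signedSwap fun v hv => hQ.map_standardLattice hp3 hs ht hσ hv
    rw [image_modelLattice_smul g hg] at hσ
    rcases eq_or_neg_eq_of_modelLattice_le hp3 (g.smul_mem_quadricPoints hs) ht
      (le_of_eq (SetLike.coe_injective hσ)) with h | h
    · exact ⟨g, h⟩
    · refine ⟨⟨false, -1, -1, -1⟩ * g, ?_⟩
      rw [h, mul_smul]
      generalize g • s = r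
      simp [SignedSwap.smul_def]
      rfl
  · rintro ⟨g, rfl⟩
    obtain ⟨σ, hσ⟩ := hQ.exists_isometryEquiv_smul g
    exact ⟨σ, image_modelLattice_smul g hσ⟩

end QuadraticSpace

/-! ### Model lattices lie in one genus. -/

namespace QuadraticSpace

variable {V : Type*} [AddCommGroup V] [Module ℚ V]
variable {Q : QuadraticForm ℚ V} {c : V ≃ₗ[ℚ] ℚ × ℚ × ℚ}

theorem natCast_zsmul_mem_modelLattice {p : ℕ} (s t : ZMod p × ZMod p × ZMod p) {v : V}
    (hv : v ∈ modelLattice c s) : (p : ℤ) • v ∈ modelLattice c t := by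
  obtain ⟨a, b, k, h, h1, h2, -⟩ := hv
  refine ⟨p * a, p * b, p * k, ?_, ?_, ?_, by push_cast; simp⟩
  · rw [← Int.cast_smul_eq_zsmul ℚ, map_smul, h]
    simp [mul_div_assoc]
  · rw [← mul_sub]
    exact Dvd.dvd.mul_left h1 _
  · rw [← mul_sub]
    exact Dvd.dvd.mul_left h2 _

/-- The reflection in a vector with integral coordinates. -/
theorem IsDiagonal.exists_reflection (hQ : IsDiagonal Q c) (x y z : ℤ)
    (hN : x ^ 2 + y ^ 2 + 3 * z ^ 2 ≠ 0) :
    ∃ σ : Q.IsometryEquiv Q, (∀ v, σ.symm v = σ v) ∧ ∀ (v : V) (a b k : ℤ),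
      c v = ((a : ℚ) / 2, (b : ℚ) / 2, (k : ℚ)) →
      c ((4 * (x ^ 2 + y ^ 2 + 3 * z ^ 2)) • σ v) =
        (((2 * (2 * (x ^ 2 + y ^ 2 + 3 * z ^ 2) * a - 4 * (a * x + b * y + 6 * k * z) * x) : ℤ) : ℚ) / 2,
        ((2 * (2 * (x ^ 2 + y ^ 2 + 3 * z ^ 2) * b - 4 * (a * x + b * y + 6 * k * z) * y) : ℤ) : ℚ) / 2,
        ((4 * ((x ^ 2 + y ^ 2 + 3 * z ^ 2) * k - (a * x + b * y + 6 * k * z) * z) : ℤ) : ℚ)) := by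
  have hN' : (x ^ 2 + y ^ 2 + 3 * z ^ 2 : ℚ) ≠ 0 := by exact_mod_cast hN
  let l : V → ℚ := fun v => 2 * ((c v).1 * x + (c v).2.1 * y + 3 * (c v).2.2 * z) /
    (x ^ 2 + y ^ 2 + 3 * z ^ 2)
  have hl : ∀ v, l v * (x ^ 2 + y ^ 2 + 3 * z ^ 2) =
      2 * ((c v).1 * x + (c v).2.1 * y + 3 * (c v).2.2 * z) := fun v => by
    simp only [l]
    field_simp
  let f : V →ₗ[ℚ] V :=
    { toFun := fun v => v - l v • c.symm ((x : ℚ), (y : ℚ), (z : ℚ))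
      map_add' := fun v w => by
        have : l (v + w) = l v + l w := by
          simp only [l, map_add, Prod.fst_add, Prod.snd_add]
          ring
        rw [this, add_smul]
        abel
      map_smul' := fun r v => by
        have : l (r • v) = r * l v := by
          simp only [l, map_smul, Prod.smul_fst, Prod.smul_snd, smul_eq_mul]
          ring
        rw [this, mul_smul, RingHom.id_apply, smul_sub] }
  have hf : ∀ v, c (f v) = ((c v).1 - l v * x, (c v).2.1 - l v * y, (c v).2.2 - l v * z) := by
    intro v
    simp only [f, LinearMap.coe_mk, AddHom.coe_mk, map_sub, map_smul, LinearEquiv.apply_symm_apply]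
    ext <;> simp
  obtain ⟨σ, hσ⟩ := hQ.exists_isometryEquiv f (fun v => by
    rw [hQ, hQ, hf]
    linear_combination 2 * l v * hl v)
  have hinv : ∀ v, σ (σ v) = v := by
    intro v
    have hlf : l (f v) = - l v := by
      apply mul_right_cancel₀ hN'
      rw [hl, hf]
      linear_combination -hl v
    apply c.injective
    rw [hσ, hσ, hf, hf, hlf]
    ext <;> simp
  refine ⟨σ, fun v => ?_, ?_⟩
  · conv_lhs => rw [← hinv v]
    rw [QuadraticMap.IsometryEquiv.symm_apply_apply]
  · intro v a b k hv
    have h := hl v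
    rw [hv] at h
    rw [← Int.cast_smul_eq_zsmul ℚ, map_smul, hσ, hf, hv]
    push_cast
    refine Prod.ext ?_ (Prod.ext ?_ ?_)
    · simp only [Prod.smul_mk, smul_eq_mul]
      linear_combination -4 * x * h
    · simp only [Prod.smul_mk, smul_eq_mul]
      linear_combination -4 * y * h
    · simp only [Prod.smul_mk, smul_eq_mul]
      linear_combination -4 * z * h

/-- For q ≠ p each lattice contains p times the other, and p is a unit of ℤ_q. For q = p the vectors
s and ε(0, 0, 1) have the same norm modulo p, so the reflection in their difference exchanges them.
-/
theorem IsDiagonal.modelLattice_mem_genus (hQ : IsDiagonal Q c) {p : ℕ} [hp : Fact p.Prime]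
    (hp3 : 3 < p) {s : ZMod p × ZMod p × ZMod p} (hs : s ∈ quadricPoints (ZMod p)) :
    modelLattice c s ∈ genus Q (modelLattice c ((0, 0, 1) : ZMod p × ZMod p × ZMod p)) := by
  refine ⟨isLattice_modelLattice hp.out.ne_zero s, fun q hq => ?_⟩
  by_cases hqp : q = p
  · subst hqp
    have h2 : (2 : ZMod q) ≠ 0 := by
      exact_mod_cast natCast_zmod_ne_zero (n := 2) (by norm_num) (by omega)
    have h3 : (3 : ZMod q) ≠ 0 := by
      exact_mod_cast natCast_zmod_ne_zero (n := 3) (by norm_num) hp3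
    obtain ⟨x, hx⟩ := ZMod.intCast_surjective s.1
    obtain ⟨y, hy⟩ := ZMod.intCast_surjective s.2.1
    obtain ⟨z, hz⟩ := ZMod.intCast_surjective s.2.2
    -- The difference has norm 6(1 − ε s₃) modulo p, and at least one sign ε makes this a unit.
    obtain ⟨ε, hε, hne⟩ : ∃ ε : ℤ, ε * ε = 1 ∧ (1 - ε * s.2.2 : ZMod q) ≠ 0 := by
      by_cases h : s.2.2 = 1
      · refine ⟨-1, by norm_num, ?_⟩
        rw [h]
        convert h2 using 1
        push_cast
        ring
      · refine ⟨1, by norm_num, ?_⟩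
        rw [sub_ne_zero]
        push_cast
        rw [one_mul]
        exact Ne.symm h
    have hε' : (ε : ZMod q) * ε = 1 := by exact_mod_cast congrArg (Int.cast : ℤ → ZMod q) hε
    have hs' : s.1 ^ 2 + s.2.1 ^ 2 + 3 * s.2.2 ^ 2 = 3 := hs
    have hNmod : ((x ^ 2 + y ^ 2 + 3 * (z - ε) ^ 2 : ℤ) : ZMod q) = 2 * 3 * (1 - ε * s.2.2) := by
      push_cast
      rw [hx, hy, hz]
      linear_combination hs' + 3 * hε'
    have hN0 : ((x ^ 2 + y ^ 2 + 3 * (z - ε) ^ 2 : ℤ) : ZMod q) ≠ 0 := by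
      rw [hNmod]
      exact mul_ne_zero (mul_ne_zero h2 h3) hne
    have hN : x ^ 2 + y ^ 2 + 3 * (z - ε) ^ 2 ≠ 0 := by
      intro h
      rw [h] at hN0
      simp at hN0
    -- Four times the norm clears the denominators of the reflection and makes all numerators even,
    -- so the parity conditions hold automatically.
    have hn : ¬ (q : ℤ) ∣ 4 * (x ^ 2 + y ^ 2 + 3 * (z - ε) ^ 2) := by
      rw [← ZMod.intCast_zmod_eq_zero_iff_dvd, Int.cast_mul]
      refine mul_ne_zero ?_ hN0
      push_cast
      rw [show (4 : ZMod q) = 2 * 2 by norm_num]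
      exact mul_ne_zero h2 h2
    obtain ⟨σ, hσ, hσ'⟩ := hQ.exists_reflection x y (z - ε) hN
    have hdvd : ∀ m : ℤ, 2 ∣ 4 * m := fun m => ⟨2 * m, by ring⟩
    refine locallyIsometric_of_isometryEquiv σ (fun v hv => ⟨_, hn, ?_⟩) (fun v hv => ⟨_, hn, ?_⟩)
    · obtain ⟨a, b, k, h, h1, h2', h3'⟩ := hv
      refine ⟨_, _, _, hσ' v a b k h, (dvd_mul_right _ _).sub (hdvd _),
        (dvd_mul_right _ _).sub (hdvd _), ?_⟩
      push_cast at hNmod h3' ⊢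
      rw [hx, hy, hz] at hNmod ⊢
      rw [hNmod]
      linear_combination (-8 * (a * s.1 + b * s.2.1) + 48 * ε * k - 48 * k * s.2.2) * hs' +
        24 * (ε - s.2.2) * h3' - 144 * s.2.2 * k * hε'
    · rw [hσ]
      obtain ⟨a, b, k, h, h1, h2', h3'⟩ := hv
      refine ⟨_, _, _, hσ' v a b k h, (dvd_mul_right _ _).sub (hdvd _),
        (dvd_mul_right _ _).sub (hdvd _), ?_⟩
      push_cast at hNmod h3' ⊢
      rw [hx, hy, hz] at hNmod ⊢
      rw [hNmod]
      linear_combination 24 * (ε - s.2.2) * h3' - 144 * k * hε'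
  · refine locallyIsometric_of_isometryEquiv (QuadraticMap.IsometryEquiv.refl Q)
      (fun v hv => ⟨p, ?_, natCast_zsmul_mem_modelLattice _ _ hv⟩)
      (fun v hv => ⟨p, ?_, natCast_zsmul_mem_modelLattice _ _ hv⟩) <;>
    · intro h
      exact hqp ((Nat.prime_dvd_prime_iff_eq hq.out hp.out).1 (by exact_mod_cast h))

end QuadraticSpace

/-! ### Indices, adapted frames and the enlarged lattice. -/

namespace QuadraticSpace

variable {V : Type*} [AddCommGroup V] [Module ℚ V]

/-- `M₀` is the kernel of l modulo n on M, and l modulo n is onto because it takes a value prime to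
n. -/
theorem relIndex_eq_of_linearMap (l : V →ₗ[ℚ] ℚ) {M₀ M : Submodule ℤ V} {n : ℕ}
    (hint : ∀ v ∈ M, ∃ k : ℤ, l v = k) (h0 : ∀ v, v ∈ M₀ ↔ v ∈ M ∧ ∃ k : ℤ, l v = n * k)
    (hs : ∃ v ∈ M, ∃ k : ℤ, l v = k ∧ IsCoprime k n) :
    M₀.toAddSubgroup.relIndex M.toAddSubgroup = n := by
  have hint' : ∀ v : M.toAddSubgroup, ∃ k : ℤ, l v = k := fun v => hint v v.2
  choose k hk using hint'
  let φ : M.toAddSubgroup →+ ZMod n :=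
    { toFun := fun v => (k v : ZMod n)
      map_zero' := by
        have h := hk 0
        have : k 0 = 0 := by
          have h2 : ((k 0 : ℤ) : ℚ) = 0 := by rw [← h]; simp
          exact_mod_cast h2
        rw [this]
        simp
      map_add' := fun v w => by
        have : k (v + w) = k v + k w := by
          have h2 : ((k (v + w) : ℤ) : ℚ) = ((k v + k w : ℤ) : ℚ) := by
            push_cast
            rw [← hk, ← hk, ← hk]
            simp
          exact_mod_cast h2
        rw [this]
        push_cast
        rfl }
  have hker : M₀.toAddSubgroup.addSubgroupOf M.toAddSubgroup = φ.ker := by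
    ext v
    rw [AddSubgroup.mem_addSubgroupOf, AddMonoidHom.mem_ker]
    change (v : V) ∈ M₀ ↔ (k v : ZMod n) = 0
    rw [h0, ZMod.intCast_zmod_eq_zero_iff_dvd]
    constructor
    · rintro ⟨-, j, hj⟩
      refine ⟨j, ?_⟩
      have h2 : ((k v : ℤ) : ℚ) = ((n * j : ℤ) : ℚ) := by
        rw [← hk, hj]
        push_cast
        rfl
      exact_mod_cast h2
    · rintro ⟨j, hj⟩
      refine ⟨v.2, j, ?_⟩
      rw [hk, hj]
      push_cast
      rfl
  have hsurj : φ.range = ⊤ := by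
    rw [AddMonoidHom.range_eq_top]
    obtain ⟨v, hv, j, hj, a, b, hab⟩ := hs
    have hkv : k ⟨v, hv⟩ = j := by
      have h2 : ((k ⟨v, hv⟩ : ℤ) : ℚ) = j := by rw [← hk, ← hj]
      exact_mod_cast h2
    intro x
    obtain ⟨x, rfl⟩ := ZMod.intCast_surjective x
    refine ⟨(x * a) • ⟨v, hv⟩, ?_⟩
    rw [map_zsmul]
    change (x * a) • ((k ⟨v, hv⟩ : ℤ) : ZMod n) = _
    rw [hkv]
    have h3 := congrArg (Int.cast : ℤ → ZMod n) hab
    push_cast at h3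
    rw [zsmul_eq_mul]
    push_cast
    simp only [ZMod.natCast_self, mul_zero, add_zero] at h3
    linear_combination (x : ZMod n) * h3
  rw [AddSubgroup.relIndex, hker, AddSubgroup.index_ker, hsurj,
    Nat.card_congr AddSubgroup.topEquiv.toEquiv, Nat.card_zmod]

/-- The index is the absolute value of the determinant of the base change, which enters the Gram
determinant squared. -/
theorem det_gram_eq_relIndex_sq_mul {n : ℕ} (Q : QuadraticForm ℚ V) {L M : Submodule ℤ V}
    (hL : L.IsLattice ℚ) (hM : M.IsLattice ℚ) (h : L ≤ M) (b : Module.Basis (Fin n) ℤ L)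
    (m : Module.Basis (Fin n) ℤ M) :
    (gram Q fun i => (b i : V)).det =
      (L.toAddSubgroup.relIndex M.toAddSubgroup : ℚ) ^ 2 * (gram Q fun i => (m i : V)).det := by
  have hcl : ∀ {L : Submodule ℤ V} (hL : L.IsLattice ℚ) (b : Module.Basis (Fin n) ℤ L),
      L.toAddSubgroup = AddSubgroup.closure (Set.range (b.extendOfIsLattice ℚ)) := by
    intro L hL b
    apply AddSubgroup.toIntSubmodule.injective
    rw [AddSubgroup.toIntSubmodule_closure]
    have h1 : (Set.range (b.extendOfIsLattice ℚ)) = L.subtype '' Set.range b := by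
      rw [← Set.range_comp]
      congr 1
      ext i
      simp
    rw [h1, ← Submodule.map_span, b.span_eq, Submodule.map_top, Submodule.range_subtype]
    rfl
  have hidx := AddSubgroup.relIndex_eq_abs_det L.toAddSubgroup M.toAddSubgroup h
    (b.extendOfIsLattice ℚ) (m.extendOfIsLattice ℚ) (hcl hL b) (hcl hM m)
  rw [hidx, sq_abs, Module.Basis.det_apply]
  have hb : (fun i => (b i : V)) = fun i => ∑ j,
      ((m.extendOfIsLattice ℚ).toMatrix (b.extendOfIsLattice ℚ)).transpose i j • (m j : V) := by
    funext i
    have := (m.extendOfIsLattice ℚ).sum_toMatrix_smul_self (b.extendOfIsLattice ℚ) i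
    simp only [Module.Basis.extendOfIsLattice_apply] at this
    exact this.symm
  rw [hb, gram_sum_smul, Matrix.det_mul, Matrix.det_mul]
  simp only [Matrix.det_transpose]
  ring

/-- A triple of vectors of `M`, spanning a sublattice of index prime to `6p`, whose Gram matrix is
congruent modulo `96p³` to the one with rows `(2, 0, -p)`, `(0, 2, -p)`, `(-p, -p, 7p²)`. -/
structure AdaptedFrame (B : LinearMap.BilinForm ℚ V) (p : ℕ) (M : Submodule ℤ V)
    (f₁ f₂ f₃ : V) (d : ℤ) : Prop where
  symm : ∀ x y, B x y = B y x
  integral : ∀ x ∈ M, ∀ y ∈ M, ∃ n : ℤ, B x y = n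
  mem₁ : f₁ ∈ M
  mem₂ : f₂ ∈ M
  mem₃ : f₃ ∈ M
  coprime : IsCoprime d (96 * p ^ 3)
  span : ∀ v ∈ M, ∃ x y z : ℤ, (d : ℚ) • v = (x : ℚ) • f₁ + (y : ℚ) • f₂ + (z : ℚ) • f₃
  b11 : ∃ k : ℤ, B f₁ f₁ = 2 + 96 * p ^ 3 * k
  b22 : ∃ k : ℤ, B f₂ f₂ = 2 + 96 * p ^ 3 * k
  b33 : ∃ k : ℤ, B f₃ f₃ = 7 * p ^ 2 + 96 * p ^ 3 * k
  b12 : ∃ k : ℤ, B f₁ f₂ = 96 * p ^ 3 * k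
  b13 : ∃ k : ℤ, B f₁ f₃ = -p + 96 * p ^ 3 * k
  b23 : ∃ k : ℤ, B f₂ f₃ = -p + 96 * p ^ 3 * k

/-- The vector orthogonal to `f₁` and `f₂` modulo `24p`. -/
def adaptedVector (p : ℕ) (f₁ f₂ f₃ : V) : V :=
  (1 / (2 * p) : ℚ) • ((2 : ℚ) • f₃ + (p : ℚ) • f₁ + (p : ℚ) • f₂)

/-- The vectors of `M` whose product with `u` is divisible by `12p`. -/
def congruenceSublattice (B : LinearMap.BilinForm ℚ V) (p : ℕ) (M : Submodule ℤ V) (u : V) :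
    Submodule ℤ V where
  carrier := {v | v ∈ M ∧ ∃ k : ℤ, B v u = 12 * p * k}
  add_mem' := by
    rintro v w ⟨hv, k, hk⟩ ⟨hw, l, hl⟩
    exact ⟨add_mem hv hw, k + l, by rw [map_add, LinearMap.add_apply, hk, hl]; push_cast; ring⟩
  zero_mem' := ⟨zero_mem _, 0, by simp⟩
  smul_mem' := by
    rintro n v ⟨hv, k, hk⟩
    refine ⟨M.smul_mem n hv, n * k, ?_⟩
    rw [← Int.cast_smul_eq_zsmul ℚ, map_smul, LinearMap.smul_apply, hk]
    push_cast
    rw [smul_eq_mul]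
    ring

theorem mem_congruenceSublattice {B : LinearMap.BilinForm ℚ V} {p : ℕ} {M : Submodule ℤ V}
    {u v : V} : v ∈ congruenceSublattice B p M u ↔ v ∈ M ∧ ∃ k : ℤ, B v u = 12 * p * k := Iff.rfl

namespace AdaptedFrame

variable {B : LinearMap.BilinForm ℚ V} {p : ℕ} {M : Submodule ℤ V} {f₁ f₂ f₃ : V} {d : ℤ}

theorem apply_adaptedVector (x : V) : B x (adaptedVector p f₁ f₂ f₃) =
    1 / (2 * p) * (2 * B x f₃ + p * B x f₁ + p * B x f₂) := by
  simp only [adaptedVector, map_smul, map_add, smul_eq_mul]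

theorem b1u (h : AdaptedFrame B p M f₁ f₂ f₃ d) (hp : p ≠ 0) :
    ∃ k : ℤ, B f₁ (adaptedVector p f₁ f₂ f₃) = 24 * p * k := by
  have hp' : (p : ℚ) ≠ 0 := by exact_mod_cast hp
  obtain ⟨k1, h1⟩ := h.b11
  obtain ⟨k2, h2⟩ := h.b12
  obtain ⟨k3, h3⟩ := h.b13
  refine ⟨2 * p * (2 * k3 + p * k1 + p * k2), ?_⟩
  rw [apply_adaptedVector, h1, h2, h3]
  push_cast
  field_simp
  ring

theorem b2u (h : AdaptedFrame B p M f₁ f₂ f₃ d) (hp : p ≠ 0) :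
    ∃ k : ℤ, B f₂ (adaptedVector p f₁ f₂ f₃) = 24 * p * k := by
  have hp' : (p : ℚ) ≠ 0 := by exact_mod_cast hp
  obtain ⟨k1, h1⟩ := h.b12
  obtain ⟨k2, h2⟩ := h.b22
  obtain ⟨k3, h3⟩ := h.b23
  refine ⟨2 * p * (2 * k3 + p * k1 + p * k2), ?_⟩
  rw [apply_adaptedVector, h.symm f₂ f₁, h1, h2, h3]
  push_cast
  field_simp
  ring

theorem b3u (h : AdaptedFrame B p M f₁ f₂ f₃ d) (hp : p ≠ 0) :
    ∃ k : ℤ, B f₃ (adaptedVector p f₁ f₂ f₃) = 6 * p * (1 + 8 * p * k) := by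
  have hp' : (p : ℚ) ≠ 0 := by exact_mod_cast hp
  obtain ⟨k1, h1⟩ := h.b13
  obtain ⟨k2, h2⟩ := h.b23
  obtain ⟨k3, h3⟩ := h.b33
  refine ⟨2 * k3 + p * k1 + p * k2, ?_⟩
  rw [apply_adaptedVector, h.symm f₃ f₁, h.symm f₃ f₂, h1, h2, h3]
  push_cast
  field_simp
  ring

theorem buu (h : AdaptedFrame B p M f₁ f₂ f₃ d) (hp : p ≠ 0) :
    ∃ k : ℤ, B (adaptedVector p f₁ f₂ f₃) (adaptedVector p f₁ f₂ f₃) = 6 + 24 * p * k := by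
  have hp' : (p : ℚ) ≠ 0 := by exact_mod_cast hp
  obtain ⟨k11, h11⟩ := h.b11
  obtain ⟨k22, h22⟩ := h.b22
  obtain ⟨k33, h33⟩ := h.b33
  obtain ⟨k12, h12⟩ := h.b12
  obtain ⟨k13, h13⟩ := h.b13
  obtain ⟨k23, h23⟩ := h.b23
  refine ⟨4 * k33 + p ^ 2 * k11 + p ^ 2 * k22 + 4 * p * k13 + 4 * p * k23 + 2 * p ^ 2 * k12, ?_⟩
  rw [apply_adaptedVector, h.symm _ f₁, h.symm _ f₂, h.symm _ f₃, apply_adaptedVector,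
    apply_adaptedVector, apply_adaptedVector, h.symm f₂ f₁, h.symm f₃ f₁, h.symm f₃ f₂,
    h11, h22, h33, h12, h13, h23]
  push_cast
  field_simp
  ring

theorem two_mul_smul_adaptedVector (hp : p ≠ 0) :
    ((2 * p : ℤ) : ℚ) • adaptedVector p f₁ f₂ f₃ = (2 : ℚ) • f₃ + (p : ℚ) • f₁ + (p : ℚ) • f₂ := by
  have hp' : (p : ℚ) ≠ 0 := by exact_mod_cast hp
  rw [adaptedVector, smul_smul]
  have : ((2 * p : ℤ) : ℚ) * (1 / (2 * p)) = 1 := by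
    push_cast
    field_simp
  rw [this, one_smul]

theorem coprime_of_dvd (h : AdaptedFrame B p M f₁ f₂ f₃ d) {n : ℤ} (hn : n ∣ 96 * (p : ℤ) ^ 3) :
    IsCoprime n d :=
  (h.coprime.of_isCoprime_of_dvd_right hn).symm

/-- The product of a vector of `M` with the adapted vector is divisible by `6p`. -/
theorem exists_apply_eq (h : AdaptedFrame B p M f₁ f₂ f₃ d) (hp : p ≠ 0) {v : V} (hv : v ∈ M)
    {x y z : ℤ} (he : (d : ℚ) • v = (x : ℚ) • f₁ + (y : ℚ) • f₂ + (z : ℚ) • f₃) :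
    ∃ m k : ℤ, B v (adaptedVector p f₁ f₂ f₃) = 6 * p * m ∧ d * m = z + 4 * k := by
  have hp' : (p : ℚ) ≠ 0 := by exact_mod_cast hp
  obtain ⟨k1, h1⟩ := h.b1u hp
  obtain ⟨k2, h2⟩ := h.b2u hp
  obtain ⟨k3, h3⟩ := h.b3u hp
  have h4 : (d : ℚ) * B v (adaptedVector p f₁ f₂ f₃) =
      x * (24 * p * k1) + y * (24 * p * k2) + z * (6 * p * (1 + 8 * p * k3)) := by
    rw [← h1, ← h2, ← h3, ← smul_eq_mul, ← LinearMap.smul_apply, ← map_smul, he]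
    simp
  obtain ⟨n1, hn1⟩ := h.integral v hv _ h.mem₁
  obtain ⟨n2, hn2⟩ := h.integral v hv _ h.mem₂
  obtain ⟨n3, hn3⟩ := h.integral v hv _ h.mem₃
  have h5 : 2 * p * B v (adaptedVector p f₁ f₂ f₃) = ((2 * n3 + p * n1 + p * n2 : ℤ) : ℚ) := by
    rw [apply_adaptedVector, hn1, hn2, hn3]
    push_cast
    field_simp
  generalize 2 * n3 + p * n1 + p * n2 = n at h5
  have h6 : d * n = 12 * p ^ 2 * (z + 4 * (x * k1 + y * k2 + 2 * p * z * k3)) := by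
    have : ((d * n : ℤ) : ℚ) =
        ((12 * p ^ 2 * (z + 4 * (x * k1 + y * k2 + 2 * p * z * k3)) : ℤ) : ℚ) := by
      push_cast
      rw [← h5]
      linear_combination 2 * p * h4
    exact_mod_cast this
  -- As d is prime to 12p², the divisibility of d n passes to n.
  obtain ⟨m, rfl⟩ : (12 * (p : ℤ) ^ 2) ∣ n := by
    refine (h.coprime_of_dvd ⟨8 * p, by ring⟩).dvd_of_dvd_mul_left (Dvd.intro _ h6.symm)
  refine ⟨m, x * k1 + y * k2 + 2 * p * z * k3, ?_, ?_⟩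
  · push_cast at h5
    apply mul_left_cancel₀ (mul_ne_zero two_ne_zero hp')
    linear_combination h5
  · have h7 : (12 * (p : ℤ) ^ 2) ≠ 0 := by
      have : (p : ℤ) ≠ 0 := by exact_mod_cast hp
      positivity
    apply mul_left_cancel₀ h7
    linear_combination h6

/-- Here the quotient m of `exists_apply_eq` is even, and d m ≡ z mod 4 makes the coefficient of f₃
even. The vector 2 f₃ can then be exchanged for 2p u and multiples of f₁ and f₂. -/
theorem span_congruenceSublattice (h : AdaptedFrame B p M f₁ f₂ f₃ d) (hp : p ≠ 0) {v : V}
    (hv : v ∈ congruenceSublattice B p M (adaptedVector p f₁ f₂ f₃)) :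
    ∃ x y z : ℤ, (d : ℚ) • v = (x : ℚ) • f₁ + (y : ℚ) • f₂ + ((2 * z : ℤ) : ℚ) • f₃ := by
  have hp' : (p : ℚ) ≠ 0 := by exact_mod_cast hp
  obtain ⟨hv, k, hk⟩ := hv
  obtain ⟨x, y, z, he⟩ := h.span v hv
  obtain ⟨m, l, hm, hl⟩ := h.exists_apply_eq hp hv he
  have hmk : m = 2 * k := by
    have : ((m : ℤ) : ℚ) = ((2 * k : ℤ) : ℚ) := by
      apply mul_left_cancel₀ (mul_ne_zero (show (6 : ℚ) ≠ 0 by norm_num) hp')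
      rw [← hm, hk]
      push_cast
      ring
    exact_mod_cast this
  refine ⟨x, y, d * k - 2 * l, ?_⟩
  rw [he]
  congr 3
  rw [hmk] at hl
  linarith

/-- The lattice generated by the congruence sublattice and the adapted vector. -/
def enlargement (B : LinearMap.BilinForm ℚ V) (p : ℕ) (M : Submodule ℤ V) (f₁ f₂ f₃ : V) :
    Submodule ℤ V :=
  congruenceSublattice B p M (adaptedVector p f₁ f₂ f₃) ⊔
    Submodule.span ℤ {adaptedVector p f₁ f₂ f₃}

theorem mem_enlargement {v : V} : v ∈ enlargement B p M f₁ f₂ f₃ ↔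
    ∃ m ∈ congruenceSublattice B p M (adaptedVector p f₁ f₂ f₃), ∃ k : ℤ,
      v = m + (k : ℚ) • adaptedVector p f₁ f₂ f₃ := by
  unfold enlargement
  rw [Submodule.mem_sup]
  constructor
  · rintro ⟨m, hm, w, hw, rfl⟩
    obtain ⟨k, rfl⟩ := Submodule.mem_span_singleton.1 hw
    exact ⟨m, hm, k, by rw [Int.cast_smul_eq_zsmul]⟩
  · rintro ⟨m, hm, k, rfl⟩
    exact ⟨m, hm, _, Submodule.mem_span_singleton.2 ⟨k, rfl⟩, by rw [Int.cast_smul_eq_zsmul]⟩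

theorem span_enlargement (h : AdaptedFrame B p M f₁ f₂ f₃ d) (hp : p ≠ 0) {v : V}
    (hv : v ∈ enlargement B p M f₁ f₂ f₃) :
    ∃ x y z : ℤ, (d : ℚ) • v = (x : ℚ) • f₁ + (y : ℚ) • f₂ +
      (z : ℚ) • adaptedVector p f₁ f₂ f₃ := by
  obtain ⟨m, hm, k, rfl⟩ := mem_enlargement.1 hv
  obtain ⟨x, y, z, he⟩ := h.span_congruenceSublattice hp hm
  refine ⟨x - z * p, y - z * p, 2 * p * z + d * k, ?_⟩
  have hu := two_mul_smul_adaptedVector (f₁ := f₁) (f₂ := f₂) (f₃ := f₃) hp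
  rw [smul_add, he]
  push_cast at hu ⊢
  linear_combination (norm := module) -(z : ℚ) • hu

/-- At the primes dividing 6p the vectors f₁, f₂, u form a basis of the enlargement with Gram matrix
≡ diag(2, 2, 6). The integer d, prime to 6p, accounts for the other primes. -/
theorem exists_apply_enlargement (h : AdaptedFrame B p M f₁ f₂ f₃ d) (hp : p ≠ 0) {v w : V}
    (hv : v ∈ enlargement B p M f₁ f₂ f₃) (hw : w ∈ enlargement B p M f₁ f₂ f₃)
    {x y z x' y' z' : ℤ}
    (hve : (d : ℚ) • v = (x : ℚ) • f₁ + (y : ℚ) • f₂ + (z : ℚ) • adaptedVector p f₁ f₂ f₃)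
    (hwe : (d : ℚ) • w = (x' : ℚ) • f₁ + (y' : ℚ) • f₂ + (z' : ℚ) • adaptedVector p f₁ f₂ f₃) :
    ∃ n k : ℤ, B v w = 2 * n ∧ d * (d * n) = x * x' + y * y' + 3 * (z * z') + 12 * p * k := by
  obtain ⟨k11, h11⟩ := h.b11
  obtain ⟨k22, h22⟩ := h.b22
  obtain ⟨k12, h12⟩ := h.b12
  obtain ⟨k1, h1⟩ := h.b1u hp
  obtain ⟨k2, h2⟩ := h.b2u hp
  obtain ⟨k3, h3⟩ := h.buu hp
  obtain ⟨n, hn⟩ : ∃ n : ℤ, B v w = n := by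
    obtain ⟨m, ⟨hm, j, hj⟩, k, rfl⟩ := mem_enlargement.1 hv
    obtain ⟨m', ⟨hm', j', hj'⟩, k', rfl⟩ := mem_enlargement.1 hw
    obtain ⟨i, hi⟩ := h.integral m hm m' hm'
    refine ⟨i + k' * (12 * p * j) + k * (12 * p * j') + k * k' * (6 + 24 * p * k3), ?_⟩
    simp only [map_add, map_smul, LinearMap.add_apply, LinearMap.smul_apply, smul_eq_mul]
    rw [h.symm (adaptedVector p f₁ f₂ f₃) m', hj, hj', hi, h3]
    push_cast
    ring
  have hd : (d : ℚ) * (d * B v w) = 2 * (x * x' + y * y' + 3 * (z * z') + 12 * p *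
      (4 * p ^ 2 * (x * x' * k11 + y * y' * k22 + (x * y' + y * x') * k12) +
      (x * z' + z * x') * k1 + (y * z' + z * y') * k2 + z * z' * k3)) := by
    have : (d : ℚ) * (d * B v w) = B ((d : ℚ) • v) ((d : ℚ) • w) := by simp
    rw [this, hve, hwe]
    simp only [map_add, map_smul, LinearMap.add_apply, LinearMap.smul_apply, smul_eq_mul]
    rw [h.symm (adaptedVector p f₁ f₂ f₃) f₁, h.symm (adaptedVector p f₁ f₂ f₃) f₂, h.symm f₂ f₁,
      h11, h22, h12, h1, h2, h3]
    ring
  rw [hn] at hd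
  have hd' : d * (d * n) = 2 * (x * x' + y * y' + 3 * (z * z') + 12 * p *
      (4 * p ^ 2 * (x * x' * k11 + y * y' * k22 + (x * y' + y * x') * k12) +
      (x * z' + z * x') * k1 + (y * z' + z * y') * k2 + z * z' * k3)) := by
    exact_mod_cast hd
  have h2d : IsCoprime (2 : ℤ) d := h.coprime_of_dvd ⟨48 * p ^ 3, by ring⟩
  obtain ⟨n', rfl⟩ : (2 : ℤ) ∣ n :=
    h2d.dvd_of_dvd_mul_left (h2d.dvd_of_dvd_mul_left (Dvd.intro _ hd'.symm))
  refine ⟨n', 4 * p ^ 2 * (x * x' * k11 + y * y' * k22 + (x * y' + y * x') * k12) +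
      (x * z' + z * x') * k1 + (y * z' + z * y') * k2 + z * z' * k3, by rw [hn]; push_cast; rfl, ?_⟩
  linarith

/-- The form x² + y² is anisotropic modulo 3, so a norm divisible by 3 forces x ≡ y ≡ 0. This
supplies the hypothesis `h3` of `exists_orthogonal_of_gramDet_eq_three`. -/
theorem three_dvd_apply_enlargement (h : AdaptedFrame B p M f₁ f₂ f₃ d) (hp : p ≠ 0) {v w : V}
    (hv : v ∈ enlargement B p M f₁ f₂ f₃) (hw : w ∈ enlargement B p M f₁ f₂ f₃)
    (hvv : ∃ n : ℤ, B v v = 6 * n) : ∃ n : ℤ, B v w = 6 * n := by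
  obtain ⟨x, y, z, he⟩ := h.span_enlargement hp hv
  obtain ⟨x', y', z', he'⟩ := h.span_enlargement hp hw
  obtain ⟨n, k, hn, hk⟩ := h.exists_apply_enlargement hp hv hv he he
  obtain ⟨n', k', hn', hk'⟩ := h.exists_apply_enlargement hp hv hw he he'
  obtain ⟨m, hm⟩ := hvv
  have hnm : n = 3 * m := by
    have : ((n : ℤ) : ℚ) = ((3 * m : ℤ) : ℚ) := by push_cast; linarith
    exact_mod_cast this
  have h3d : IsCoprime (3 : ℤ) d := h.coprime_of_dvd ⟨32 * p ^ 3, by ring⟩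
  have hxy : 3 ∣ x * x + y * y := ⟨d * (d * m) - z * z - 4 * p * k, by
    rw [hnm] at hk
    linarith⟩
  have hx : ∀ t : ℤ, t * t % 3 = 0 ∧ t % 3 = 0 ∨ t * t % 3 = 1 := by
    intro t
    have : t % 3 = 0 ∨ t % 3 = 1 ∨ t % 3 = 2 := by omega
    rcases this with h | h | h <;> simp [Int.mul_emod, h]
  have hx3 : x % 3 = 0 ∧ y % 3 = 0 := by
    rcases hx x with h1 | h1 <;> rcases hx y with h2 | h2 <;> omega
  obtain ⟨a, rfl⟩ : 3 ∣ x := Int.dvd_of_emod_eq_zero hx3.1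
  obtain ⟨b, rfl⟩ : 3 ∣ y := Int.dvd_of_emod_eq_zero hx3.2
  have h4 : 3 ∣ d * (d * n') := ⟨a * x' + b * y' + z * z' + 4 * p * k', by rw [hk']; ring⟩
  obtain ⟨j, rfl⟩ : 3 ∣ n' := h3d.dvd_of_dvd_mul_left (h3d.dvd_of_dvd_mul_left h4)
  exact ⟨j, by rw [hn']; push_cast; ring⟩

end AdaptedFrame

end QuadraticSpace

/-! ### Index and lattice properties of the enlargement. -/

namespace QuadraticSpace

variable {V : Type*} [AddCommGroup V] [Module ℚ V]

namespace AdaptedFrame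

variable {B : LinearMap.BilinForm ℚ V} {p : ℕ} {M : Submodule ℤ V} {f₁ f₂ f₃ : V} {d : ℤ}

theorem mem₁_congruenceSublattice (h : AdaptedFrame B p M f₁ f₂ f₃ d) (hp : p ≠ 0) :
    f₁ ∈ congruenceSublattice B p M (adaptedVector p f₁ f₂ f₃) := by
  obtain ⟨k, hk⟩ := h.b1u hp
  exact ⟨h.mem₁, 2 * k, by rw [hk]; push_cast; ring⟩

theorem mem₂_congruenceSublattice (h : AdaptedFrame B p M f₁ f₂ f₃ d) (hp : p ≠ 0) :
    f₂ ∈ congruenceSublattice B p M (adaptedVector p f₁ f₂ f₃) := by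
  obtain ⟨k, hk⟩ := h.b2u hp
  exact ⟨h.mem₂, 2 * k, by rw [hk]; push_cast; ring⟩

theorem mem₁_enlargement (h : AdaptedFrame B p M f₁ f₂ f₃ d) (hp : p ≠ 0) :
    f₁ ∈ enlargement B p M f₁ f₂ f₃ :=
  Submodule.mem_sup_left (h.mem₁_congruenceSublattice hp)

theorem mem₂_enlargement (h : AdaptedFrame B p M f₁ f₂ f₃ d) (hp : p ≠ 0) :
    f₂ ∈ enlargement B p M f₁ f₂ f₃ :=
  Submodule.mem_sup_left (h.mem₂_congruenceSublattice hp)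

theorem adaptedVector_mem_enlargement :
    adaptedVector p f₁ f₂ f₃ ∈ enlargement B p M f₁ f₂ f₃ :=
  Submodule.mem_sup_right (Submodule.mem_span_singleton_self _)

theorem two_mul_smul_mem (h : AdaptedFrame B p M f₁ f₂ f₃ d) (hp : p ≠ 0) (k : ℤ) :
    ((2 * p * k : ℤ) : ℚ) • adaptedVector p f₁ f₂ f₃ ∈
      congruenceSublattice B p M (adaptedVector p f₁ f₂ f₃) := by
  obtain ⟨j, hj⟩ := h.buu hp
  refine ⟨?_, k * (1 + 4 * p * j), ?_⟩
  · have h1 : ((2 * p * k : ℤ) : ℚ) • adaptedVector p f₁ f₂ f₃ =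
        k • ((2 : ℤ) • f₃ + (p : ℤ) • f₁ + (p : ℤ) • f₂) := by
      have h2 := two_mul_smul_adaptedVector (f₁ := f₁) (f₂ := f₂) (f₃ := f₃) hp
      simp only [← Int.cast_smul_eq_zsmul ℚ]
      push_cast at h2 ⊢
      rw [← h2]
      module
    rw [h1]
    exact M.smul_mem _ (add_mem (add_mem (M.smul_mem _ h.mem₃) (M.smul_mem _ h.mem₁))
      (M.smul_mem _ h.mem₂))
  · rw [map_smul, LinearMap.smul_apply, hj, smul_eq_mul]
    push_cast
    ring

theorem exists_apply_adaptedVector (h : AdaptedFrame B p M f₁ f₂ f₃ d) (hp : p ≠ 0) {v : V}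
    (hv : v ∈ M) : ∃ m : ℤ, B v (adaptedVector p f₁ f₂ f₃) = 6 * p * m := by
  obtain ⟨x, y, z, he⟩ := h.span v hv
  obtain ⟨m, k, hm, -⟩ := h.exists_apply_eq hp hv he
  exact ⟨m, hm⟩

/-- The congruence sublattice as a sublattice of the enlargement. -/
theorem mem_congruenceSublattice_iff (h : AdaptedFrame B p M f₁ f₂ f₃ d) (hp : p.Prime)
    (hp3 : 3 < p) {v : V} :
    v ∈ congruenceSublattice B p M (adaptedVector p f₁ f₂ f₃) ↔
      v ∈ enlargement B p M f₁ f₂ f₃ ∧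
        ∃ k : ℤ, B v (adaptedVector p f₁ f₂ f₃) = 2 * ((2 * p) * k) := by
  have hp0 := hp.ne_zero
  constructor
  · intro hv
    refine ⟨Submodule.mem_sup_left hv, ?_⟩
    obtain ⟨-, k, hk⟩ := hv
    exact ⟨3 * k, by rw [hk]; push_cast; ring⟩
  · rintro ⟨hv, k, hk⟩
    obtain ⟨m, hm, j, rfl⟩ := mem_enlargement.1 hv
    obtain ⟨-, i, hi⟩ := id hm
    obtain ⟨l, hl⟩ := h.buu hp0
    rw [map_add, map_smul, LinearMap.add_apply, LinearMap.smul_apply, hi, hl, smul_eq_mul] at hk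
    have h1 : 3 * j = 2 * p * (k - 3 * i - 6 * l * j) := by
      have : ((3 * j : ℤ) : ℚ) = ((2 * p * (k - 3 * i - 6 * l * j) : ℤ) : ℚ) := by
        push_cast
        linarith
      exact_mod_cast this
    -- The product of u with itself is 6 modulo 24p, so the coefficient j of u satisfies 2p ∣ 3j. As
    -- 2p is prime to 3, j is a multiple of 2p, and 2p u already lies in the sublattice.
    have hcop : IsCoprime (2 * p : ℤ) 3 := by
      have h : Nat.Coprime (2 * p) 3 := by
        apply Nat.Coprime.mul_left (by norm_num)
        exact (Nat.coprime_primes hp Nat.prime_three).2 (by omega)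
      exact_mod_cast Nat.isCoprime_iff_coprime.2 h
    obtain ⟨j, rfl⟩ := hcop.dvd_of_dvd_mul_left (Dvd.intro _ h1.symm)
    exact add_mem hm (h.two_mul_smul_mem hp0 j)

/-- The functional B(u, ·) / 6p is integral on M and odd at f₃. The sublattice is where it is even.
-/
theorem relIndex_self (h : AdaptedFrame B p M f₁ f₂ f₃ d) (hp : p ≠ 0) :
    (congruenceSublattice B p M (adaptedVector p f₁ f₂ f₃)).toAddSubgroup.relIndex
      M.toAddSubgroup = 2 := by
  have hp' : (p : ℚ) ≠ 0 := by exact_mod_cast hp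
  refine relIndex_eq_of_linearMap
    ((1 / (6 * p) : ℚ) • B (adaptedVector p f₁ f₂ f₃)) ?_ ?_ ?_
  · intro v hv
    obtain ⟨m, hm⟩ := h.exists_apply_adaptedVector hp hv
    refine ⟨m, ?_⟩
    rw [LinearMap.smul_apply, h.symm (adaptedVector p f₁ f₂ f₃), hm, smul_eq_mul]
    field_simp
  · intro v
    rw [mem_congruenceSublattice]
    refine and_congr_right fun _ => exists_congr fun k => ?_
    rw [LinearMap.smul_apply, h.symm (adaptedVector p f₁ f₂ f₃), smul_eq_mul]
    push_cast
    rw [one_div_mul_eq_div, div_eq_iff (by positivity)]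
    constructor <;> intro h <;> linarith
  · obtain ⟨k, hk⟩ := h.b3u hp
    refine ⟨f₃, h.mem₃, 1 + 8 * p * k, ?_, ?_⟩
    · rw [LinearMap.smul_apply, h.symm (adaptedVector p f₁ f₂ f₃), hk, smul_eq_mul]
      push_cast
      field_simp
    · exact ⟨1, -(4 * p * k), by push_cast; ring⟩

/-- The functional B(u, ·) / 2 is integral on the enlargement, and its value 3 + 12pk at u is prime
to 2p. The sublattice is its kernel modulo 2p. -/
theorem relIndex_enlargement (h : AdaptedFrame B p M f₁ f₂ f₃ d) (hp : p.Prime) (hp3 : 3 < p) :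
    (congruenceSublattice B p M (adaptedVector p f₁ f₂ f₃)).toAddSubgroup.relIndex
      (enlargement B p M f₁ f₂ f₃).toAddSubgroup = 2 * p := by
  have hp0 := hp.ne_zero
  refine relIndex_eq_of_linearMap ((1 / 2 : ℚ) • B (adaptedVector p f₁ f₂ f₃)) ?_ ?_ ?_
  · intro v hv
    obtain ⟨x, y, z, he⟩ := h.span_enlargement hp0 hv
    obtain ⟨x', y', z', he'⟩ := h.span_enlargement hp0 (adaptedVector_mem_enlargement
      (B := B) (p := p) (M := M) (f₁ := f₁) (f₂ := f₂) (f₃ := f₃))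
    obtain ⟨n, k, hn, -⟩ := h.exists_apply_enlargement hp0 hv adaptedVector_mem_enlargement he he'
    refine ⟨n, ?_⟩
    rw [LinearMap.smul_apply, h.symm (adaptedVector p f₁ f₂ f₃), hn, smul_eq_mul]
    ring
  · intro v
    rw [h.mem_congruenceSublattice_iff hp hp3]
    refine and_congr_right fun _ => exists_congr fun k => ?_
    rw [LinearMap.smul_apply, h.symm (adaptedVector p f₁ f₂ f₃), smul_eq_mul]
    push_cast
    constructor <;> intro h <;> linarith
  · obtain ⟨k, hk⟩ := h.buu hp0
    refine ⟨_, adaptedVector_mem_enlargement, 3 + 12 * p * k, ?_, ?_⟩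
    · rw [LinearMap.smul_apply, h.symm (adaptedVector p f₁ f₂ f₃), hk, smul_eq_mul]
      push_cast
      ring
    · have hcop : IsCoprime (3 : ℤ) (2 * p : ℤ) := by
        have h : Nat.Coprime 3 (2 * p) := by
          apply Nat.Coprime.mul_right (by norm_num)
          exact (Nat.coprime_primes Nat.prime_three hp).2 (by omega)
        exact_mod_cast Nat.isCoprime_iff_coprime.2 h
      have : (3 + 12 * p * k : ℤ) = 3 + (2 * p) * (6 * k) := by ring
      push_cast
      rw [this]
      exact IsCoprime.add_mul_left_left hcop _

theorem isLattice_congruenceSublattice (h : AdaptedFrame B p M f₁ f₂ f₃ d) (hp : p ≠ 0)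
    (hM : M.IsLattice ℚ) :
    (congruenceSublattice B p M (adaptedVector p f₁ f₂ f₃)).IsLattice ℚ where
  fg := by
    have hle : congruenceSublattice B p M (adaptedVector p f₁ f₂ f₃) ≤ M := fun v hv => hv.1
    have : IsNoetherian ℤ (congruenceSublattice B p M (adaptedVector p f₁ f₂ f₃)) :=
      isNoetherian_of_le hle
    rw [← Module.Finite.iff_fg]
    infer_instance
  span_eq_top := by
    rw [eq_top_iff, ← hM.span_eq_top, Submodule.span_le]
    intro v hv
    obtain ⟨m, hm⟩ := h.exists_apply_adaptedVector hp hv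
    have h2 : (2 : ℤ) • v ∈ congruenceSublattice B p M (adaptedVector p f₁ f₂ f₃) := by
      refine ⟨M.smul_mem _ hv, m, ?_⟩
      rw [← Int.cast_smul_eq_zsmul ℚ, map_smul, LinearMap.smul_apply, hm, smul_eq_mul]
      push_cast
      ring
    have h3 : v = (1 / 2 : ℚ) • ((2 : ℤ) • v) := by
      rw [← Int.cast_smul_eq_zsmul ℚ, smul_smul]
      norm_num
    rw [h3]
    exact Submodule.smul_mem _ _ (Submodule.subset_span h2)

theorem isLattice_enlargement (h : AdaptedFrame B p M f₁ f₂ f₃ d) (hp : p ≠ 0)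
    (hM : M.IsLattice ℚ) : (enlargement B p M f₁ f₂ f₃).IsLattice ℚ := by
  have h0 := h.isLattice_congruenceSublattice hp hM
  exact Submodule.IsLattice.of_le_of_isLattice_of_fg ℚ le_sup_left
    (h0.fg.sup (Submodule.fg_span_singleton _))

end AdaptedFrame

theorem exists_basis_of_isLattice {n : ℕ} {L M : Submodule ℤ V} (hL : L.IsLattice ℚ)
    (hM : M.IsLattice ℚ) (b : Module.Basis (Fin n) ℤ L) : Nonempty (Module.Basis (Fin n) ℤ M) := by
  have h1 : Module.finrank ℤ M = n := by
    rw [Module.finrank, Submodule.IsLattice.rank' ℚ M, ← Submodule.IsLattice.rank' ℚ L,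
      ← Module.finrank, Module.finrank_eq_card_basis b, Fintype.card_fin]
  exact ⟨(Module.finBasis ℤ M).reindex (finCongr h1)⟩

theorem gramDet_eq_det_gram (Q : QuadraticForm ℚ V) (v : Fin 3 → V) :
    gramDet ((1 / 2 : ℚ) • QuadraticMap.associated (R := ℚ) Q) (v 0) (v 1) (v 2) =
      (gram Q v).det / 8 := by
  rw [Matrix.det_fin_three, gramDet]
  have hs : ∀ x y, QuadraticMap.associated (R := ℚ) Q x y =
      QuadraticMap.associated (R := ℚ) Q y x := fun x y => by
    simp only [QuadraticMap.associated_apply, add_comm x y]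
    rw [sub_right_comm]
  simp only [gram, Matrix.of_apply, LinearMap.smul_apply, smul_eq_mul]
  rw [hs (v 1) (v 0), hs (v 2) (v 0), hs (v 2) (v 1)]
  ring

end QuadraticSpace

/-! ### Recovering a model lattice from its enlargement. -/

namespace QuadraticSpace

variable {V : Type*} [AddCommGroup V] [Module ℚ V]
variable {Q : QuadraticForm ℚ V} {c : V ≃ₗ[ℚ] ℚ × ℚ × ℚ}

/-- Modulo 4 the hypothesis reads x² + y² + 1 ≡ z², and x² + y² is never 3. -/
theorem Int.odd_even_of_sum_sq {x y z k : ℤ} (h : x * x + y * y + 3 * (z * z) = 3 + 4 * k) :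
    x % 2 = 0 ∧ y % 2 = 0 ∧ z % 2 = 1 := by
  have hx : ∀ t : ℤ, t * t % 4 = 0 ∧ t % 2 = 0 ∨ t * t % 4 = 1 ∧ t % 2 = 1 := by
    intro t
    have : t % 4 = 0 ∨ t % 4 = 1 ∨ t % 4 = 2 ∨ t % 4 = 3 := by omega
    rcases this with h | h | h | h <;> simp [Int.mul_emod, h] <;> omega
  rcases hx x with h1 | h1 <;> rcases hx y with h2 | h2 <;> rcases hx z with h3 | h3 <;> omega

/-- An orthonormal pair in 𝔽₂² consists of the two unit vectors, whose sum is (1, 1). -/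
theorem Int.odd_of_orthonormal_mod_two {a b a' b' : ℤ} (h : (a * a + b * b) % 2 = 1)
    (h' : (a' * a' + b' * b') % 2 = 1) (h0 : (a * a' + b * b') % 2 = 0) :
    (a + a') % 2 = 1 ∧ (b + b') % 2 = 1 := by
  have hx : ∀ t : ℤ, t % 2 = 0 ∨ t % 2 = 1 := fun t => by omega
  rcases hx a with h1 | h1 <;> rcases hx b with h2 | h2 <;> rcases hx a' with h3 | h3 <;>
    rcases hx b' with h4 | h4 <;>
    simp [Int.add_emod, Int.mul_emod, h1, h2, h3, h4] at h h' h0 ⊢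

/-- Odd squares are 1 modulo 8, so 12k² ≡ 4 mod 8. -/
theorem Int.odd_of_sum_sq_mod_eight {x y k t : ℤ} (hx : x % 2 = 1) (hy : y % 2 = 1)
    (h : x * x + y * y + 12 * (k * k) = 6 + 8 * t) : k % 2 = 1 := by
  obtain ⟨x, rfl⟩ : ∃ x', x = 2 * x' + 1 := ⟨x / 2, by omega⟩
  obtain ⟨y, rfl⟩ : ∃ y', y = 2 * y' + 1 := ⟨y / 2, by omega⟩
  by_contra hk
  obtain ⟨k, rfl⟩ : ∃ k', k = 2 * k' := ⟨k / 2, by omega⟩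
  obtain ⟨i, hi⟩ := Int.even_mul_succ_self x
  obtain ⟨j, hj⟩ := Int.even_mul_succ_self y
  have : 8 * (i + j + 6 * (k * k)) + 2 = 6 + 8 * t := by
    linear_combination h - 4 * hi - 4 * hj
  omega

/-- Let ⟨v, u⟩ be half the product of v with u. The congruence sublattice consists of the integral v
with 2p ∣ ⟨v, u⟩. Since u has coordinates even, even, odd, divisibility by 2 says that the third
coordinate of v is even, and divisibility by p is orthogonality to s = u mod p. So this is the even
half of the model lattice of s, and f₃ represents the other coset both in M and in the model
lattice. -/
theorem AdaptedFrame.exists_eq_modelLattice (hQ : IsDiagonal Q c) {p : ℕ} [hp : Fact p.Prime]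
    (hp3 : 3 < p) {M : Submodule ℤ V} {f₁ f₂ f₃ : V} {d : ℤ}
    (h : AdaptedFrame (QuadraticMap.associated (R := ℚ) Q) p M f₁ f₂ f₃ d)
    (hI : enlargement (QuadraticMap.associated (R := ℚ) Q) p M f₁ f₂ f₃ = standardLattice c) :
    ∃ s ∈ quadricPoints (ZMod p), M = modelLattice c s := by
  have hp0 := hp.out.ne_zero
  have hodd : p % 2 = 1 := Nat.odd_iff.1 (hp.out.odd_of_ne_two (by omega))
  have h2 : (2 : ZMod p) ≠ 0 := by
    exact_mod_cast natCast_zmod_ne_zero (n := 2) (by norm_num) (by omega)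
  obtain ⟨u0, u1, u2, hu⟩ : adaptedVector p f₁ f₂ f₃ ∈ standardLattice c :=
    hI ▸ adaptedVector_mem_enlargement
  obtain ⟨a1, b1, e1, hf1⟩ : f₁ ∈ standardLattice c := hI ▸ h.mem₁_enlargement hp0
  obtain ⟨a2, b2, e2, hf2⟩ : f₂ ∈ standardLattice c := hI ▸ h.mem₂_enlargement hp0
  have hBu : ∀ {v : V} {x y z : ℤ}, c v = ((x : ℚ), (y : ℚ), (z : ℚ)) →
      QuadraticMap.associated (R := ℚ) Q v (adaptedVector p f₁ f₂ f₃) =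
        2 * ((x * u0 + y * u1 + 3 * (z * u2) : ℤ) : ℚ) := by
    intro v x y z hv
    rw [hQ.associated_eq, hv, hu]
    push_cast
    ring
  have hM0 : ∀ {v : V} {x y z : ℤ}, c v = ((x : ℚ), (y : ℚ), (z : ℚ)) →
      (v ∈ congruenceSublattice (QuadraticMap.associated (R := ℚ) Q) p M (adaptedVector p f₁ f₂ f₃) ↔
        2 * (p : ℤ) ∣ x * u0 + y * u1 + 3 * (z * u2)) := by
    intro v x y z hv
    rw [h.mem_congruenceSublattice_iff hp.out hp3, hI, hBu hv]
    constructor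
    · rintro ⟨-, k, hk⟩
      refine ⟨k, ?_⟩
      have : ((x * u0 + y * u1 + 3 * (z * u2) : ℤ) : ℚ) = ((2 * p * k : ℤ) : ℚ) := by
        push_cast at hk ⊢
        linarith
      exact_mod_cast this
    · rintro ⟨k, hk⟩
      refine ⟨⟨x, y, z, hv⟩, k, ?_⟩
      rw [hk]
      push_cast
      ring
  -- The adapted vector.
  obtain ⟨ku, hku⟩ := h.buu hp0
  have huu : u0 * u0 + u1 * u1 + 3 * (u2 * u2) = 3 + 12 * p * ku := by
    rw [hBu hu] at hku
    have : ((u0 * u0 + u1 * u1 + 3 * (u2 * u2) : ℤ) : ℚ) = ((3 + 12 * p * ku : ℤ) : ℚ) := by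
      push_cast at hku ⊢
      linarith
    exact_mod_cast this
  obtain ⟨hu0, hu1, hu2⟩ := Int.odd_even_of_sum_sq (k := 3 * p * ku) (by rw [huu]; ring)
  obtain ⟨v0, hv0⟩ : ∃ v0, u0 = 2 * v0 := ⟨u0 / 2, by omega⟩
  obtain ⟨v1, hv1⟩ : ∃ v1, u1 = 2 * v1 := ⟨u1 / 2, by omega⟩
  obtain ⟨v2, hv2⟩ : ∃ v2, u2 = 2 * v2 + 1 := ⟨u2 / 2, by omega⟩
  have heven : ∀ {x y z : ℤ}, 2 * (p : ℤ) ∣ x * u0 + y * u1 + 3 * (z * u2) → 2 ∣ z := by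
    rintro x y z ⟨k, hk⟩
    have : z = 2 * (p * k - x * v0 - y * v1 - 3 * z * v2 - z) := by
      rw [hv0, hv1, hv2] at hk
      linear_combination hk
    exact ⟨_, this⟩
  let s : ZMod p × ZMod p × ZMod p := ((u0 : ZMod p), (u1 : ZMod p), (u2 : ZMod p))
  have hs : s ∈ quadricPoints (ZMod p) := by
    have h3 := congrArg (Int.cast : ℤ → ZMod p) huu
    push_cast at h3
    simp only [ZMod.natCast_self, mul_zero, zero_mul, add_zero] at h3
    unfold quadricPoints
    simp only [Set.mem_ofPred_eq, s]
    linear_combination h3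
  refine ⟨s, hs, ?_⟩
  have hsub : ∀ v ∈ congruenceSublattice (QuadraticMap.associated (R := ℚ) Q) p M
      (adaptedVector p f₁ f₂ f₃), v ∈ modelLattice c s := by
    intro v hv
    obtain ⟨x, y, z, hc⟩ : v ∈ standardLattice c := hI ▸ Submodule.mem_sup_left hv
    have hd := (hM0 hc).1 hv
    obtain ⟨k, rfl⟩ := heven hd
    refine ⟨2 * x, 2 * y, 2 * k, by rw [hc]; simp, by omega, by omega, ?_⟩
    obtain ⟨j, hj⟩ := hd
    have h3 := congrArg (Int.cast : ℤ → ZMod p) hj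
    push_cast at h3 ⊢
    simp only [ZMod.natCast_self, mul_zero, zero_mul] at h3
    simp only [s]
    linear_combination 2 * h3
  have hsup : ∀ {v : V} {a b k : ℤ}, c v = ((a : ℚ) / 2, (b : ℚ) / 2, (k : ℚ)) → 2 ∣ a - k →
      2 ∣ b - k → (a : ZMod p) * s.1 + b * s.2.1 + 6 * k * s.2.2 = 0 → 2 ∣ k → v ∈ M := by
    rintro v a b k hc ha hb h0 ⟨k, rfl⟩
    obtain ⟨a, rfl⟩ : ∃ a', a = 2 * a' := ⟨a / 2, by omega⟩
    obtain ⟨b, rfl⟩ : ∃ b', b = 2 * b' := ⟨b / 2, by omega⟩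
    have hc' : c v = ((a : ℚ), (b : ℚ), ((2 * k : ℤ) : ℚ)) := by
      rw [hc]
      simp
    refine ((hM0 hc').2 (two_mul_dvd_of_dvd hodd ?_ ?_)).1
    · rw [hv0, hv1]
      exact ⟨a * v0 + b * v1 + 3 * (k * u2), by ring⟩
    · apply mul_left_cancel₀ h2
      push_cast at h0 ⊢
      simp only [s] at h0
      linear_combination h0
  -- The third vector of the frame.
  obtain ⟨e1', rfl⟩ := heven ((hM0 hf1).1 (h.mem₁_congruenceSublattice hp0))
  obtain ⟨e2', rfl⟩ := heven ((hM0 hf2).1 (h.mem₂_congruenceSublattice hp0))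
  obtain ⟨x, hx⟩ : ∃ x, x = 2 * p * u0 - p * (a1 + a2) := ⟨_, rfl⟩
  obtain ⟨y, hy⟩ : ∃ y, y = 2 * p * u1 - p * (b1 + b2) := ⟨_, rfl⟩
  obtain ⟨k, hk⟩ : ∃ k, k = p * u2 - p * (e1' + e2') := ⟨_, rfl⟩
  have hf3 : c f₃ = ((x : ℚ) / 2, (y : ℚ) / 2, (k : ℚ)) := by
    have h3 : f₃ = (p : ℚ) • adaptedVector p f₁ f₂ f₃ - ((p : ℚ) / 2) • f₁ - ((p : ℚ) / 2) • f₂ := by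
      have h4 := two_mul_smul_adaptedVector (f₁ := f₁) (f₂ := f₂) (f₃ := f₃) hp0
      push_cast at h4
      linear_combination (norm := module) (-1 / 2 : ℚ) • h4
    rw [h3, map_sub, map_sub, map_smul, map_smul, map_smul, hu, hf1, hf2, hx, hy, hk]
    ext <;> simp <;> ring
  obtain ⟨t1, ht1⟩ := h.b11
  obtain ⟨t2, ht2⟩ := h.b22
  obtain ⟨t12, ht12⟩ := h.b12
  obtain ⟨t3, ht3⟩ := h.b33
  rw [hQ.associated_eq, hf1] at ht1
  rw [hQ.associated_eq, hf2] at ht2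
  rw [hQ.associated_eq, hf1, hf2] at ht12
  rw [hQ.associated_eq, hf3] at ht3
  have hn1 : a1 * a1 + b1 * b1 = 1 + 2 * (24 * p ^ 3 * t1 - 6 * (e1' * e1')) := by
    have : ((a1 * a1 + b1 * b1 : ℤ) : ℚ) =
        ((1 + 2 * (24 * p ^ 3 * t1 - 6 * (e1' * e1')) : ℤ) : ℚ) := by
      push_cast at ht1 ⊢
      linarith
    exact_mod_cast this
  have hn2 : a2 * a2 + b2 * b2 = 1 + 2 * (24 * p ^ 3 * t2 - 6 * (e2' * e2')) := by
    have : ((a2 * a2 + b2 * b2 : ℤ) : ℚ) =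
        ((1 + 2 * (24 * p ^ 3 * t2 - 6 * (e2' * e2')) : ℤ) : ℚ) := by
      push_cast at ht2 ⊢
      linarith
    exact_mod_cast this
  have hn12 : a1 * a2 + b1 * b2 = 2 * (24 * p ^ 3 * t12 - 6 * (e1' * e2')) := by
    have : ((a1 * a2 + b1 * b2 : ℤ) : ℚ) = ((2 * (24 * p ^ 3 * t12 - 6 * (e1' * e2')) : ℤ) : ℚ) := by
      push_cast at ht12 ⊢
      linarith
    exact_mod_cast this
  have hn3 : x * x + y * y + 12 * (k * k) = 14 * p ^ 2 + 8 * (24 * p ^ 3 * t3) := by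
    have : ((x * x + y * y + 12 * (k * k) : ℤ) : ℚ) =
        ((14 * p ^ 2 + 8 * (24 * p ^ 3 * t3) : ℤ) : ℚ) := by
      push_cast at ht3 ⊢
      linarith
    exact_mod_cast this
  -- The third coordinates of f₁ and f₂ are even, so their first two coordinates are orthonormal
  -- modulo 2. Hence f₃ = p u − (p/2)(f₁ + f₂) has odd numerators x and y.
  obtain ⟨ho1, ho2⟩ := Int.odd_of_orthonormal_mod_two (a := a1) (b := b1) (a' := a2) (b' := b2)
    (by omega) (by omega) (by omega)
  obtain ⟨p', hp'⟩ : ∃ p' : ℤ, (p : ℤ) = 2 * p' + 1 := ⟨p / 2, by omega⟩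
  have hxodd : x % 2 = 1 := by
    obtain ⟨q, hq⟩ : ∃ q, a1 + a2 = 2 * q + 1 := ⟨(a1 + a2) / 2, by omega⟩
    have : x = 2 * (p * u0 - p * q - p' - 1) + 1 := by
      rw [hx, hq, hp']
      ring
    omega
  have hyodd : y % 2 = 1 := by
    obtain ⟨q, hq⟩ : ∃ q, b1 + b2 = 2 * q + 1 := ⟨(b1 + b2) / 2, by omega⟩
    have : y = 2 * (p * u1 - p * q - p' - 1) + 1 := by
      rw [hy, hq, hp']
      ring
    omega
  have hkodd : k % 2 = 1 := by
    refine Int.odd_of_sum_sq_mod_eight (t := 24 * p ^ 3 * t3 + 1 + 7 * (p' * p' + p')) hxodd hyodd ?_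
    rw [hn3, hp']
    ring
  have hf3m : f₃ ∈ modelLattice c s := by
    refine ⟨x, y, k, hf3, by omega, by omega, ?_⟩
    obtain ⟨k3, hk3⟩ := h.b3u hp0
    rw [hQ.associated_eq, hf3, hu] at hk3
    have h3 : x * u0 + y * u1 + 6 * (k * u2) = p * (6 * (1 + 8 * p * k3)) := by
      have : ((x * u0 + y * u1 + 6 * (k * u2) : ℤ) : ℚ) =
          ((p * (6 * (1 + 8 * p * k3)) : ℤ) : ℚ) := by
        push_cast at hk3 ⊢
        linarith
      exact_mod_cast this
    have h4 := congrArg (Int.cast : ℤ → ZMod p) h3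
    push_cast at h4
    simp only [ZMod.natCast_self, zero_mul] at h4
    simp only [s]
    linear_combination h4
  apply le_antisymm
  · intro v hv
    obtain ⟨m, hm⟩ := h.exists_apply_adaptedVector hp0 hv
    -- The parity of B(v, u) / 6p tells which coset of the congruence sublattice contains v.
    rcases Int.even_or_odd' m with ⟨j, rfl | rfl⟩
    · exact hsub v ⟨hv, j, by rw [hm]; push_cast; ring⟩
    · obtain ⟨k3, hk3⟩ := h.b3u hp0
      have h4 : v - f₃ ∈ modelLattice c s := by
        refine hsub _ ⟨sub_mem hv h.mem₃, j - 4 * p * k3, ?_⟩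
        rw [map_sub, LinearMap.sub_apply, hm, hk3]
        push_cast
        ring
      simpa using add_mem h4 hf3m
  · intro v hv
    obtain ⟨a, b, k', hc, ha, hb, h0⟩ := id hv
    by_cases hk' : 2 ∣ k'
    · exact hsup hc ha hb h0 hk'
    · obtain ⟨a', b', k'', hc', ha', hb', h0'⟩ := sub_mem hv hf3m
      have h5 : k'' = k' - k := by
        rw [map_sub, hc, hf3] at hc'
        have h6 := congrArg (fun w => w.2.2) hc'
        simp only [Prod.snd_sub] at h6
        have : ((k'' : ℤ) : ℚ) = ((k' - k : ℤ) : ℚ) := by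
          push_cast
          linarith
        exact_mod_cast this
      have h7 : v - f₃ ∈ M := hsup hc' ha' hb' h0' (by omega)
      simpa using add_mem h7 h.mem₃

end QuadraticSpace

/-! ### Existence of adapted frames in the genus. -/

namespace QuadraticSpace

variable {V : Type*} [AddCommGroup V] [Module ℚ V]

theorem exists_det_gram_eq_sq_mul {n : ℕ} (Q : QuadraticForm ℚ V) {L M : Submodule ℤ V}
    (hL : L.IsLattice ℚ) (hM : M.IsLattice ℚ) (b : Module.Basis (Fin n) ℤ L)
    (m : Module.Basis (Fin n) ℤ M) :
    ∃ r : ℚ, (gram Q fun i => (m i : V)).det = r ^ 2 * (gram Q fun i => (b i : V)).det := by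
  refine ⟨((b.extendOfIsLattice ℚ).toMatrix (m.extendOfIsLattice ℚ)).det, ?_⟩
  have hm : (fun i => (m i : V)) = fun i => ∑ j,
      ((b.extendOfIsLattice ℚ).toMatrix (m.extendOfIsLattice ℚ)).transpose i j • (b j : V) := by
    funext i
    have := (b.extendOfIsLattice ℚ).sum_toMatrix_smul_self (m.extendOfIsLattice ℚ) i
    simp only [Module.Basis.extendOfIsLattice_apply] at this
    exact this.symm
  rw [hm, gram_sum_smul, Matrix.det_mul, Matrix.det_mul]
  simp only [Matrix.det_transpose]
  ring

/-- The determinants agree up to sign, and their ratio is a rational square because the lattices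
span the same space. -/
theorem det_gram_eq_of_mem_genus {n : ℕ} {Q : QuadraticForm ℚ V} {L M : Submodule ℤ V}
    (hL : L.IsLattice ℚ) (hM : M ∈ genus Q L) (b : Module.Basis (Fin n) ℤ L)
    (m : Module.Basis (Fin n) ℤ M) {A : Matrix (Fin n) (Fin n) ℤ}
    (hA : gram Q (fun i => (b i : V)) = A.map ((↑) : ℤ → ℚ)) :
    (gram Q fun i => (m i : V)).det = A.det := by
  obtain ⟨G, hG, h⟩ := exists_int_gram hL hM b m hA
  obtain ⟨r, hr⟩ := exists_det_gram_eq_sq_mul Q hL hM.1 b m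
  have hdet : ∀ X : Matrix (Fin n) (Fin n) ℤ, (X.map ((↑) : ℤ → ℚ)).det = X.det :=
    fun X => (RingHom.map_det (Int.castRingHom ℚ) X).symm
  rw [hA, hG, hdet, hdet] at hr
  rw [hG, hdet]
  rcases Int.natAbs_eq_natAbs_iff.1 (natAbs_det_eq h) with h1 | h1
  · rw [h1]
  · rw [h1] at hr ⊢
    rw [Int.cast_neg] at hr ⊢
    have h2 : (r ^ 2 + 1) * (A.det : ℚ) = 0 := by linear_combination -hr
    rw [(mul_eq_zero.1 h2).resolve_left (by positivity), neg_zero]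

theorem exists_adaptedFrame {Q : QuadraticForm ℚ V} {L M : Submodule ℤ V}
    (hL : L.IsLattice ℚ) (hM : M ∈ genus Q L) (b : Module.Basis (Fin 3) ℤ L) {p : ℕ}
    (hp : p.Prime) (hp3 : 3 < p)
    (hA : gram Q (fun i => (b i : V)) = (!![2, 0, -(p : ℤ); 0, 2, -(p : ℤ); -(p : ℤ), -(p : ℤ),
      7 * (p : ℤ) ^ 2]).map ((↑) : ℤ → ℚ)) :
    ∃ (f₁ f₂ f₃ : V) (d : ℤ),
      AdaptedFrame (QuadraticMap.associated (R := ℚ) Q) p M f₁ f₂ f₃ d := by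
  obtain ⟨m⟩ := exists_basis_of_isLattice hL hM.1 b
  obtain ⟨G, hG, h⟩ := exists_int_gram hL hM b m hA
  have hcop : ∀ {a b : ℕ}, a.Prime → b.Prime → a ≠ b → ∀ k l, (a ^ k).Coprime (b ^ l) :=
    fun ha hb hab k l => Nat.Coprime.pow k l ((Nat.coprime_primes ha hb).2 hab)
  have : Fact p.Prime := ⟨hp⟩
  -- The modulus is 2⁵ · 3 · p³ = 96p³. The product of u with itself carries a denominator 4p², so
  -- it is still controlled modulo 24p.
  obtain ⟨F, hF, hFG⟩ := ((approxCongruent_prime_pow (h 2) 5).mul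
    (approxCongruent_prime_pow (h 3) 1) (hcop Nat.prime_two Nat.prime_three (by norm_num) _ _)).mul
    (approxCongruent_prime_pow (h p) 3)
    (Nat.Coprime.mul_left (hcop Nat.prime_two hp (by omega) _ _)
      (hcop Nat.prime_three hp (by omega) _ _))
  let f : Fin 3 → V := fun i => ∑ j, (F.map ((↑) : ℤ → ℚ)) i j • (m j : V)
  have hgram : gram Q f = (F * G * F.transpose).map ((↑) : ℤ → ℚ) := by
    simp only [f]
    rw [gram_sum_smul, hG]
    ext i j
    simp [Matrix.mul_apply]
  have hcong : ∀ i j, ∃ k : ℤ, QuadraticMap.associated (R := ℚ) Q (f i) (f j) =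
      (((!![2, 0, -(p : ℤ); 0, 2, -(p : ℤ); -(p : ℤ), -(p : ℤ), 7 * (p : ℤ) ^ 2] :
        Matrix (Fin 3) (Fin 3) ℤ) i j : ℤ) : ℚ) + 96 * p ^ 3 * k := by
    intro i j
    have h1 := congrFun (congrFun hFG i) j
    simp only [Matrix.map_apply] at h1
    obtain ⟨k, hk⟩ := (ZMod.intCast_eq_intCast_iff_dvd_sub _ _ _).1 h1.symm
    refine ⟨k, ?_⟩
    have h2 := congrFun (congrFun hgram i) j
    simp only [gram, Matrix.of_apply, Matrix.map_apply] at h2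
    rw [h2, sub_eq_iff_eq_add.1 hk]
    push_cast
    ring
  have hmem : ∀ i, f i ∈ M := by
    intro i
    refine sum_mem fun j _ => ?_
    rw [Matrix.map_apply, Int.cast_smul_eq_zsmul]
    exact M.smul_mem _ (m j).2
  have hrepr : ∀ v ∈ M, ∃ x : Fin 3 → ℤ, v = ∑ i, (x i : ℚ) • (m i : V) := by
    intro v hv
    refine ⟨fun i => m.repr ⟨v, hv⟩ i, ?_⟩
    have h1 := congrArg (Subtype.val) (m.sum_repr ⟨v, hv⟩)
    simp only [Int.cast_smul_eq_zsmul]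
    rw [AddSubmonoidClass.coe_finsetSum] at h1
    exact h1.symm
  have hGsymm : ∀ x y, QuadraticMap.associated (R := ℚ) Q x y =
      QuadraticMap.associated (R := ℚ) Q y x := fun x y => by
    rw [QuadraticMap.associated_apply, QuadraticMap.associated_apply, add_comm x y, sub_right_comm]
  refine ⟨f 0, f 1, f 2, F.det, hGsymm, ?_, hmem 0, hmem 1, hmem 2, ?_, ?_, ?_, ?_, ?_, ?_, ?_, ?_⟩
  · intro x hx y hy
    obtain ⟨x, rfl⟩ := hrepr x hx
    obtain ⟨y, rfl⟩ := hrepr y hy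
    refine ⟨∑ i, ∑ j, y i * (x j * G j i), ?_⟩
    simp only [map_sum, map_smul, LinearMap.sum_apply, LinearMap.smul_apply, smul_eq_mul,
      Int.cast_sum, Int.cast_mul, Finset.mul_sum]
    refine Finset.sum_congr rfl fun i _ => Finset.sum_congr rfl fun j _ => ?_
    have h2 := congrFun (congrFun hG j) i
    simp only [gram, Matrix.of_apply, Matrix.map_apply] at h2
    rw [h2]
  · convert hF using 1
    push_cast
    ring
  · intro v hv
    obtain ⟨x, rfl⟩ := hrepr v hv
    -- The adjugate of F inverts the change of basis up to the factor det F, which plays the role of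
    -- d.
    have hadj : ∀ j, (F.det : ℚ) • (m j : V) = ∑ i, (F.adjugate j i : ℚ) • f i := by
      intro j
      simp only [f, Finset.smul_sum, smul_smul]
      rw [Finset.sum_comm]
      simp only [← Finset.sum_smul]
      have h1 : ∀ k, ∑ i, (F.adjugate j i : ℚ) * (F.map ((↑) : ℤ → ℚ)) i k =
          if j = k then (F.det : ℚ) else 0 := by
        intro k
        have h2 := congrFun (congrFun F.adjugate_mul j) k
        rw [Matrix.mul_apply, Matrix.smul_apply, Matrix.one_apply] at h2
        have h3 := congrArg ((↑) : ℤ → ℚ) h2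
        push_cast at h3
        simp only [Matrix.map_apply]
        rw [h3]
        split_ifs <;> simp
      simp only [h1]
      simp
    refine ⟨∑ j, x j * F.adjugate j 0, ∑ j, x j * F.adjugate j 1, ∑ j, x j * F.adjugate j 2, ?_⟩
    have h1 : (F.det : ℚ) • ∑ i, (x i : ℚ) • (m i : V) =
        ∑ i, (x i : ℚ) • ((F.det : ℚ) • (m i : V)) := by
      rw [Finset.smul_sum]
      exact Finset.sum_congr rfl fun i _ => smul_comm _ _ _
    rw [h1]
    simp only [hadj, Fin.sum_univ_three]
    push_cast
    module
  all_goals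
    obtain ⟨k, hk⟩ := hcong _ _
    refine ⟨k, hk.trans ?_⟩
    simp

end QuadraticSpace

/-! ### Classification of the genus and the class number. -/

namespace QuadraticSpace

variable {V : Type*} [AddCommGroup V] [Module ℚ V]
variable {Q : QuadraticForm ℚ V} {c : V ≃ₗ[ℚ] ℚ × ℚ × ℚ}

/-- The congruence sublattice has index 2 in M and index 2p in the enlargement, so the latter has
determinant 4 · 24p² / (2p)² = 24, and half the form has determinant 24 / 8 = 3. -/
theorem AdaptedFrame.exists_orthogonal_enlargement (hQ : IsDiagonal Q c) {p : ℕ} (hp : p.Prime)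
    (hp3 : 3 < p) {M : Submodule ℤ V} (hM : M.IsLattice ℚ) (m : Module.Basis (Fin 3) ℤ M)
    (hdet : (gram Q fun i => (m i : V)).det = 24 * p ^ 2) {f₁ f₂ f₃ : V} {d : ℤ}
    (h : AdaptedFrame (QuadraticMap.associated (R := ℚ) Q) p M f₁ f₂ f₃ d) :
    ∃ u v w : V,
      Submodule.span ℤ {u, v, w} = enlargement (QuadraticMap.associated (R := ℚ) Q) p M f₁ f₂ f₃ ∧
      ∀ x y z : ℚ, Q (x • u + y • v + z • w) = 2 * x ^ 2 + 2 * y ^ 2 + 6 * z ^ 2 := by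
  have hp0 := hp.ne_zero
  have hp0' : (p : ℚ) ≠ 0 := by exact_mod_cast hp0
  have hL0 := h.isLattice_congruenceSublattice hp0 hM
  have hI := h.isLattice_enlargement hp0 hM
  obtain ⟨b⟩ := exists_basis_of_isLattice hM hL0 m
  obtain ⟨e⟩ := exists_basis_of_isLattice hM hI m
  have h1 := det_gram_eq_relIndex_sq_mul Q hL0 hM (fun v hv => hv.1) b m
  have h2 := det_gram_eq_relIndex_sq_mul Q hL0 hI le_sup_left b e
  rw [h.relIndex_self hp0, hdet] at h1
  rw [h.relIndex_enlargement hp hp3, h1] at h2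
  have h3 : (gram Q fun i => (e i : V)).det = 24 := by
    apply mul_left_cancel₀ (pow_ne_zero 2 hp0')
    push_cast at h2
    linear_combination -h2 / 4
  have hspan : Submodule.span ℤ {(e 0 : V), (e 1 : V), (e 2 : V)} =
      enlargement (QuadraticMap.associated (R := ℚ) Q) p M f₁ f₂ f₃ := by
    have h4 : ({(e 0 : V), (e 1 : V), (e 2 : V)} : Set V) =
        (enlargement (QuadraticMap.associated (R := ℚ) Q) p M f₁ f₂ f₃).subtype '' Set.range e := by
      ext v
      simp [Fin.exists_fin_succ, eq_comm]
    rw [h4, ← Submodule.map_span, e.span_eq, Submodule.map_top, Submodule.range_subtype]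
  suffices h4 : ∃ u v w : V,
      Submodule.span ℤ {u, v, w} = enlargement (QuadraticMap.associated (R := ℚ) Q) p M f₁ f₂ f₃ ∧
      ((1 / 2 : ℚ) • QuadraticMap.associated (R := ℚ) Q) u u = 1 ∧
      ((1 / 2 : ℚ) • QuadraticMap.associated (R := ℚ) Q) v v = 1 ∧
      ((1 / 2 : ℚ) • QuadraticMap.associated (R := ℚ) Q) w w = 3 ∧
      ((1 / 2 : ℚ) • QuadraticMap.associated (R := ℚ) Q) u v = 0 ∧
      ((1 / 2 : ℚ) • QuadraticMap.associated (R := ℚ) Q) u w = 0 ∧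
      ((1 / 2 : ℚ) • QuadraticMap.associated (R := ℚ) Q) v w = 0 by
    obtain ⟨u, v, w, hs, huu, hvv, hww, huv, huw, hvw⟩ := h4
    refine ⟨u, v, w, hs, fun x y z => ?_⟩
    simp only [LinearMap.smul_apply, smul_eq_mul] at huu hvv hww huv huw hvw
    have hvu := h.symm u v
    have hwu := h.symm u w
    have hwv := h.symm v w
    rw [← QuadraticMap.associated_eq_self_apply ℚ Q]
    simp only [map_add, map_smul, LinearMap.add_apply, LinearMap.smul_apply, smul_eq_mul]
    rw [← hvu, ← hwu, ← hwv]
    linear_combination 2 * x ^ 2 * huu + 2 * y ^ 2 * hvv + 2 * z ^ 2 * hww + 4 * x * y * huv +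
      4 * x * z * huw + 4 * y * z * hvw
  refine exists_orthogonal_of_gramDet_eq_three (u := e 0) (v := e 1) (w := e 2) ?_ ?_ ?_
    ⟨hspan, ?_⟩ ?_
  · intro x y
    simp only [LinearMap.smul_apply, h.symm x y]
  · intro x hx
    rw [LinearMap.smul_apply, LinearMap.smul_apply, QuadraticMap.associated_eq_self_apply]
    have h5 : 0 ≤ Q x := by
      rw [hQ]
      positivity
    have h6 : Q x ≠ 0 := fun h => hx (hQ.eq_zero h)
    rw [smul_eq_mul]
    positivity
  · intro x hx y hy
    obtain ⟨_, _, _, hx'⟩ := h.span_enlargement hp0 hx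
    obtain ⟨_, _, _, hy'⟩ := h.span_enlargement hp0 hy
    obtain ⟨n, k, hn, -⟩ := h.exists_apply_enlargement hp0 hx hy hx' hy'
    refine ⟨n, ?_⟩
    rw [LinearMap.smul_apply, LinearMap.smul_apply, hn, smul_eq_mul]
    ring
  · rw [gramDet_eq_det_gram Q fun i => (e i : V), h3]
    norm_num
  · rintro x hx y hy ⟨n, hn⟩
    simp only [LinearMap.smul_apply, smul_eq_mul] at hn ⊢
    obtain ⟨k, hk⟩ := h.three_dvd_apply_enlargement hp0 hx hy ⟨n, by linarith⟩
    exact ⟨k, by rw [hk]; ring⟩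

/-- A frame whose Gram matrix is `diag(2, 2, 6)` gives new diagonal coordinates. -/
theorem IsDiagonal.exists_isometryEquiv_frame (hQ : IsDiagonal Q c) {u v w : V}
    (h : ∀ x y z : ℚ, Q (x • u + y • v + z • w) = 2 * x ^ 2 + 2 * y ^ 2 + 6 * z ^ 2) :
    ∃ σ : Q.IsometryEquiv Q,
      ∀ x, σ x = (c x).1 • u + (c x).2.1 • v + (c x).2.2 • w :=
  hQ.exists_isometryEquiv
    { toFun := fun x => (c x).1 • u + (c x).2.1 • v + (c x).2.2 • w
      map_add' := fun x y => by
        simp only [map_add, Prod.fst_add, Prod.snd_add]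
        module
      map_smul' := fun r x => by
        simp only [map_smul, Prod.smul_fst, Prod.smul_snd, smul_eq_mul, RingHom.id_apply]
        module }
    fun x => by rw [LinearMap.coe_mk, AddHom.coe_mk, h, hQ]

/-- The orthogonal frame of the enlargement defines an isometry σ. In the coordinates transported by
σ the enlargement is the standard lattice and M a model lattice, so M is the σ-image of the model
lattice in the original coordinates. -/
theorem IsDiagonal.exists_isometric_modelLattice (hQ : IsDiagonal Q c) {p : ℕ} [hp : Fact p.Prime]
    (hp3 : 3 < p) {L M : Submodule ℤ V} (hL : L.IsLattice ℚ) (hM : M ∈ genus Q L)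
    (b : Module.Basis (Fin 3) ℤ L)
    (hA : gram Q (fun i => (b i : V)) = (!![2, 0, -(p : ℤ); 0, 2, -(p : ℤ); -(p : ℤ), -(p : ℤ),
      7 * (p : ℤ) ^ 2]).map ((↑) : ℤ → ℚ)) :
    ∃ s ∈ quadricPoints (ZMod p), Isometric Q (modelLattice c s) M := by
  obtain ⟨f₁, f₂, f₃, d, h⟩ := exists_adaptedFrame hL hM b hp.out hp3 hA
  obtain ⟨m⟩ := exists_basis_of_isLattice hL hM.1 b
  have hdet := det_gram_eq_of_mem_genus hL hM b m hA
  obtain ⟨u, v, w, huvw, hf⟩ := h.exists_orthogonal_enlargement hQ hp.out hp3 hM.1 m (by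
    rw [hdet, Matrix.det_fin_three]
    simp
    ring)
  obtain ⟨σ, hσ⟩ := hQ.exists_isometryEquiv_frame hf
  let c' : V ≃ₗ[ℚ] ℚ × ℚ × ℚ := σ.toLinearEquiv.symm.trans c
  have hc' : ∀ x, c' (σ x) = c x := fun x => congrArg c (σ.toLinearEquiv.symm_apply_apply x)
  have hc'' : ∀ x, c' x = c (σ.symm x) := fun x => rfl
  have hQ' : IsDiagonal Q c' := fun x => by
    rw [hc'', ← hQ, QuadraticMap.IsometryEquiv.map_app]
  have hI : AdaptedFrame.enlargement (QuadraticMap.associated (R := ℚ) Q) p M f₁ f₂ f₃ = standardLattice c' := by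
    rw [← huvw]
    ext x
    rw [mem_standardLattice, Submodule.mem_span_triple]
    refine exists_congr fun a => exists_congr fun b => exists_congr fun e => ?_
    have h1 : σ (c.symm ((a : ℚ), (b : ℚ), (e : ℚ))) = a • u + b • v + e • w := by
      rw [hσ, LinearEquiv.apply_symm_apply]
      simp only [Int.cast_smul_eq_zsmul]
    rw [← h1]
    constructor
    · rintro rfl
      rw [hc', LinearEquiv.apply_symm_apply]
    · intro hx
      rw [hc''] at hx
      rw [← hx, LinearEquiv.symm_apply_apply, QuadraticMap.IsometryEquiv.apply_symm_apply]
  obtain ⟨s, hs, rfl⟩ := h.exists_eq_modelLattice hQ' hp3 hI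
  refine ⟨s, hs, σ, ?_⟩
  ext x
  constructor
  · rintro ⟨y, hy, rfl⟩
    rw [SetLike.mem_coe, mem_modelLattice, hc']
    exact hy
  · intro hx
    refine ⟨σ.symm x, ?_, QuadraticMap.IsometryEquiv.apply_symm_apply _ _⟩
    rw [SetLike.mem_coe, mem_modelLattice, ← hc'']
    exact hx

/-- The coordinates in which the form with the given Gram matrix is diagonal. -/
theorem exists_isDiagonal {L : Submodule ℤ V} (hL : L.IsLattice ℚ) (b : Module.Basis (Fin 3) ℤ L)
    {p : ℕ} (hp : p.Prime) (hp3 : 3 < p)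
    (hA : ∀ i j, QuadraticMap.associated (R := ℚ) Q (b i : V) (b j : V) =
      ((!![2, 0, -(p : ℤ); 0, 2, -(p : ℤ); -(p : ℤ), -(p : ℤ), 7 * (p : ℤ) ^ 2] :
        Matrix (Fin 3) (Fin 3) ℤ) i j : ℚ)) :
    ∃ c : V ≃ₗ[ℚ] ℚ × ℚ × ℚ, IsDiagonal Q c ∧
      L = modelLattice c ((0, 0, 1) : ZMod p × ZMod p × ZMod p) := by
  have hp0 : (p : ℚ) ≠ 0 := by exact_mod_cast hp.ne_zero
  let y := (b.extendOfIsLattice ℚ).equivFun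
  have hy : ∀ x : Fin 3 → ℚ, y.symm x = x 0 • (b 0 : V) + x 1 • (b 1 : V) + x 2 • (b 2 : V) := by
    intro x
    simp only [y, Module.Basis.equivFun_symm_apply, Fin.sum_univ_three,
      Module.Basis.extendOfIsLattice_apply]
  -- Completing the square: 2x₀² + 2x₁² + 7p²x₂² − 2p x₀x₂ − 2p x₁x₂ equals 2(x₀ − p x₂/2)² + 2(x₁ −
  -- p x₂/2)² + 6(p x₂)².
  let t : (Fin 3 → ℚ) ≃ₗ[ℚ] ℚ × ℚ × ℚ :=
    { toFun := fun x => (x 0 - p * x 2 / 2, x 1 - p * x 2 / 2, p * x 2)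
      map_add' := fun x x' => by
        ext <;> simp <;> ring
      map_smul' := fun r x => by
        ext <;> simp <;> ring
      invFun := fun w => ![w.1 + w.2.2 / 2, w.2.1 + w.2.2 / 2, w.2.2 / p]
      left_inv := fun x => by
        ext i
        fin_cases i <;> simp <;> field_simp
      right_inv := fun w => by
        ext <;> simp <;> field_simp <;> ring }
  have ht : ∀ x, t x = (x 0 - p * x 2 / 2, x 1 - p * x 2 / 2, p * x 2) := fun x => rfl
  refine ⟨y.trans t, ?_, ?_⟩
  · intro v
    obtain ⟨x, rfl⟩ := y.symm.surjective v
    rw [LinearEquiv.trans_apply, LinearEquiv.apply_symm_apply, ht, hy,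
      ← QuadraticMap.associated_eq_self_apply ℚ Q]
    simp only [map_add, map_smul, LinearMap.add_apply, LinearMap.smul_apply, smul_eq_mul, hA]
    simp
    ring
  · ext v
    have hv : v ∈ L ↔ ∃ a : Fin 3 → ℤ, ∀ i, y v i = a i := by
      constructor
      · intro hv
        refine ⟨fun i => b.repr ⟨v, hv⟩ i, fun i => ?_⟩
        have h1 : v = y.symm fun i => ((b.repr ⟨v, hv⟩ i : ℤ) : ℚ) := by
          rw [hy]
          have h2 := congrArg Subtype.val (b.sum_repr ⟨v, hv⟩)
          simp only [Fin.sum_univ_three] at h2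
          simp only [Int.cast_smul_eq_zsmul]
          exact h2.symm
        conv_lhs => rw [h1]
        rw [LinearEquiv.apply_symm_apply]
      · rintro ⟨a, ha⟩
        have h1 : v = y.symm fun i => (a i : ℚ) := by
          rw [LinearEquiv.eq_symm_apply]
          funext i
          exact ha i
        rw [h1, hy]
        simp only [Int.cast_smul_eq_zsmul]
        exact add_mem (add_mem (L.smul_mem _ (b 0).2) (L.smul_mem _ (b 1).2)) (L.smul_mem _ (b 2).2)
    rw [hv, mem_modelLattice, LinearEquiv.trans_apply, ht]
    have : Fact p.Prime := ⟨hp⟩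
    have h6 : (6 : ZMod p) ≠ 0 := by
      rw [show (6 : ZMod p) = ((2 : ℕ) : ZMod p) * ((3 : ℕ) : ZMod p) by norm_num]
      exact mul_ne_zero (natCast_zmod_ne_zero (by norm_num) (by omega))
        (natCast_zmod_ne_zero (by norm_num) hp3)
    obtain ⟨p', hp'⟩ : ∃ p' : ℤ, (p : ℤ) = 2 * p' + 1 := by
      have := Nat.odd_iff.1 (hp.odd_of_ne_two (by omega))
      exact ⟨p / 2, by omega⟩
    constructor
    · rintro ⟨a, ha⟩
      refine ⟨2 * a 0 - p * a 2, 2 * a 1 - p * a 2, p * a 2, ?_, ?_, ?_, by simp⟩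
      · rw [ha, ha, ha]
        push_cast
        ext <;> simp <;> ring
      · exact ⟨a 0 - p * a 2, by ring⟩
      · exact ⟨a 1 - p * a 2, by ring⟩
    · rintro ⟨i, j, k, h1, ⟨i', hi⟩, ⟨j', hj⟩, h2⟩
      simp only [mul_zero, zero_add, mul_one] at h2
      -- Orthogonality to (0, 0, 1) reads 6k ≡ 0 mod p, and 6 is a unit.
      obtain ⟨l, rfl⟩ := (ZMod.intCast_zmod_eq_zero_iff_dvd k p).1
        ((mul_eq_zero.1 h2).resolve_left h6)
      simp only [Prod.mk.injEq] at h1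
      obtain ⟨h3, h4, h5⟩ := h1
      have h7 : y v 2 = l := by
        apply mul_left_cancel₀ hp0
        rw [h5]
        push_cast
        rfl
      obtain rfl : i = p * l + 2 * i' := by linarith
      obtain rfl : j = p * l + 2 * j' := by linarith
      refine ⟨![p * l + i', p * l + j', l], fun n => ?_⟩
      rw [h7] at h3 h4
      push_cast at h3 h4
      fin_cases n
      · simp
        linarith
      · simp
        linarith
      · simpa using h7

/-- The map from s to its model lattice is injective from orbits to classes by
`isometric_modelLattice_iff`, and `hM` makes it surjective. -/
theorem classNumber_eq_card_orbits (hQ : IsDiagonal Q c) {p : ℕ} [hp : Fact p.Prime] (hp3 : 3 < p)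
    (hM : ∀ M ∈ genus Q (modelLattice c ((0, 0, 1) : ZMod p × ZMod p × ZMod p)),
      ∃ s ∈ quadricPoints (ZMod p), Isometric Q (modelLattice c s) M) :
    classNumber Q (modelLattice c ((0, 0, 1) : ZMod p × ZMod p × ZMod p)) =
      Nat.card (MulAction.orbitRel.Quotient SignedSwap (quadricPoints (ZMod p))) := by
  let φ : quadricPoints (ZMod p) →
      genus Q (modelLattice c ((0, 0, 1) : ZMod p × ZMod p × ZMod p)) :=
    fun s => ⟨modelLattice c s.1, hQ.modelLattice_mem_genus hp3 s.2⟩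
  have hφ : ∀ s t : quadricPoints (ZMod p),
      MulAction.orbitRel SignedSwap (quadricPoints (ZMod p)) s t ↔ genusSetoid Q _ (φ s) (φ t) := by
    intro s t
    change _ ↔ Isometric Q (modelLattice c s.1) (modelLattice c t.1)
    rw [hQ.isometric_modelLattice_iff hp3 s.2 t.2, Setoid.comm', MulAction.orbitRel_apply]
    refine exists_congr fun g => ?_
    rw [← Subtype.coe_inj, eq_comm]
    rfl
  refine (Nat.card_congr (Equiv.ofBijective
    (Quotient.map φ fun s t h => (hφ s t).1 h) ⟨?_, ?_⟩)).symm
  · rintro ⟨s⟩ ⟨t⟩ h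
    exact Quotient.sound ((hφ s t).2 (Quotient.exact h))
  · rintro ⟨M⟩
    obtain ⟨s, hs, h⟩ := hM M.1 M.2
    exact ⟨Quotient.mk _ ⟨s, hs⟩, Quotient.sound h⟩

end QuadraticSpace

theorem mainTheorem7 {V : Type*} [AddCommGroup V] [Module ℚ V] (Q : QuadraticForm ℚ V)
    (L : Submodule ℤ V) (hL : L.IsLattice ℚ) (p : ℕ) (hp : p.Prime) (hp3 : 3 < p)
    (hGram : QuadraticSpace.HasGramMatrix Q L
      !![2, 0, -(p : ℤ); 0, 2, -(p : ℤ); -(p : ℤ), -(p : ℤ), 7 * (p : ℤ) ^ 2]) :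
    (p % 24 = 1 ∨ p % 24 = 5 ∨ p % 24 = 13 ∨ p % 24 = 17 →
      (QuadraticSpace.classNumber Q L : ℚ) = ((p : ℚ) ^ 2 + 6 * p + 9) / 16) ∧
    (p % 24 = 7 →
      (QuadraticSpace.classNumber Q L : ℚ) = ((p : ℚ) ^ 2 + 4 * p + 3) / 16) ∧
    (p % 24 = 11 ∨ p % 24 = 19 →
      (QuadraticSpace.classNumber Q L : ℚ) = ((p : ℚ) ^ 2 + 4 * p + 11) / 16) ∧
    (p % 24 = 23 →
      (QuadraticSpace.classNumber Q L : ℚ) = ((p : ℚ) ^ 2 + 4 * p + 19) / 16) := by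
  have : Fact p.Prime := ⟨hp⟩
  obtain ⟨b, hb⟩ := hGram
  obtain ⟨c, hc, rfl⟩ := QuadraticSpace.exists_isDiagonal hL b hp hp3 hb
  have hcl := QuadraticSpace.classNumber_eq_card_orbits hc hp3 fun M hM =>
    hc.exists_isometric_modelLattice hp3 hL hM b (by
      ext i j
      exact hb i j)
  have key : ∀ x : ℤ, 16 * (Nat.card (MulAction.orbitRel.Quotient SignedSwap
      (quadricPoints (ZMod p))) : ℤ) = x →
      (QuadraticSpace.classNumber Q (QuadraticSpace.modelLattice c
        ((0, 0, 1) : ZMod p × ZMod p × ZMod p)) : ℚ) = (x : ℚ) / 16 := by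
    rintro x rfl
    rw [hcl]
    push_cast
    ring
  obtain ⟨h1, h2, h3, h4⟩ := card_orbits_quadricPoints_zmod hp3
  refine ⟨fun h => ?_, fun h => ?_, fun h => ?_, fun h => ?_⟩
  · rw [key _ (h1 h)]
    push_cast
    rfl
  · rw [key _ (h2 h)]
    push_cast
    rfl
  · rw [key _ (h3 h)]
    push_cast
    rfl
  · rw [key _ (h4 h)]
    push_cast
    rfl
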